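/- Let $(X,d)$ be a complete separable metric space and $\mathcal E:[0,\infty)\times X\to(-\infty,+\infty]$. For $\tau>0$ put $\mathbf E(t,\tau,u;v)=\mathcal E(t,v)+\frac{d^2(u,v)}{2\tau}$. Assume: E1. For each $t\ge 0$, $\mathcal E(t,\cdot)$ is proper and lower semicontinuous. E2. The domain $\mathbf D=\{u:\mathcal E(t,u)<\infty\}$ does not depend on $t$. E3. There are $u^*\in X$ and $0\le\beta\in L^1_{loc}([0,\infty))$ with $|\mathcal E(t,u)-\mathcal E(s,u)|\le\int_s^t\beta(r)\,dr\,(1+d^2(u,u^*))$ for all $u\in\mathbf D$ and $0\le s\le t$. E4. For each $T>0$ there are $u^*\in X$ and $\tau^*>0$ such that $t\mapsto\inf_{v\in X}\mathbf E(t,\tau^*,u^*;v)$ is bounded from below on $[0,T]$. E5. There is $\lambda\in L^\infty_{loc}([0,\infty))$, bounded from below on each $[0,T]$, such that, with $\lambda_T^-=\max\{-\inf_{[0,T]}\lambda,0\}$, for all $T>0$ and all $u,v_0,v_1\in X$ there is a curve $\gamma:[0,1]\to X$ with $\gamma(0)=v_0$, $\gamma(1)=v_1$ and $$\mathbf E(t,\tau,u;\gamma(s))\le(1-s)\mathbf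 E(t,\tau,u;v_0)+s\,\mathbf E(t,\tau,u;v_1)-\tfrac{1+\tau\lambda(t)}{2\tau}s(1-s)d^2(v_0,v_1)$$ for all $t\in[0,T]$, $0<\tau<1/\lambda_T^-$ (where $1/0=\infty$), $s\in[0,1]$. For a partition $\boldsymbol\tau=\{0=t^0<t^1<\cdots\}$ of $[0,\infty)$ with $t^n\to\infty$ and $|\boldsymbol\tau|=\sup_n(t^n-t^{n-1})$, and a datum $U^0_{\boldsymbol\tau}\in X$, let $U^n_{\boldsymbol\tau}$ be a minimizer of $v\mapsto\mathbf E(t^n,t^n-t^{n-1},U^{n-1}_{\boldsymbol\tau};v)$ for $n\ge1$, and let $\overline U_{\boldsymbol\tau}=U^n_{\boldsymbol\tau}$ and $\underline U_{\boldsymbol\tau}=U^{n-1}_{\boldsymbol\tau}$ on $(t^{n-1},t^n]$, $\overline U_{\boldsymbol\tau}(0)=\underline U_{\boldsymbol\tau}(0)=U^0_{\boldsymbol\tau}$. Let $u_0\in\mathbf D$, and let the data satisfy $d(U^0_{\boldsymbol\tau},u_0)\to0$ as $|\boldsymbol\tau|\to0$ and $\sup_{\boldsymbol\tau}\mathcal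 E(0,U^0_{\boldsymbol\tau})<\infty$. **Theorem.** For every $T>0$ the scheme is solvable up to time $T$ once $|\boldsymbol\tau|$ is small, and there is a limit $u:[0,\infty)\to X$ of $\overline U_{\boldsymbol\tau}$ and $\underline U_{\boldsymbol\tau}$, locally uniform in time, as $|\boldsymbol\tau|\to0$. The limit $u$ is locally absolutely continuous (that is, absolutely continuous on each $[0,T]$), its metric derivative $|u'|(t)=\lim_{s\to t}\frac{d(u(s),u(t))}{|s-t|}$ exists for almost every $t>0$, and $|u'|\in L^2_{loc}([0,\infty))$. Suppose moreover that for $u\in\mathbf D$ the function $t\mapsto\mathcal E(t,u)$ is differentiable on $[0,\infty)$ (one-sidedly at $0$), that $\partial_t\mathcal E(t,\cdot)$ is upper semicontinuous on $\mathbf D$ for each $t\ge 0$, and that $$t_n\downarrow t,\ d(u_n,u)\to0\ \Longrightarrow\ \liminf_{n\to\infty}\frac{\mathcal E(t_n,u_n)-\mathcal E(t,u_n)}{t_n-t}\ge\partial_t\mathcal E(t,u)$$ for $t\ge 0$, $t_n>t$ and $u_n,u\in\mathbf D$. Let $|\partial\mathcal E(t)|(u)=\limsup_{v\to u}\frac{(\mathcal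 E(t,u)-\mathcal E(t,v))^+}{d(u,v)}$ be the local slope of $\mathcal E(t,\cdot)$. Then $u(t)\in\mathbf D$ for all $t\ge0$, the function $t\mapsto\mathcal E(t,u(t))$ is locally absolutely continuous, $t\mapsto|\partial\mathcal E(t)|(u(t))$ is in $L^2_{loc}([0,\infty))$, $s\mapsto\partial_t\mathcal E(s,u(s))$ is in $L^1_{loc}([0,\infty))$, and for all $t\ge0$ $$\mathcal E(t,u(t))-\mathcal E(0,u(0))=\int_0^t\partial_t\mathcal E(s,u(s))\,ds-\frac12\int_0^t|u'|^2(s)\,ds-\frac12\int_0^t|\partial\mathcal E(s)|^2(u(s))\,ds .$$ In particular $u$ is a solution of the gradient flow of $\mathcal E$ with initial datum $u_0$ in the metric sense: $u$ and $t\mapsto\mathcal E(t,u(t))$ are locally absolutely continuous, $u(0)=u_0$, $|u'|$ and $|\partial\mathcal E(\cdot)|(u(\cdot))$ are in $L^2_{loc}([0,\infty))$, and for almost every $t>0$ $$\frac{d}{dt}\mathcal E(t,u(t))\le\partial_t\mathcal E(t,u(t))-\tfrac12|\partial\mathcal E(t)|^2(u(t))-\tfrac12|u'|^2(t).$$ 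-/

import Mathlib

open Set Filter Topology MeasureTheory
open scoped ENNReal

namespace TimeGradFlow

noncomputable section

variable {X : Type*} [MetricSpace X]

/-! A time-dependent functional `[0,∞) × X → (-∞,+∞]` is modelled by `E : ℝ → X → EReal`; only the
values `E t u` with `0 ≤ t` matter, and `HypE1` contains the requirement that they are not `-∞`. -/

/-- The domain of `E(t,·)`, which does not depend on `t ≥ 0` under `HypE2`. -/
def dom (E : ℝ → X → EReal) : Set X := {u | E 0 u < ⊤}

/-- The functional `v ↦ E(t,v) + d²(u,v)/(2τ)`. -/
def penalized (E : ℝ → X → EReal) (t τ : ℝ) (u v : X) : EReal :=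
  E t v + ((dist u v ^ 2 / (2 * τ) : ℝ) : EReal)

/-- The Moreau-Yosida approximation of `E(t,·)`. -/
def moreauYosida (E : ℝ → X → EReal) (t τ : ℝ) (u : X) : EReal :=
  ⨅ v : X, penalized E t τ u v

/-- `λ_T⁻ = max {-inf_{[0,T]} λ, 0}`. -/
def lamMinus (lam : ℝ → ℝ) (T : ℝ) : ℝ := max (-sInf (lam '' Icc 0 T)) 0

/-- Each `E(t,·)` has values in `(-∞,+∞]`, is proper and lower semicontinuous. -/
def HypE1 (E : ℝ → X → EReal) : Prop :=
  ∀ t, 0 ≤ t → (∀ u, E t u ≠ ⊥) ∧ (∃ u, E t u < ⊤) ∧ LowerSemicontinuous (E t)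

/-- The domain of `E(t,·)` is independent of time. -/
def HypE2 (E : ℝ → X → EReal) : Prop :=
  ∀ t, 0 ≤ t → {u | E t u < ⊤} = dom E

/-- Absolute continuity in time, with a modulus of quadratic growth in space. -/
def HypE3 (E : ℝ → X → EReal) : Prop :=
  ∃ (ustar : X) (β : ℝ → ℝ), (∀ t, 0 ≤ t → 0 ≤ β t) ∧ LocallyIntegrableOn β (Ici 0) ∧
    ∀ u ∈ dom E, ∀ s t, 0 ≤ s → s ≤ t →
      |(E t u).toReal - (E s u).toReal| ≤ (∫ r in s..t, β r) * (1 + dist u ustar ^ 2)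

/-- Some Moreau-Yosida approximation is bounded from below, locally uniformly in time. -/
def HypE4 (E : ℝ → X → EReal) : Prop :=
  ∀ T, 0 < T → ∃ (ustar : X) (τstar : ℝ), 0 < τstar ∧
    ∃ m : ℝ, ∀ t ∈ Icc 0 T, (m : EReal) ≤ moreauYosida E t τstar ustar

/-- Convexity of the penalized functionals along suitable curves. The function `λ` is in
`L^∞_loc([0,∞))`, with a finite infimum on each `[0,T]`, so that `λ_T⁻ < ∞`. The condition
`τ * λ_T⁻ < 1` is `τ < 1 / λ_T⁻`, with `1 / 0 = ∞`. -/
def HypE5 (E : ℝ → X → EReal) : Prop :=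
  ∃ lam : ℝ → ℝ,
    (∀ T, 0 < T → MemLp lam ⊤ (volume.restrict (Icc 0 T)) ∧ BddBelow (lam '' Icc 0 T)) ∧
    ∀ T, 0 < T → ∀ u v₀ v₁ : X, ∃ γ : ℝ → X, γ 0 = v₀ ∧ γ 1 = v₁ ∧
      ∀ t ∈ Icc 0 T, ∀ τ, 0 < τ → τ * lamMinus lam T < 1 → ∀ s ∈ Icc (0 : ℝ) 1,
        penalized E t τ u (γ s) ≤
          ((1 - s : ℝ) : EReal) * penalized E t τ u v₀ + (s : EReal) * penalized E t τ u v₁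
            - (((1 + τ * lam t) / (2 * τ) * s * (1 - s) * dist v₀ v₁ ^ 2 : ℝ) : EReal)

/-- A partition `0 = t⁰ < t¹ < ⋯` of `[0,∞)` with `tⁿ → ∞`. -/
structure TimePartition where
  node : ℕ → ℝ
  node_zero : node 0 = 0
  strictMono : StrictMono node
  tendsto : Tendsto node atTop atTop

/-- The mesh size `|τ| = sup_n (tⁿ - tⁿ⁻¹)`. -/
def TimePartition.mesh (P : TimePartition) : ℝ≥0∞ :=
  ⨆ n, ENNReal.ofReal (P.node (n + 1) - P.node n)

/-- The filter of partitions along `|τ| → 0`. -/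
def meshToZero : Filter TimePartition := comap TimePartition.mesh (𝓝 0)

/-- `n` with `tⁿ⁻¹ < t ≤ tⁿ` for `t > 0`, and `0` for `t = 0`. -/
def TimePartition.index (P : TimePartition) (t : ℝ) : ℕ := sInf {n | t ≤ P.node n}

/-- `U` solves the implicit scheme with initial datum `x` up to the time `T`: for every `n` with
`tⁿ < T` the point `Uⁿ⁺¹` minimizes `v ↦ E(tⁿ⁺¹,v) + d²(Uⁿ,v)/(2(tⁿ⁺¹-tⁿ))`. -/
def IsDiscreteSolution (E : ℝ → X → EReal) (P : TimePartition) (x : X) (T : ℝ) (U : ℕ → X) :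
    Prop :=
  U 0 = x ∧ ∀ n, P.node n < T → ∀ v,
    penalized E (P.node (n + 1)) (P.node (n + 1) - P.node n) (U n) (U (n + 1)) ≤
      penalized E (P.node (n + 1)) (P.node (n + 1) - P.node n) (U n) v

/-- The approximate solution equal to `Uⁿ` on `(tⁿ⁻¹,tⁿ]`, and to `U⁰` at `0`. -/
def upperInterp (P : TimePartition) (U : ℕ → X) (t : ℝ) : X := U (P.index t)

/-- The approximate solution equal to `Uⁿ⁻¹` on `(tⁿ⁻¹,tⁿ]`, and to `U⁰` at `0`. -/
def lowerInterp (P : TimePartition) (U : ℕ → X) (t : ℝ) : X := U (P.index t - 1)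

/-- `u : [0,∞) → X` is the limit of the implicit scheme with initial data `U0 P`: for every `T`, as
`|P| → 0`, the scheme is solvable up to time `T` and both approximate solutions converge to `u`
uniformly on `[0,T]`. -/
def IsSchemeLimit (E : ℝ → X → EReal) (U0 : TimePartition → X) (u : ℝ → X) : Prop :=
  ∀ T, 0 < T → ∀ ε, 0 < ε → ∀ᶠ P in meshToZero,
    (∃ U, IsDiscreteSolution E P (U0 P) T U) ∧
    ∀ U, IsDiscreteSolution E P (U0 P) T U → ∀ t ∈ Icc 0 T,
      dist (upperInterp P U t) (u t) < ε ∧ dist (lowerInterp P U t) (u t) < ε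

/-- The local slope `limsup_{v → u} (φ(u) - φ(v))⁺ / d(u,v)`, equal to `+∞` where `φ = +∞`. -/
def localSlope (φ : X → EReal) (u : X) : ℝ≥0∞ :=
  open Classical in
  if φ u = ⊤ then ⊤ else limsup (fun v => (φ u - φ v).toENNReal / edist u v) (𝓝[≠] u)

/-- The metric derivative `lim_{s → t} d(u(s),u(t)) / |s - t|` (meaningful where the limit
exists). -/
def metricDeriv (u : ℝ → X) (t : ℝ) : ℝ :=
  limUnder (𝓝[≠] t) (fun s => dist (u s) (u t) / |s - t|)

/-- `∂_t E(t,u)` as a function on `[0,∞)`, one-sided at `t = 0`. -/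
def timeDeriv (E : ℝ → X → EReal) (t : ℝ) (u : X) : ℝ :=
  derivWithin (fun s => (E s u).toReal) (Ici 0) t

/-- Absolute continuity on each `[0,T]`. -/
def LocAbsCont {Y : Type*} [MetricSpace Y] (f : ℝ → Y) : Prop :=
  ∀ T, 0 < T → AbsolutelyContinuousOnInterval f 0 T

/-- Solutions of the gradient flow of `E` from `u₀` in the metric sense. -/
structure IsSolution (E : ℝ → X → EReal) (u₀ : X) (u : ℝ → X) : Prop where
  locAbsCont : LocAbsCont u
  initial : u 0 = u₀
  mem_dom : ∀ t, 0 ≤ t → E t (u t) < ⊤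
  energy_locAbsCont : LocAbsCont (fun t => (E t (u t)).toReal)
  metricDeriv_sq : ∀ T, 0 < T → MemLp (metricDeriv u) 2 (volume.restrict (Icc 0 T))
  slope_sq : ∀ T, 0 < T →
    MemLp (fun t => localSlope (E t) (u t)) 2 (volume.restrict (Icc 0 T))
  inequality : ∀ᵐ t ∂(volume.restrict (Ioi (0 : ℝ))),
    ∃ e' : ℝ, HasDerivAt (fun s => (E s (u s)).toReal) e' t ∧
      e' ≤ timeDeriv E t (u t) - 1 / 2 * (localSlope (E t) (u t)).toReal ^ 2
        - 1 / 2 * metricDeriv u t ^ 2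

/-- The additional regularity in time: `t ↦ E(t,u)` is differentiable on `[0,∞)` for `u` in the
domain, `∂_t E(t,·)` is upper semicontinuous on the domain, and the liminf condition holds along
`t_n ↓ t`, `u_n → u` (in the domain, where the difference quotients make sense). -/
structure TimeRegular (E : ℝ → X → EReal) : Prop where
  differentiable : ∀ u ∈ dom E, DifferentiableOn ℝ (fun t => (E t u).toReal) (Ici 0)
  upperSemicontinuous : ∀ t, 0 ≤ t → UpperSemicontinuousOn (timeDeriv E t) (dom E)
  liminf_ge : ∀ t, 0 ≤ t → ∀ u ∈ dom E, ∀ (tn : ℕ → ℝ) (un : ℕ → X),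
    Antitone tn → (∀ n, t < tn n) → Tendsto tn atTop (𝓝 t) →
    (∀ n, un n ∈ dom E) → Tendsto un atTop (𝓝 u) →
    ((timeDeriv E t u : ℝ) : EReal) ≤
      liminf (fun n =>
        ((((E (tn n) (un n)).toReal - (E t (un n)).toReal) / (tn n - t) : ℝ) : EReal)) atTop

end

end TimeGradFlow

open TimeGradFlow

/-! Convexity of the penalized functionals turns the minimality of one step into a discrete
evolution variational inequality (`IsStepMin.evi`): if `y` minimizes the step of length `τ` from
`x`, then `(1 - τκ) d²(y,v) + d²(x,y) ≤ d²(x,v) + 2τ (φ(t,v) - φ(t,y))` for every `v` in the domain.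
Everything rests on this inequality. Along the scheme started at `u₀`, energy dissipation gives
bounds uniform in the partition, and the inequality can be summed over many steps with an error
governed by the increment of `ω(t) = B(t) + t`, where `B` is a multiple of the primitive of `β`
(`Scheme.multistep_evi`, `LocalHyp.exists_eviCurve`). The resulting notion `EVICurve` is stable
under limits (`EVICurve.of_tendsto`).

Convergence: test the inequality of a curve `w` with the new point of a scheme, and that of the
scheme with the old point of `w`. The energy of the scheme cancels and that of `w` telescopes, so
Gronwall's lemma gives `d²(Uⁿ, w(tⁿ)) ≤ K (d²(U⁰, w(0)) + δ)`, where `K` does not depend on the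
scheme (`LocalHyp.exists_comparison`). Dyadic partitions are nested, so dyadic solutions can be
compared with each other; they converge to an `EVICurve` (`exists_global_eviCurve`). Comparing this
limit with the scheme on an arbitrary partition yields the scheme limit
(`isSchemeLimit_of_eviCurve`).

Regularity: testing with an earlier point of the curve gives `d²(u(t),u(s)) ≤ (t - s)(g(t) - g(s))`
with `g` monotone. Hence `u` is absolutely continuous and `|u'|² ≤ g'` almost everywhere
(`exists_metric_derivative`). Letting `s` increase to `t` bounds the slope by `|u'|`
(`EVICurve.slope_bound`), and an averaging argument makes the energy `e(t)` absolutely continuous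
(`sub_le_of_ae_sub_le`).

Energy identity: let `G` be the slope and `p` the partial time derivative. Integrating the
differential inequality for `d²(u(·),u(t))` to second order gives `|u'|² ≤ p - e'`
(`EVICurve.sq_metricDeriv_le`); the liminf condition gives `p - G|u'| ≤ e'`
(`sub_mul_le_of_liminf`). As `G ≤ |u'|`, these force `G = |u'|` and `e' = p - |u'|²` almost
everywhere, which is then integrated. -/

namespace TimeGradFlow

/-! ### Real-valued hypotheses, one minimization step, discrete Gronwall -/

variable {X : Type*} [MetricSpace X]

/-- The hypotheses on the functional on a bounded time interval `[0,H]`, in terms of its real values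
`φ` on its domain `D`. -/
structure LocalHyp (φ : ℝ → X → ℝ) (D : Set X) (o : X) (B : ℝ → ℝ) (A κ H : ℝ) : Prop where
  horizon_pos : 0 < H
  base_mem : o ∈ D
  lower_nonneg : 0 ≤ A
  kappa_nonneg : 0 ≤ κ
  mono : Monotone B
  continuous : Continuous B
  absCont : AbsolutelyContinuousOnInterval B 0 H
  isClosed_sublevel : ∀ t ∈ Icc 0 H, ∀ c, IsClosed {u | u ∈ D ∧ φ t u ≤ c}
  time : ∀ u ∈ D, ∀ s t, 0 ≤ s → s ≤ t → t ≤ H →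
    |φ t u - φ s u| ≤ (B t - B s) * (1 + dist u o ^ 2)
  lower : ∀ t ∈ Icc 0 H, ∀ v ∈ D, -A * (1 + dist v o ^ 2) ≤ φ t v
  convex : ∀ u, ∀ v₀ ∈ D, ∀ v₁ ∈ D, ∃ γ : ℝ → X, ∀ t ∈ Icc 0 H, ∀ τ, 0 < τ → τ * κ < 1 →
    ∀ s ∈ Icc (0 : ℝ) 1, γ s ∈ D ∧
      φ t (γ s) + dist u (γ s) ^ 2 / (2 * τ) ≤
        (1 - s) * (φ t v₀ + dist u v₀ ^ 2 / (2 * τ)) + s * (φ t v₁ + dist u v₁ ^ 2 / (2 * τ))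
          - (1 - τ * κ) / (2 * τ) * s * (1 - s) * dist v₀ v₁ ^ 2

/-- `y` minimizes `v ↦ φ(t,v) + d²(x,v)/(2τ)` on `D`. -/
def IsStepMin (φ : ℝ → X → ℝ) (D : Set X) (t τ : ℝ) (x y : X) : Prop :=
  y ∈ D ∧ ∀ v ∈ D, φ t y + dist x y ^ 2 / (2 * τ) ≤ φ t v + dist x v ^ 2 / (2 * τ)

section Step

variable {φ : ℝ → X → ℝ} {D : Set X} {o : X} {B : ℝ → ℝ} {A κ H : ℝ}

/-- First-order optimality: compare `y` with the point `γ s` of the convexity curve for the pair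
`y`, `v`, divide by `s` and let `s` decrease to `0`. -/
theorem IsStepMin.evi (h : LocalHyp φ D o B A κ H) {t τ : ℝ} {x y : X}
    (hy : IsStepMin φ D t τ x y) (ht : t ∈ Icc 0 H) (hτ : 0 < τ) (hτκ : τ * κ < 1)
    {v : X} (hv : v ∈ D) :
    (1 - τ * κ) * dist y v ^ 2 + dist x y ^ 2 ≤ dist x v ^ 2 + 2 * τ * (φ t v - φ t y) := by
  obtain ⟨γ, hγ⟩ := h.convex x y hy.1 v hv
  set k := (1 - τ * κ) / (2 * τ) with hk
  have key : ∀ s ∈ Ioo (0 : ℝ) 1, φ t y + dist x y ^ 2 / (2 * τ) ≤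
      φ t v + dist x v ^ 2 / (2 * τ) - k * (1 - s) * dist y v ^ 2 := by
    intro s hs
    obtain ⟨h1, h2⟩ := hγ t ht τ hτ hτκ s ⟨hs.1.le, hs.2.le⟩
    have h3 := hy.2 _ h1
    have h4 : s * (φ t y + dist x y ^ 2 / (2 * τ)) ≤
      s * (φ t v + dist x v ^ 2 / (2 * τ) - k * (1 - s) * dist y v ^ 2) := by linarith
    exact le_of_mul_le_mul_left h4 hs.1
  have lim : Tendsto (fun s : ℝ => φ t v + dist x v ^ 2 / (2 * τ) - k * (1 - s) * dist y v ^ 2)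
      (𝓝[>] 0) (𝓝 (φ t v + dist x v ^ 2 / (2 * τ) - k * (1 - 0) * dist y v ^ 2)) := by
    apply Tendsto.mono_left _ nhdsWithin_le_nhds
    apply Continuous.tendsto
    fun_prop
  have h5 := ge_of_tendsto lim (by
    filter_upwards [Ioo_mem_nhdsGT (zero_lt_one' ℝ)] with s hs using key s hs)
  have h6 : (2 * τ) * (φ t y + dist x y ^ 2 / (2 * τ)) ≤
      (2 * τ) * (φ t v + dist x v ^ 2 / (2 * τ) - k * (1 - 0) * dist y v ^ 2) := by gcongr
  have e1 : (2 * τ) * (φ t y + dist x y ^ 2 / (2 * τ)) = 2 * τ * φ t y + dist x y ^ 2 := by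
    field_simp
  have e2 : (2 * τ) * (φ t v + dist x v ^ 2 / (2 * τ) - k * (1 - 0) * dist y v ^ 2)
      = 2 * τ * φ t v + dist x v ^ 2 - (1 - τ * κ) * dist y v ^ 2 := by
    rw [hk]; field_simp; ring
  rw [e1, e2] at h6
  linarith

theorem dist_sq_le_two_mul (x y z : X) : dist x z ^ 2 ≤ 2 * dist x y ^ 2 + 2 * dist y z ^ 2 := by
  have h := dist_triangle x y z
  nlinarith [sq_nonneg (dist x y - dist y z), dist_nonneg (x := x) (y := z)]

/-- Convexity at the midpoint `s = 1/2` makes almost-minimizers close to each other, so a minimizing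
sequence is Cauchy and no compactness is needed. The condition `4 * A * τ ≤ 1` lets the penalty
absorb the quadratic lower bound. -/
theorem exists_isStepMin [CompleteSpace X] (h : LocalHyp φ D o B A κ H) {t τ : ℝ} (x : X)
    (ht : t ∈ Icc 0 H) (hτ : 0 < τ) (hτκ : τ * κ < 1) (hτA : 4 * A * τ ≤ 1) :
    ∃ y, IsStepMin φ D t τ x y := by
  set P : X → ℝ := fun v => φ t v + dist x v ^ 2 / (2 * τ) with hP
  have hbdd : BddBelow (P '' D) := by
    refine ⟨-A - 2 * A * dist x o ^ 2, ?_⟩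
    rintro _ ⟨v, hv, rfl⟩
    have h1 := h.lower t ht v hv
    have h2 := dist_sq_le_two_mul v x o
    have h3 : 2 * A * dist x v ^ 2 ≤ dist x v ^ 2 / (2 * τ) := by
      rw [le_div_iff₀ (by positivity)]
      nlinarith [sq_nonneg (dist x v)]
    have h4 := mul_le_mul_of_nonneg_left h2 h.lower_nonneg
    rw [dist_comm v x] at h4
    simp only [hP]
    nlinarith
  have hne : (P '' D).Nonempty := ⟨_, o, h.base_mem, rfl⟩
  set I := sInf (P '' D) with hI
  have hIle : ∀ v ∈ D, I ≤ P v := fun v hv => csInf_le hbdd ⟨v, hv, rfl⟩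
  have hseq : ∀ n : ℕ, ∃ v ∈ D, P v < I + 1 / (n + 1 : ℝ) := by
    intro n
    obtain ⟨_, ⟨v, hv, rfl⟩, hlt⟩ := exists_lt_of_csInf_lt hne
      (show sInf (P '' D) < I + 1 / (n + 1 : ℝ) by rw [← hI]; have := Nat.one_div_pos_of_nat (α := ℝ) (n := n); linarith)
    exact ⟨v, hv, hlt⟩
  choose v hvD hvlt using hseq
  set k := (1 - τ * κ) / (2 * τ) with hk
  have hkpos : 0 < k := div_pos (by linarith) (by positivity)
  have hcau : CauchySeq v := by
    refine cauchySeq_of_le_tendsto_0 (fun N : ℕ => Real.sqrt (4 / k * (1 / (N + 1 : ℝ)))) ?_ ?_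
    · intro n m N hn hm
      apply Real.le_sqrt_of_sq_le
      obtain ⟨γ, hγ⟩ := h.convex x (v n) (hvD n) (v m) (hvD m)
      obtain ⟨h1, h2⟩ := hγ t ht τ hτ hτκ (1 / 2) (by norm_num)
      have h3 := hIle _ h1
      have hn' : 1 / (n + 1 : ℝ) ≤ 1 / (N + 1 : ℝ) := Nat.one_div_le_one_div hn
      have hm' : 1 / (m + 1 : ℝ) ≤ 1 / (N + 1 : ℝ) := Nat.one_div_le_one_div hm
      have h4 := hvlt n
      have h5 := hvlt m
      simp only [hP] at h3 h4 h5
      have h6 : k * dist (v n) (v m) ^ 2 ≤ 4 * (1 / (N + 1 : ℝ)) := by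
        rw [← hk] at h2
        nlinarith
      rw [div_mul_eq_mul_div, le_div_iff₀ hkpos]
      linarith
    · have := (tendsto_one_div_add_atTop_nhds_zero_nat (𝕜 := ℝ)).const_mul (4 / k)
      simpa using this.sqrt
  obtain ⟨y, hy⟩ := cauchySeq_tendsto_of_complete hcau
  have hle : ∀ ε > 0, y ∈ D ∧ φ t y ≤ I - dist x y ^ 2 / (2 * τ) + ε := by
    intro ε hε
    refine (h.isClosed_sublevel t ht _).mem_of_tendsto hy ?_
    have l1 : Tendsto (fun n : ℕ => I + 1 / (n + 1 : ℝ) - dist x (v n) ^ 2 / (2 * τ)) atTop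
        (𝓝 (I + 0 - dist x y ^ 2 / (2 * τ))) := by
      refine (tendsto_const_nhds.add tendsto_one_div_add_atTop_nhds_zero_nat).sub ?_
      exact ((tendsto_const_nhds.dist hy).pow 2).div_const _
    filter_upwards [l1.eventually_lt_const
      (show I + 0 - dist x y ^ 2 / (2 * τ) < I - dist x y ^ 2 / (2 * τ) + ε by linarith)] with n hn
    refine ⟨hvD n, ?_⟩
    have := hvlt n
    simp only [hP] at this
    linarith
  refine ⟨y, (hle 1 one_pos).1, fun w hw => ?_⟩
  have h1 : φ t y ≤ I - dist x y ^ 2 / (2 * τ) := le_of_forall_pos_le_add fun ε hε => (hle ε hε).2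
  have h2 := hIle w hw
  simp only [hP] at h2
  linarith

end Step

/-- As long as `c τ ≤ 1/2`, one has `1/(1 - cτ) ≤ 1 + 2cτ ≤ exp(2cτ)`; this is the origin of the
doubled rate. -/
theorem discrete_gronwall {c : ℝ} (hc : 0 ≤ c) {t x y : ℕ → ℝ} {N : ℕ} (ht0 : t 0 = 0)
    (ht : ∀ n < N, 0 ≤ t (n + 1) - t n) (hct : ∀ n < N, c * (t (n + 1) - t n) ≤ 1 / 2)
    (hx : ∀ n, 0 ≤ x n) (hy : ∀ n < N, 0 ≤ y n)
    (h : ∀ n < N, (1 - c * (t (n + 1) - t n)) * x (n + 1) ≤ x n + y n) :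
    ∀ n ≤ N, x n ≤ Real.exp (2 * c * t n) * (x 0 + ∑ k ∈ Finset.range n, y k) := by
  have htn : ∀ n ≤ N, 0 ≤ t n := by
    intro n
    induction n with
    | zero => intro _; exact ht0.ge
    | succ n ih => intro hn; linarith [ih (by omega), ht n hn]
  intro n
  induction n with
  | zero => intro _; simp [ht0]
  | succ n ih =>
    intro hn
    have hn' : n < N := hn
    have ih := ih hn'.le
    set τ := t (n + 1) - t n with hτ
    have h0 := ht n hn'
    have h1 := hct n hn'
    have h2 := h n hn'
    have h3 : x (n + 1) ≤ (1 + 2 * (c * τ)) * (x n + y n) := by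
      have e : 1 ≤ (1 + 2 * (c * τ)) * (1 - c * τ) := by nlinarith [mul_nonneg hc h0]
      calc x (n + 1) ≤ ((1 + 2 * (c * τ)) * (1 - c * τ)) * x (n + 1) :=
            le_mul_of_one_le_left (hx _) e
        _ = (1 + 2 * (c * τ)) * ((1 - c * τ) * x (n + 1)) := by ring
        _ ≤ _ := mul_le_mul_of_nonneg_left h2 (by nlinarith [mul_nonneg hc h0])
    have h4 : 1 + 2 * (c * τ) ≤ Real.exp (2 * c * τ) := by
      have := Real.add_one_le_exp (2 * c * τ); linarith
    have h5 : 1 ≤ Real.exp (2 * c * t n) :=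
      Real.one_le_exp (mul_nonneg (by positivity) (htn n hn'.le))
    have h6 : y n ≤ Real.exp (2 * c * t n) * y n := le_mul_of_one_le_left (hy n hn') h5
    have h7 : 0 ≤ x n + y n := add_nonneg (hx n) (hy n hn')
    calc x (n + 1) ≤ (1 + 2 * (c * τ)) * (x n + y n) := h3
      _ ≤ Real.exp (2 * c * τ) * (x n + y n) := mul_le_mul_of_nonneg_right h4 h7
      _ ≤ Real.exp (2 * c * τ) *
          (Real.exp (2 * c * t n) * (x 0 + ∑ k ∈ Finset.range n, y k) +
            Real.exp (2 * c * t n) * y n) := by gcongr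
      _ = Real.exp (2 * c * t (n + 1)) * (x 0 + ∑ k ∈ Finset.range (n + 1), y k) := by
        rw [Finset.sum_range_succ, show 2 * c * t (n + 1) = 2 * c * τ + 2 * c * t n by
          rw [hτ]; ring, Real.exp_add]
        ring

end TimeGradFlow

/-! ### A priori estimates for the implicit scheme -/

namespace TimeGradFlow

variable {X : Type*} [MetricSpace X]

/-- The modulus of time-regularity. -/
def modulus (B : ℝ → ℝ) (t : ℝ) : ℝ := B t + t

/-- `w` satisfies on the set of times `S` a finite-difference form of the evolution variational
inequality, with uniform bounds. -/
structure EVICurve (φ : ℝ → X → ℝ) (D : Set X) (o : X) (B : ℝ → ℝ) (κ C : ℝ) (S : Set ℝ)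
    (w : ℝ → X) : Prop where
  mem : ∀ t ∈ S, w t ∈ D
  dist_sq_le : ∀ t ∈ S, dist (w t) o ^ 2 ≤ C
  abs_energy_le : ∀ t ∈ S, |φ t (w t)| ≤ C
  holder : ∀ s ∈ S, ∀ t ∈ S, s ≤ t → dist (w t) (w s) ^ 2 ≤ C * (t - s)
  evi : ∀ v ∈ D, ∀ s ∈ S, ∀ t ∈ S, s ≤ t →
    dist (w t) v ^ 2 - dist (w s) v ^ 2 ≤
      (t - s) * (2 * (φ t v - φ t (w t)) + 2 * κ * dist (w t) v ^ 2 +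
        C * (1 + dist v o ^ 2) * (modulus B t - modulus B s))

/-- `U` solves the implicit scheme on the nodes `t 0 = 0 < ⋯ < t N ≤ H`, with mesh at most `δ`. -/
structure Scheme (φ : ℝ → X → ℝ) (D : Set X) (H δ : ℝ) (t : ℕ → ℝ) (U : ℕ → X) (N : ℕ) :
    Prop where
  zero : t 0 = 0
  strictMono : StrictMono t
  le_horizon : t N ≤ H
  mesh : ∀ n < N, t (n + 1) - t n ≤ δ
  step : ∀ n < N, IsStepMin φ D (t (n + 1)) (t (n + 1) - t n) (U n) (U (n + 1))

variable {φ : ℝ → X → ℝ} {D : Set X} {o : X} {B : ℝ → ℝ} {A κ H δ : ℝ}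
  {t : ℕ → ℝ} {U : ℕ → X} {N : ℕ}

theorem Scheme.mem_Icc (hS : Scheme φ D H δ t U N) {n : ℕ} (hn : n ≤ N) : t n ∈ Icc 0 H :=
  ⟨hS.zero ▸ hS.strictMono.monotone n.zero_le, (hS.strictMono.monotone hn).trans hS.le_horizon⟩

theorem Scheme.sub_pos (hS : Scheme φ D H δ t U N) (n : ℕ) : 0 < t (n + 1) - t n :=
  _root_.sub_pos.2 (hS.strictMono n.lt_succ_self)

theorem Scheme.mem (hS : Scheme φ D H δ t U N) (h0 : U 0 ∈ D) {n : ℕ} (hn : n ≤ N) : U n ∈ D := by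
  cases n with
  | zero => exact h0
  | succ n => exact (hS.step n hn).1

theorem Scheme.evi (hS : Scheme φ D H δ t U N) (h : LocalHyp φ D o B A κ H) (hδκ : δ * κ < 1)
    {n : ℕ} (hn : n < N) {v : X} (hv : v ∈ D) :
    (1 - κ * (t (n + 1) - t n)) * dist (U (n + 1)) v ^ 2 ≤
      dist (U n) v ^ 2 + 2 * (t (n + 1) - t n) * (φ (t (n + 1)) v - φ (t (n + 1)) (U (n + 1))) := by
  have h1 := (hS.step n hn).evi h (hS.mem_Icc hn) (hS.sub_pos n)
    ((mul_le_mul_of_nonneg_right (hS.mesh n hn) h.kappa_nonneg).trans_lt hδκ) hv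
  nlinarith [sq_nonneg (dist (U n) (U (n + 1)))]

/-- Uniform bound on the distance from the base point. -/
theorem Scheme.dist_sq_le (hS : Scheme φ D H δ t U N) (h : LocalHyp φ D o B A κ H)
    (hδ : (κ + 2 * A) * δ ≤ 1 / 2) (hδκ : δ * κ < 1) (h0 : U 0 = o) {n : ℕ} (hn : n ≤ N) :
    dist (U n) o ^ 2 ≤ Real.exp (2 * (κ + 2 * A) * H) *
      (2 * (|φ 0 o + (B H - B 0)| + A) * H) := by
  set M := |φ 0 o + (B H - B 0)| with hM
  have hA := h.lower_nonneg
  have hκ := h.kappa_nonneg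
  have hH := h.horizon_pos
  have hM0 : 0 ≤ M := abs_nonneg _
  -- The one-step inequality is tested with `o`. The quadratic lower bound on the energy adds `2 *
  -- A` to the Gronwall rate, and `M` bounds the energy of `o` at all nodes.
  have key := discrete_gronwall (c := κ + 2 * A) (by positivity) (x := fun n => dist (U n) o ^ 2)
    (y := fun n => 2 * (M + A) * (t (n + 1) - t n)) (N := N) hS.zero
    (fun n _ => (hS.sub_pos n).le)
    (fun n hn => (mul_le_mul_of_nonneg_left (hS.mesh n hn) (by positivity)).trans hδ)
    (fun n => by positivity)
    (fun n _ => mul_nonneg (by positivity) (hS.sub_pos n).le)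
    (fun n hn => by
      have h1 := hS.evi h hδκ hn h.base_mem
      have h2 := hS.mem_Icc (n := n + 1) hn
      have h3 := h.lower _ h2 _ (hS.step n hn).1
      have h4 : φ (t (n + 1)) o ≤ M := by
        have h5 := (abs_le.1 (h.time o h.base_mem 0 _ le_rfl h2.1 h2.2)).2
        have h6 := h.mono h2.2
        rw [dist_self] at h5
        refine le_trans ?_ (le_abs_self _)
        linarith
      have h7 := hS.sub_pos n
      have h8 : 2 * (t (n + 1) - t n) * (φ (t (n + 1)) o - φ (t (n + 1)) (U (n + 1))) ≤
          2 * (t (n + 1) - t n) * (M + A * (1 + dist (U (n + 1)) o ^ 2)) := by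
        gcongr; linarith
      nlinarith) n hn
  refine key.trans ?_
  simp only [h0, dist_self]
  rw [← Finset.mul_sum, Finset.sum_range_sub, hS.zero]
  have h2 := hS.mem_Icc hn
  have h3 : 0 ≤ κ + 2 * A := by positivity
  have h4 : (0 : ℝ) ^ 2 + 2 * (M + A) * (t n - 0) = 2 * (M + A) * t n := by ring
  rw [h4]
  have h5 := h2.1
  have h6 := h2.2
  gcongr

/-- The previous point is a competitor in the step. Changing the time at that point costs at most `1
+ ρ` times the increment of `B`, so `φ - (1 + ρ) * B` is the quantity that dissipates. -/
theorem Scheme.energy_step (hS : Scheme φ D H δ t U N) (h : LocalHyp φ D o B A κ H) (h0 : U 0 ∈ D)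
    {ρ : ℝ} (hρ : ∀ n ≤ N, dist (U n) o ^ 2 ≤ ρ) {n : ℕ} (hn : n < N) :
    φ (t (n + 1)) (U (n + 1)) - (1 + ρ) * B (t (n + 1)) +
      dist (U n) (U (n + 1)) ^ 2 / (2 * (t (n + 1) - t n)) ≤ φ (t n) (U n) - (1 + ρ) * B (t n) := by
  have hU := hS.mem h0 hn.le
  have h1 := (hS.step n hn).2 _ hU
  have h2 := (abs_le.1 (h.time _ hU (t n) (t (n + 1)) (hS.mem_Icc hn.le).1
    (hS.strictMono.monotone n.le_succ) (hS.mem_Icc hn).2)).2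
  have h3 := hρ n hn.le
  have h4 := h.mono (hS.strictMono.monotone n.le_succ)
  rw [dist_self] at h1
  have h5 := mul_le_mul_of_nonneg_left (add_le_add_right h3 1) (_root_.sub_nonneg.2 h4)
  simp only [ne_eq, OfNat.ofNat_ne_zero, not_false_eq_true, zero_pow, zero_div, add_zero] at h1
  linarith

/-- A Cauchy-Schwarz inequality for chains: from `p² ≤ 2ax` and `q² ≤ 2by` follows `2pq ≤ 2ay +
2bx`, hence `(p + q)² ≤ 2(a + b)(x + y)`. -/
theorem Scheme.dist_sq_le_sub_mul_sub (hS : Scheme φ D H δ t U N) {f : ℕ → ℝ}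
    (hf : ∀ n < N, f (n + 1) + dist (U n) (U (n + 1)) ^ 2 / (2 * (t (n + 1) - t n)) ≤ f n)
    {m n : ℕ} (hmn : m ≤ n) (hn : n ≤ N) :
    f n ≤ f m ∧ dist (U n) (U m) ^ 2 ≤ 2 * (t n - t m) * (f m - f n) := by
  induction n, hmn using Nat.le_induction with
  | base => simp
  | succ n hmn ih =>
    obtain ⟨i1, i2⟩ := ih (by omega)
    have h1 := hf n hn
    have hτ := hS.sub_pos n
    have h2 : 0 ≤ dist (U n) (U (n + 1)) ^ 2 / (2 * (t (n + 1) - t n)) := by positivity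
    have h3 : dist (U (n + 1)) (U n) ^ 2 ≤ 2 * (t (n + 1) - t n) * (f n - f (n + 1)) := by
      rw [dist_comm]
      have : dist (U n) (U (n + 1)) ^ 2 / (2 * (t (n + 1) - t n)) ≤ f n - f (n + 1) := by linarith
      rw [div_le_iff₀ (by positivity)] at this
      linarith
    refine ⟨by linarith, ?_⟩
    have h4 := dist_triangle (U (n + 1)) (U n) (U m)
    set p := dist (U (n + 1)) (U n)
    set q := dist (U n) (U m)
    have hp : 0 ≤ p := dist_nonneg
    have hq : 0 ≤ q := dist_nonneg
    set a := t (n + 1) - t n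
    set b := t n - t m with hb
    have hb0 : 0 ≤ b := _root_.sub_nonneg.2 (hS.strictMono.monotone hmn)
    set x := f n - f (n + 1) with hx
    set y := f m - f n with hy
    have hx0 : 0 ≤ x := by linarith
    have hy0 : 0 ≤ y := by linarith
    have e1 : t (n + 1) - t m = a + b := by simp only [a, b]; ring
    have e2 : f m - f (n + 1) = x + y := by simp only [x, y]; ring
    rw [e1, e2]
    have h5 : dist (U (n + 1)) (U m) ^ 2 ≤ (p + q) ^ 2 := by gcongr
    have h6 : 2 * p * q ≤ 2 * a * y + 2 * b * x := by
      have : (p * q) ^ 2 ≤ (a * y + b * x) ^ 2 := by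
        have : (p * q) ^ 2 ≤ (2 * a * x) * (2 * b * y) := by
          rw [mul_pow]; gcongr
        nlinarith [sq_nonneg (a * y - b * x)]
      have := abs_le_of_sq_le_sq this (by positivity)
      linarith [le_abs_self (p * q)]
    nlinarith

/-- The one-step inequalities are summed against a bound `Q` that refers to the last node only.
Moving the energies of `v` and of `U` to that node costs increments of `B`, because `φ - (1 + ρ) *
B` decreases along `U`. Moving the distance to `v` costs `d²(U n, U (k+1)) ≤ 2F (t n - t m)` and
doubles `κ`. -/
theorem Scheme.multistep_evi (hS : Scheme φ D H δ t U N) (h : LocalHyp φ D o B A κ H)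
    (hδκ : δ * κ < 1) (h0 : U 0 ∈ D) {ρ F : ℝ} (hρ : ∀ n ≤ N, dist (U n) o ^ 2 ≤ ρ)
    (hF : ∀ m n, m ≤ n → n ≤ N → φ (t m) (U m) - (1 + ρ) * B (t m) -
      (φ (t n) (U n) - (1 + ρ) * B (t n)) ≤ F)
    {m n : ℕ} (hmn : m ≤ n) (hn : n ≤ N) {v : X} (hv : v ∈ D) :
    dist (U n) v ^ 2 - dist (U m) v ^ 2 ≤
      (t n - t m) * (2 * (φ (t n) v - φ (t n) (U n)) + 2 * κ * dist (U n) v ^ 2 +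
        (B (t n) - B (t m)) * (2 * (1 + dist v o ^ 2) + 2 * (1 + ρ)) +
          4 * κ * F * (t n - t m)) := by
  set Q := 2 * (φ (t n) v - φ (t n) (U n)) + 2 * κ * dist (U n) v ^ 2 +
        (B (t n) - B (t m)) * (2 * (1 + dist v o ^ 2) + 2 * (1 + ρ)) +
          4 * κ * F * (t n - t m) with hQ
  have hκ := h.kappa_nonneg
  have hρ0 : 0 ≤ 1 + ρ := by linarith [hρ 0 N.zero_le, sq_nonneg (dist (U 0) o)]
  have step := fun (i : ℕ) (hi : i < N) => hS.energy_step h h0 hρ hi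
  suffices ∀ k, m ≤ k → k ≤ n → dist (U k) v ^ 2 - dist (U m) v ^ 2 ≤ (t k - t m) * Q from
    this n hmn le_rfl
  intro k hk
  induction k, hk using Nat.le_induction with
  | base => intro _; simp
  | succ k hmk ih =>
    intro hkn
    have ih := ih (by omega)
    have h1 := hS.evi h hδκ (n := k) (by omega) hv
    have hτ := hS.sub_pos k
    have hkI := hS.mem_Icc (n := k + 1) (by omega)
    have hnI := hS.mem_Icc (n := n) hn
    have hkn' := hS.strictMono.monotone hkn
    have hmk' := hS.strictMono.monotone (show m ≤ k + 1 by omega)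
    have hB1 := h.mono hkn'
    have hB2 := h.mono hmk'
    have h2 := (abs_le.1 (h.time v hv _ _ hkI.1 hkn' hnI.2)).1
    obtain ⟨h3, h4⟩ := hS.dist_sq_le_sub_mul_sub
      (f := fun n => φ (t n) (U n) - (1 + ρ) * B (t n)) step hkn hn
    have h5 := hF (k + 1) n hkn hn
    have h6 := dist_sq_le_two_mul (U (k + 1)) (U n) v
    rw [dist_comm (U (k + 1)) (U n)] at h6
    have h7 : 2 * (φ (t (k + 1)) v - φ (t (k + 1)) (U (k + 1))) + κ * dist (U (k + 1)) v ^ 2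
        ≤ Q := by
      have a1 : φ (t (k + 1)) v ≤ φ (t n) v + (B (t n) - B (t m)) * (1 + dist v o ^ 2) := by
        have : (B (t n) - B (t (k + 1))) * (1 + dist v o ^ 2) ≤
          (B (t n) - B (t m)) * (1 + dist v o ^ 2) := by gcongr
        linarith
      have a2 : φ (t n) (U n) ≤ φ (t (k + 1)) (U (k + 1)) + (B (t n) - B (t m)) * (1 + ρ) := by
        have : (B (t n) - B (t (k + 1))) * (1 + ρ) ≤ (B (t n) - B (t m)) * (1 + ρ) := by gcongr
        linarith
      have a3 : dist (U n) (U (k + 1)) ^ 2 ≤ 2 * F * (t n - t m) := by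
        refine h4.trans ?_
        have : 0 ≤ t n - t (k + 1) := by linarith
        have b1 : 2 * (t n - t (k + 1)) * (φ (t (k + 1)) (U (k + 1)) - (1 + ρ) * B (t (k + 1)) -
            (φ (t n) (U n) - (1 + ρ) * B (t n))) ≤ 2 * (t n - t (k + 1)) * F := by gcongr
        have hF0 : 0 ≤ F := le_trans (by linarith) h5
        have b2 : 2 * (t n - t (k + 1)) * F ≤ 2 * (t n - t m) * F := by gcongr
        linarith
      have a4 : κ * dist (U (k + 1)) v ^ 2 ≤ κ * (2 * (2 * F * (t n - t m)) +
        2 * dist (U n) v ^ 2) := by gcongr; linarith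
      rw [hQ]
      linarith
    have h8 := mul_le_mul_of_nonneg_left h7 hτ.le
    nlinarith

/-- The solutions of the scheme issuing from the base point are discrete solutions of the evolution
variational inequality, uniformly in the partition. -/
theorem LocalHyp.exists_eviCurve (h : LocalHyp φ D o B A κ H) :
    ∃ C δ₀ : ℝ, 0 < δ₀ ∧ 0 ≤ C ∧ ∀ (t : ℕ → ℝ) (U : ℕ → X) (N : ℕ), Scheme φ D H δ₀ t U N → U 0 = o →
      ∀ w : ℝ → X, (∀ n ≤ N, w (t n) = U n) → EVICurve φ D o B κ C (t '' Iic N) w := by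
  have hA := h.lower_nonneg
  have hκ := h.kappa_nonneg
  have hH := h.horizon_pos
  have hB0 : 0 ≤ B H - B 0 := _root_.sub_nonneg.2 (h.mono hH.le)
  -- `ρ` bounds the squared distances to `o`, `M` the energies, and `F` the drop of `φ - (1 + ρ) *
  -- B`. They involve only the energy at the starting point `o`, hence not the partition.
  set ρ := Real.exp (2 * (κ + 2 * A) * H) * (2 * (|φ 0 o + (B H - B 0)| + A) * H) with hρ
  have hρ0 : 0 ≤ ρ := by positivity
  set M := |φ 0 o| + (1 + ρ) * (B H - B 0) + A * (1 + ρ) with hM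
  set F := |φ 0 o| + A * (1 + ρ) + (1 + ρ) * (B H - B 0) with hF
  have hM0 : 0 ≤ M := by positivity
  have hF0 : 0 ≤ F := by positivity
  have hd : (κ + 2 * A) * (1 / (2 * (κ + 2 * A + 1))) ≤ 1 / 2 := by
    rw [mul_one_div, div_le_div_iff₀ (by positivity) (by positivity)]
    linarith
  refine ⟨ρ + M + 2 * F + (4 + 2 * ρ) + 4 * κ * F, 1 / (2 * (κ + 2 * A + 1)),
    by positivity, by positivity, ?_⟩
  intro t U N hS h0 w hw
  have hδκ : 1 / (2 * (κ + 2 * A + 1)) * κ < 1 := by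
    rw [one_div_mul_eq_div, div_lt_one (by positivity)]
    linarith
  have h0D : U 0 ∈ D := h0 ▸ h.base_mem
  have hρ' : ∀ n ≤ N, dist (U n) o ^ 2 ≤ ρ := fun n hn => hS.dist_sq_le h hd hδκ h0 hn
  have hstep := fun (i : ℕ) (hi : i < N) => hS.energy_step h h0D hρ' hi
  have hdrop := fun (m n : ℕ) (hmn : m ≤ n) (hn : n ≤ N) => hS.dist_sq_le_sub_mul_sub
      (f := fun n => φ (t n) (U n) - (1 + ρ) * B (t n)) hstep hmn hn
  have hlow : ∀ n ≤ N, -(A * (1 + ρ)) ≤ φ (t n) (U n) := by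
    intro n hn
    have h1 := h.lower _ (hS.mem_Icc hn) _ (hS.mem h0D hn)
    have h2 : A * (1 + dist (U n) o ^ 2) ≤ A * (1 + ρ) := by
      gcongr; exact hρ' n hn
    linarith
  have hBle : ∀ n ≤ N, 0 ≤ B (t n) - B 0 ∧ B (t n) - B 0 ≤ B H - B 0 := fun n hn =>
    ⟨_root_.sub_nonneg.2 (h.mono (hS.mem_Icc hn).1), sub_le_sub_right (h.mono (hS.mem_Icc hn).2) _⟩
  have hup : ∀ n ≤ N, φ (t n) (U n) ≤ |φ 0 o| + (1 + ρ) * (B (t n) - B 0) := by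
    intro n hn
    have h1 := (hdrop 0 n n.zero_le hn).1
    simp only [hS.zero, h0] at h1
    linarith [le_abs_self (φ 0 o)]
  have hup' : ∀ n ≤ N, φ (t n) (U n) ≤ |φ 0 o| + (1 + ρ) * (B H - B 0) := fun n hn =>
    (hup n hn).trans (by have := (hBle n hn).2; gcongr)
  have hF' : ∀ m n, m ≤ n → n ≤ N → φ (t m) (U m) - (1 + ρ) * B (t m) -
      (φ (t n) (U n) - (1 + ρ) * B (t n)) ≤ F := by
    intro m n hmn hn
    have h1 := hup m (hmn.trans hn)
    have h2 := hlow n hn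
    have h3 : (1 + ρ) * (B (t n) - B 0) ≤ (1 + ρ) * (B H - B 0) := by
      have := (hBle n hn).2; gcongr
    rw [hF]
    linarith
  constructor
  · rintro _ ⟨n, hn, rfl⟩
    rw [hw n hn]
    exact hS.mem h0D hn
  · rintro _ ⟨n, hn, rfl⟩
    rw [hw n hn]
    have := hρ' n hn
    have : 0 ≤ κ * F := by positivity
    linarith
  · rintro _ ⟨n, hn, rfl⟩
    rw [hw n hn]
    have h1 := hup' n hn
    have h2 := hlow n hn
    have h3 : 0 ≤ κ * F := by positivity
    have h4 : 0 ≤ A * (1 + ρ) := by positivity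
    have h5 : 0 ≤ (1 + ρ) * (B H - B 0) := by positivity
    rw [abs_le]
    constructor <;> linarith [abs_nonneg (φ 0 o)]
  · rintro _ ⟨m, hm, rfl⟩ _ ⟨n, hn, rfl⟩ hmn
    have hmn' := hS.strictMono.le_iff_le.1 hmn
    rw [hw n hn, hw m hm]
    refine (hdrop m n hmn' hn).2.trans ?_
    have h1 := hF' m n hmn' hn
    have h2 : 0 ≤ t n - t m := _root_.sub_nonneg.2 hmn
    have h3 : 2 * (t n - t m) * (φ (t m) (U m) - (1 + ρ) * B (t m) -
      (φ (t n) (U n) - (1 + ρ) * B (t n))) ≤ 2 * (t n - t m) * F := by gcongr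
    have h4 : 2 * F * (t n - t m) ≤ (ρ + M + 2 * F + (4 + 2 * ρ) + 4 * κ * F) * (t n - t m) := by
      gcongr
      have : 0 ≤ κ * F := by positivity
      linarith
    linarith
  · rintro v hv _ ⟨m, hm, rfl⟩ _ ⟨n, hn, rfl⟩ hmn
    have hmn' := hS.strictMono.le_iff_le.1 hmn
    rw [hw n hn, hw m hm]
    have h2 : 0 ≤ t n - t m := _root_.sub_nonneg.2 hmn
    refine (hS.multistep_evi h hδκ h0D hρ' hF' hmn' hn hv).trans ?_
    rw [add_assoc (2 * (φ (t n) v - φ (t n) (U n)) + 2 * κ * dist (U n) v ^ 2)]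
    gcongr
    have hB := _root_.sub_nonneg.2 (h.mono hmn)
    have hd0 : 0 ≤ dist v o ^ 2 := by positivity
    have h3 : (B (t n) - B (t m)) * (2 * (1 + dist v o ^ 2) + 2 * (1 + ρ)) ≤
        (ρ + M + 2 * F + (4 + 2 * ρ)) * (1 + dist v o ^ 2) * (B (t n) - B (t m)) := by
      rw [mul_comm]
      gcongr
      nlinarith
    have h4 : 4 * κ * F * (t n - t m) ≤ 4 * κ * F * (1 + dist v o ^ 2) * (t n - t m) := by
      exact mul_le_mul_of_nonneg_right
        (le_mul_of_one_le_right (by positivity) (by linarith)) h2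
    have h5 : 0 ≤ (ρ + M + 2 * F + (4 + 2 * ρ)) * (1 + dist v o ^ 2) * (t n - t m) := by positivity
    have h6 : 0 ≤ 4 * κ * F * (1 + dist v o ^ 2) * (B (t n) - B (t m)) := by positivity
    simp only [modulus]
    linarith

end TimeGradFlow

/-! ### Comparison and stability for the evolution variational inequality -/

namespace TimeGradFlow

variable {X : Type*} [MetricSpace X]
variable {φ : ℝ → X → ℝ} {D : Set X} {o : X} {B : ℝ → ℝ} {A κ H C : ℝ}

theorem LocalHyp.modulus_mono (h : LocalHyp φ D o B A κ H) : Monotone (modulus B) :=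
  h.mono.add monotone_id

theorem LocalHyp.modulus_continuous (h : LocalHyp φ D o B A κ H) : Continuous (modulus B) :=
  h.continuous.add continuous_id

theorem LocalHyp.abs_sub_le (h : LocalHyp φ D o B A κ H) {u : X} (hu : u ∈ D) {s t : ℝ}
    (hs : s ∈ Icc 0 H) (ht : t ∈ Icc 0 H) :
    |φ t u - φ s u| ≤ |B t - B s| * (1 + dist u o ^ 2) := by
  rcases le_total s t with hst | hst
  · exact (h.time u hu s t hs.1 hst ht.2).trans (by gcongr; exact le_abs_self _)
  · rw [abs_sub_comm, abs_sub_comm (B t)]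
    exact (h.time u hu t s ht.1 hst hs.2).trans (by gcongr; exact le_abs_self _)

/-- Lower semicontinuity in time and space. -/
theorem LocalHyp.le_of_tendsto (h : LocalHyp φ D o B A κ H) {ι : Type*} {l : Filter ι} [l.NeBot]
    {θ : ι → ℝ} {y : ι → X} {c : ι → ℝ} {t c₀ : ℝ} {y₀ : X} (hθ : ∀ᶠ i in l, θ i ∈ Icc 0 H)
    (hθt : Tendsto θ l (𝓝 t)) (hy : ∀ᶠ i in l, y i ∈ D) (hyy : Tendsto y l (𝓝 y₀))
    (hc : ∀ᶠ i in l, φ (θ i) (y i) ≤ c i) (hcc : Tendsto c l (𝓝 c₀)) :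
    y₀ ∈ D ∧ φ t y₀ ≤ c₀ := by
  have ht : t ∈ Icc 0 H := isClosed_Icc.mem_of_tendsto hθt hθ
  have lim : Tendsto (fun i => c i + |B t - B (θ i)| * (1 + dist (y i) o ^ 2)) l
      (𝓝 (c₀ + |B t - B t| * (1 + dist y₀ o ^ 2))) := by
    refine hcc.add (Tendsto.mul ?_ ?_)
    · exact (tendsto_const_nhds.sub ((h.continuous.tendsto t).comp hθt)).abs
    · exact tendsto_const_nhds.add ((hyy.dist tendsto_const_nhds).pow 2)
  simp only [sub_self, abs_zero, zero_mul, add_zero] at lim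
  have key : ∀ ε > 0, y₀ ∈ D ∧ φ t y₀ ≤ c₀ + ε := by
    intro ε hε
    refine (h.isClosed_sublevel t ht _).mem_of_tendsto hyy ?_
    filter_upwards [hθ, hy, hc, lim.eventually_lt_const (show c₀ < c₀ + ε by linarith)]
      with i h1 h2 h3 h4
    have h5 := (abs_le.1 (h.abs_sub_le h2 h1 ht)).2
    exact ⟨h2, by linarith⟩
  exact ⟨(key 1 one_pos).1, le_of_forall_pos_le_add fun ε hε => (key ε hε).2⟩

theorem LocalHyp.continuousOn_left (h : LocalHyp φ D o B A κ H) {u : X} (hu : u ∈ D) :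
    ContinuousOn (fun t => φ t u) (Icc 0 H) := by
  intro t ht
  have lim : Tendsto (fun s => |B s - B t| * (1 + dist u o ^ 2)) (𝓝[Icc 0 H] t)
      (𝓝 (|B t - B t| * (1 + dist u o ^ 2))) := by
    refine Tendsto.mono_left (Continuous.tendsto ?_ t) nhdsWithin_le_nhds
    have := h.continuous
    fun_prop
  simp only [sub_self, abs_zero, zero_mul] at lim
  rw [ContinuousWithinAt, tendsto_iff_norm_sub_tendsto_zero]
  refine squeeze_zero' (Eventually.of_forall fun _ => norm_nonneg _) ?_ lim
  filter_upwards [self_mem_nhdsWithin] with s hs using h.abs_sub_le hu ht hs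

/-- The rate at which the energy can increase along solutions. -/
noncomputable def energyRate (κ C : ℝ) : ℝ := 1 + C + κ * C + C * (1 + C) / 2

theorem energyRate_nonneg (hκ : 0 ≤ κ) (hC : 0 ≤ C) : 0 ≤ energyRate κ C := by
  unfold energyRate; positivity

/-- Test with `v = w s`. Time regularity moves the energy of `w s` from `t` back to `s`, and the
Hölder bound turns the `κ` term into an increment of the modulus. The product form of the bound is
what later yields absolute continuity. -/
theorem EVICurve.dist_sq_le_energy_sub {S : Set ℝ} {w : ℝ → X}
    (hw : EVICurve φ D o B κ C S w) (h : LocalHyp φ D o B A κ H) (hS : S ⊆ Icc 0 H) (hC : 0 ≤ C)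
    {s t : ℝ} (hs : s ∈ S) (ht : t ∈ S) (hst : s ≤ t) :
    dist (w t) (w s) ^ 2 ≤ (t - s) * (2 * (φ s (w s) - φ t (w t)) +
      2 * energyRate κ C * (modulus B t - modulus B s)) := by
  refine (hw.evi (w s) (hw.mem s hs) s hs t ht hst).trans' (by simp) |>.trans ?_
  have h0 : 0 ≤ t - s := sub_nonneg.2 hst
  refine mul_le_mul_of_nonneg_left ?_ h0
  have h1 := (abs_le.1 (h.time _ (hw.mem s hs) s t (hS hs).1 hst (hS ht).2)).2
  have h2 := hw.dist_sq_le s hs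
  have h3 := hw.holder s hs t ht hst
  have hB : 0 ≤ B t - B s := sub_nonneg.2 (h.mono hst)
  have hω : B t - B s ≤ modulus B t - modulus B s := by simp only [modulus]; linarith
  have hω' : t - s ≤ modulus B t - modulus B s := by simp only [modulus]; linarith
  have h4 : (B t - B s) * (1 + dist (w s) o ^ 2) ≤ (modulus B t - modulus B s) * (1 + C) := by
    gcongr
    linarith
  have h5 : κ * dist (w t) (w s) ^ 2 ≤ κ * (C * (modulus B t - modulus B s)) := by
    have := h.kappa_nonneg
    gcongr
    exact h3.trans (by gcongr)
  have h6 : C * (1 + dist (w s) o ^ 2) * (modulus B t - modulus B s) ≤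
      C * (1 + C) * (modulus B t - modulus B s) := by
    have : 0 ≤ modulus B t - modulus B s := h0.trans hω'
    gcongr
  unfold energyRate
  linarith

/-- The left side of `EVICurve.dist_sq_le_energy_sub` is a square, so the bracket on its right side
is nonnegative. -/
theorem EVICurve.energy_le {S : Set ℝ} {w : ℝ → X}
    (hw : EVICurve φ D o B κ C S w) (h : LocalHyp φ D o B A κ H) (hS : S ⊆ Icc 0 H) (hC : 0 ≤ C)
    {s t : ℝ} (hs : s ∈ S) (ht : t ∈ S) (hst : s ≤ t) :
    φ t (w t) ≤ φ s (w s) + energyRate κ C * (modulus B t - modulus B s) := by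
  rcases hst.eq_or_lt with rfl | hlt
  · simp
  have h1 := (sq_nonneg _).trans (hw.dist_sq_le_energy_sub h hS hC hs ht hst)
  have h2 := nonneg_of_mul_nonneg_right h1 (sub_pos.2 hlt)
  linarith

/-- The constant in front of the modulus in the comparison estimate. -/
noncomputable def comparisonRate (κ C : ℝ) : ℝ :=
  2 * energyRate κ C + 2 * κ * C + 2 * (1 + C) + C * (1 + 2 * C)

theorem two_mul_energyRate_le_comparisonRate (hκ : 0 ≤ κ) (hC : 0 ≤ C) :
    2 * energyRate κ C ≤ comparisonRate κ C := by
  have : 0 ≤ 2 * κ * C + 2 * (1 + C) + C * (1 + 2 * C) := by positivity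
  unfold comparisonRate
  linarith

/-- Cross-testing: the inequality for `w` uses `v = U (n+1)`, that for the scheme uses `v = w (t
n)`. Both evaluate energies at `t (n+1)`, so the energy of `U (n+1)` cancels; the mixed squared
distance cancels up to a factor `κ τ`. -/
theorem Scheme.comparison_step {δ : ℝ} {t : ℕ → ℝ} {U : ℕ → X} {N : ℕ} {S : Set ℝ} {w : ℝ → X}
    (hS : Scheme φ D H δ t U N) (h : LocalHyp φ D o B A κ H) (hw : EVICurve φ D o B κ C S w)
    (hC : 0 ≤ C) (hSH : S ⊆ Icc 0 H) (hδκ : δ * κ < 1) (hmem : ∀ n ≤ N, t n ∈ S)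
    {n : ℕ} (hn : n < N) :
    (1 - (4 * κ + 2 * C * (modulus B H - modulus B 0)) * (t (n + 1) - t n)) *
        dist (U (n + 1)) (w (t (n + 1))) ^ 2 ≤
      dist (U n) (w (t n)) ^ 2 + (t (n + 1) - t n) *
        (2 * (φ (t n) (w (t n)) - φ (t (n + 1)) (w (t (n + 1)))) +
          comparisonRate κ C * (modulus B (t (n + 1)) - modulus B (t n))) := by
  have hκ := h.kappa_nonneg
  have hnS := hmem n hn.le
  have hn1S := hmem (n + 1) hn
  have hlt := hS.strictMono.monotone n.le_succ
  have hτ := hS.sub_pos n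
  have ha := hw.evi (U (n + 1)) (hS.step n hn).1 _ hnS _ hn1S hlt
  have hb := hS.evi h hδκ hn (hw.mem _ hnS)
  have hH := hw.holder _ hnS _ hn1S hlt
  have hq := dist_sq_le_two_mul (U (n + 1)) (w (t (n + 1))) (w (t n))
  have hr := dist_sq_le_two_mul (U (n + 1)) (w (t (n + 1))) o
  have hd := hw.dist_sq_le _ hn1S
  have hd' := hw.dist_sq_le _ hnS
  have ht := (abs_le.1 (h.time _ (hw.mem _ hnS) _ _ (hSH hnS).1 hlt (hSH hn1S).2)).2
  have hB0 : 0 ≤ B (t (n + 1)) - B (t n) := sub_nonneg.2 (h.mono hlt)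
  have hBω : B (t (n + 1)) - B (t n) ≤ modulus B (t (n + 1)) - modulus B (t n) := by
    simp only [modulus]; linarith
  have hτω : t (n + 1) - t n ≤ modulus B (t (n + 1)) - modulus B (t n) := by
    simp only [modulus]; linarith
  have hωΩ : modulus B (t (n + 1)) - modulus B (t n) ≤ modulus B H - modulus B 0 :=
    sub_le_sub (h.modulus_mono (hSH hn1S).2) (h.modulus_mono (hSH hnS).1)
  rw [dist_comm (w (t (n + 1))) (U (n + 1)), dist_comm (w (t n)) (U (n + 1))] at ha
  have ha'0 : 0 ≤ dist (U (n + 1)) (w (t (n + 1))) ^ 2 := by positivity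
  have hr0 : 0 ≤ dist (U (n + 1)) o ^ 2 := by positivity
  have hs0 : 0 ≤ dist (w (t n)) o ^ 2 := by positivity
  generalize t (n + 1) - t n = τ at *
  generalize modulus B (t (n + 1)) - modulus B (t n) = Δ at *
  generalize modulus B H - modulus B 0 = Ω at *
  generalize B (t (n + 1)) - B (t n) = b at *
  generalize dist (U (n + 1)) (w (t (n + 1))) ^ 2 = a' at *
  generalize dist (U n) (w (t n)) ^ 2 = a at *
  generalize dist (U (n + 1)) (w (t n)) ^ 2 = q at *
  generalize dist (U (n + 1)) o ^ 2 = r at *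
  generalize dist (w (t n)) o ^ 2 = s at *
  generalize dist (w (t (n + 1))) o ^ 2 = s' at *
  generalize dist (w (t (n + 1))) (w (t n)) ^ 2 = d at *
  generalize φ (t (n + 1)) (w (t n)) = p at *
  generalize φ (t (n + 1)) (U (n + 1)) = z at *
  generalize φ (t (n + 1)) (w (t (n + 1))) = e' at *
  generalize φ (t n) (w (t n)) = e₀ at *
  have hΔ0 : 0 ≤ Δ := hτ.le.trans hτω
  -- Written as a difference so that adding the term `2 * κ * a'` from the inequality for `w`
  -- visibly gives the rate `4 * κ`.
  have b1 : κ * q ≤ 4 * κ * a' - 2 * κ * a' + 2 * κ * (C * Δ) := by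
    have : C * τ ≤ C * Δ := by gcongr
    have : κ * q ≤ κ * (2 * a' + 2 * (C * Δ)) := by gcongr; linarith
    linarith
  have b2 : C * (1 + r) * Δ ≤ C * (1 + 2 * C) * Δ + 2 * C * Ω * a' := by
    have s1 : C * (1 + r) * Δ ≤ C * (1 + (2 * a' + 2 * C)) * Δ := by gcongr; linarith
    have s2 : 2 * C * a' * Δ ≤ 2 * C * a' * Ω := by gcongr
    linarith
  have b3 : p ≤ e₀ + (1 + C) * Δ := by
    have : b * (1 + s) ≤ Δ * (1 + C) := by gcongr
    linarith
  have b4 : τ * (2 * (p - e') + κ * q + 2 * κ * a' + C * (1 + r) * Δ) ≤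
      τ * (2 * (e₀ - e') + comparisonRate κ C * Δ + (4 * κ + 2 * C * Ω) * a') := by
    have hLΔ : 0 ≤ energyRate κ C * Δ := mul_nonneg (energyRate_nonneg hκ hC) hΔ0
    refine mul_le_mul_of_nonneg_left ?_ hτ.le
    unfold comparisonRate
    linarith
  linarith

/-- Comparison of a solution of the scheme with a solution of the evolution variational
inequality. -/
theorem LocalHyp.exists_comparison (h : LocalHyp φ D o B A κ H) (hC : 0 ≤ C) :
    ∃ K δ₁ : ℝ, 0 < δ₁ ∧ 0 ≤ K ∧ ∀ (S : Set ℝ) (w : ℝ → X), S ⊆ Icc 0 H →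
      EVICurve φ D o B κ C S w → ∀ (t : ℕ → ℝ) (U : ℕ → X) (N : ℕ) (δ : ℝ), 0 ≤ δ → δ ≤ δ₁ →
        Scheme φ D H δ t U N → (∀ n ≤ N, t n ∈ S) → ∀ n ≤ N,
          dist (U n) (w (t n)) ^ 2 ≤ K * (dist (U 0) (w 0) ^ 2 + δ) := by
  have hκ := h.kappa_nonneg
  have hH := h.horizon_pos
  set Ω := modulus B H - modulus B 0 with hΩ
  have hΩ0 : 0 ≤ Ω := sub_nonneg.2 (h.modulus_mono hH.le)
  set L := energyRate κ C with hL
  have hL0 : 0 ≤ L := energyRate_nonneg hκ hC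
  set L' := comparisonRate κ C with hL'
  have hLL' : 2 * L ≤ L' := two_mul_energyRate_le_comparisonRate hκ hC
  have hL'0 : 0 ≤ L' := by linarith
  set c := 4 * κ + 2 * C * Ω with hc
  have hc0 : 0 ≤ c := by positivity
  refine ⟨Real.exp (2 * c * H) * (1 + (4 * C + L' * Ω)), 1 / (2 * (c + 1)), by positivity,
    by positivity, ?_⟩
  intro S w hSH hw t U N δ hδ0 hδ hS hmem n hn
  have hcδ : c * δ ≤ 1 / 2 := by
    have : c * δ ≤ c * (1 / (2 * (c + 1))) := by gcongr
    refine this.trans ?_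
    rw [mul_one_div, div_le_div_iff₀ (by positivity) (by positivity)]
    linarith
  have hκc : 4 * κ ≤ c := by rw [hc]; have : 0 ≤ 2 * C * Ω := by positivity
                             linarith
  have hδκ : δ * κ < 1 := by nlinarith
  set e := fun n => φ (t n) (w (t n)) with he
  -- The step length is replaced by the constant `δ`. This is allowed because the bracket is
  -- nonnegative (`hpos`), and it makes the sum telescope, so the total error is of order `δ`.
  set y := fun n => δ * (2 * (e n - e (n + 1)) + L' * (modulus B (t (n + 1)) - modulus B (t n)))
    with hy
  have hdrop : ∀ n < N, 0 ≤ 2 * (e n - e (n + 1)) +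
      2 * L * (modulus B (t (n + 1)) - modulus B (t n)) := by
    intro n hn
    have := hw.energy_le h hSH hC (hmem n hn.le) (hmem (n + 1) hn)
      (hS.strictMono.monotone n.le_succ)
    simp only [he, ← hL] at this ⊢
    linarith
  have hΔ : ∀ n, 0 ≤ modulus B (t (n + 1)) - modulus B (t n) := fun n =>
    sub_nonneg.2 (h.modulus_mono (hS.strictMono.monotone n.le_succ))
  have hpos : ∀ n < N, 0 ≤ 2 * (e n - e (n + 1)) +
      L' * (modulus B (t (n + 1)) - modulus B (t n)) := fun n hn =>
    (hdrop n hn).trans (by have := mul_le_mul_of_nonneg_right hLL' (hΔ n); linarith)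
  have key := discrete_gronwall (c := c) hc0 (x := fun n => dist (U n) (w (t n)) ^ 2)
    (y := y) (N := N) hS.zero (fun n _ => (hS.sub_pos n).le)
    (fun n hn => (mul_le_mul_of_nonneg_left (hS.mesh n hn) hc0).trans hcδ)
    (fun n => by positivity)
    (fun n hn => mul_nonneg hδ0 (hpos n hn))
    (fun n hn => by
      have h1 := hS.comparison_step h hw hC hSH hδκ hmem hn
      have h2 := mul_le_mul_of_nonneg_right (hS.mesh n hn) (hpos n hn)
      exact h1.trans (by simp only [hy]; exact add_le_add_right h2 _)) n hn
  refine key.trans ?_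
  simp only [hS.zero]
  have htI := hS.mem_Icc hn
  have hsum : ∑ k ∈ Finset.range n, y k ≤ δ * (4 * C + L' * Ω) := by
    simp only [hy]
    rw [← Finset.mul_sum]
    refine mul_le_mul_of_nonneg_left ?_ hδ0
    rw [Finset.sum_add_distrib, ← Finset.mul_sum, ← Finset.mul_sum, Finset.sum_range_sub',
      Finset.sum_range_sub (fun k => modulus B (t k))]
    have h1 := abs_le.1 (hw.abs_energy_le _ (hmem 0 N.zero_le))
    have h2 := abs_le.1 (hw.abs_energy_le _ (hmem n hn))
    have h3 : modulus B (t n) - modulus B (t 0) ≤ Ω :=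
      sub_le_sub (h.modulus_mono htI.2) (h.modulus_mono hS.zero.ge)
    have h4 : L' * (modulus B (t n) - modulus B (t 0)) ≤ L' * Ω := by gcongr
    simp only [he]
    linarith [h1.1, h1.2, h2.1, h2.2]
  have hexp : Real.exp (2 * c * t n) ≤ Real.exp (2 * c * H) := by
    have := htI.2; gcongr
  have hd0 : 0 ≤ dist (U 0) (w 0) ^ 2 := by positivity
  have hG : 0 ≤ 4 * C + L' * Ω := by positivity
  calc Real.exp (2 * c * t n) * (dist (U 0) (w 0) ^ 2 + ∑ k ∈ Finset.range n, y k)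
      ≤ Real.exp (2 * c * t n) * (dist (U 0) (w 0) ^ 2 + δ * (4 * C + L' * Ω)) := by gcongr
    _ ≤ Real.exp (2 * c * H) * (dist (U 0) (w 0) ^ 2 + δ * (4 * C + L' * Ω)) := by gcongr
    _ ≤ Real.exp (2 * c * H) * ((1 + (4 * C + L' * Ω)) * (dist (U 0) (w 0) ^ 2 + δ)) := by
      gcongr
      nlinarith [mul_nonneg hG hd0]
    _ = _ := by ring

/-- Limits of discrete solutions of the evolution variational inequality are solutions. -/
theorem EVICurve.of_tendsto (h : LocalHyp φ D o B A κ H) (hC : 0 ≤ C) {T : ℝ} (hTH : T ≤ H)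
    {S : ℕ → Set ℝ} {w : ℕ → ℝ → X} (hS : ∀ i, S i ⊆ Icc 0 H)
    (hw : ∀ᶠ i in atTop, EVICurve φ D o B κ C (S i) (w i)) {θ : ℝ → ℕ → ℝ} {u : ℝ → X}
    (hθS : ∀ t ∈ Icc 0 T, ∀ᶠ i in atTop, θ t i ∈ S i)
    (hθ : ∀ t ∈ Icc 0 T, Tendsto (θ t) atTop (𝓝 t))
    (hmono : ∀ s t i, s ≤ t → θ s i ≤ θ t i)
    (hu : ∀ t ∈ Icc 0 T, Tendsto (fun i => w i (θ t i)) atTop (𝓝 (u t))) :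
    EVICurve φ D o B κ (C + A * (1 + C)) (Icc 0 T) u := by
  have hA := h.lower_nonneg
  have hCC : C ≤ C + A * (1 + C) := by
    have : 0 ≤ A * (1 + C) := by positivity
    linarith
  have hTH' : Icc 0 T ⊆ Icc 0 H := Icc_subset_Icc_right hTH
  have hdist : ∀ t ∈ Icc 0 T, dist (u t) o ^ 2 ≤ C := by
    intro t ht
    refine le_of_tendsto (((hu t ht).dist tendsto_const_nhds).pow 2) ?_
    filter_upwards [hw, hθS t ht] with i h1 h2 using h1.dist_sq_le _ h2
  have hen : ∀ t ∈ Icc 0 T, u t ∈ D ∧ φ t (u t) ≤ C := by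
    intro t ht
    refine h.le_of_tendsto (c := fun _ => C) ?_ (hθ t ht) ?_ (hu t ht) ?_ tendsto_const_nhds
    · filter_upwards [hθS t ht] with i h1 using hS i h1
    · filter_upwards [hw, hθS t ht] with i h1 h2 using h1.mem _ h2
    · filter_upwards [hw, hθS t ht] with i h1 h2 using (abs_le.1 (h1.abs_energy_le _ h2)).2
  constructor
  · exact fun t ht => (hen t ht).1
  · exact fun t ht => (hdist t ht).trans hCC
  · intro t ht
    -- Lower semicontinuity transfers only the upper energy bound. The lower one comes from the
    -- quadratic lower bound and explains the constant `C + A * (1 + C)`.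
    have h1 := h.lower t (hTH' ht) _ (hen t ht).1
    have h2 : A * (1 + dist (u t) o ^ 2) ≤ A * (1 + C) := by
      have := hdist t ht; gcongr
    rw [abs_le]
    exact ⟨by linarith, (hen t ht).2.trans hCC⟩
  · intro s hs t ht hst
    have : dist (u t) (u s) ^ 2 ≤ C * (t - s) := by
      refine le_of_tendsto_of_tendsto (((hu t ht).dist (hu s hs)).pow 2)
        (tendsto_const_nhds.mul ((hθ t ht).sub (hθ s hs))) ?_
      filter_upwards [hw, hθS t ht, hθS s hs] with i h1 h2 h3
      exact h1.holder _ h3 _ h2 (hmono s t i hst)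
    refine this.trans ?_
    have := sub_nonneg.2 hst
    gcongr
  · intro v hv s hs t ht hst
    rcases hst.eq_or_lt with rfl | hlt
    · simp
    -- The inequality is solved for the energy of the approximating curve at its later time; all
    -- other terms converge, so a single use of lower semicontinuity passes to the limit.
    set c : ℕ → ℝ := fun i => φ (θ t i) v + κ * dist (w i (θ t i)) v ^ 2 +
        C * (1 + dist v o ^ 2) * (modulus B (θ t i) - modulus B (θ s i)) / 2 -
        (dist (w i (θ t i)) v ^ 2 - dist (w i (θ s i)) v ^ 2) / (θ t i - θ s i) / 2 with hc
    set c₀ := φ t v + κ * dist (u t) v ^ 2 +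
        C * (1 + dist v o ^ 2) * (modulus B t - modulus B s) / 2 -
        (dist (u t) v ^ 2 - dist (u s) v ^ 2) / (t - s) / 2 with hc₀
    have hθH : ∀ t ∈ Icc 0 T, ∀ᶠ i in atTop, θ t i ∈ Icc 0 H := fun t ht => by
      filter_upwards [hθS t ht] with i h1 using hS i h1
    have hts : 0 < t - s := sub_pos.2 hlt
    have lim : Tendsto c atTop (𝓝 c₀) := by
      have l1 : Tendsto (fun i => φ (θ t i) v) atTop (𝓝 (φ t v)) := by
        have := h.continuousOn_left hv t (hTH' ht)
        exact this.tendsto.comp (tendsto_nhdsWithin_iff.2 ⟨hθ t ht, hθH t ht⟩)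
      have l2 : ∀ t ∈ Icc 0 T, Tendsto (fun i => dist (w i (θ t i)) v ^ 2) atTop
          (𝓝 (dist (u t) v ^ 2)) := fun t ht => ((hu t ht).dist tendsto_const_nhds).pow 2
      have l3 : ∀ t ∈ Icc 0 T, Tendsto (fun i => modulus B (θ t i)) atTop
          (𝓝 (modulus B t)) := fun t ht => (h.modulus_continuous.tendsto t).comp (hθ t ht)
      exact (((l1.add ((l2 t ht).const_mul κ)).add
        ((((l3 t ht).sub (l3 s hs)).const_mul _).div_const _)).sub
        ((((l2 t ht).sub (l2 s hs)).div ((hθ t ht).sub (hθ s hs)) hts.ne').div_const 2))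
    have key := h.le_of_tendsto (c := c) (hθH t ht) (hθ t ht) (by
      filter_upwards [hw, hθS t ht] with i h1 h2 using h1.mem _ h2) (hu t ht) (by
      filter_upwards [hw, hθS t ht, hθS s hs,
        ((hθ t ht).sub (hθ s hs)).eventually_const_lt hts] with i h1 h2 h3 h4
      have h5 := h1.evi v hv _ h3 _ h2 (hmono s t i hst)
      rw [mul_comm, ← div_le_iff₀ h4] at h5
      simp only [hc]
      linarith) lim
    have h6 : (dist (u t) v ^ 2 - dist (u s) v ^ 2) / (t - s) ≤ 2 * (φ t v - φ t (u t)) +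
        2 * κ * dist (u t) v ^ 2 + C * (1 + dist v o ^ 2) * (modulus B t - modulus B s) := by
      have := key.2
      rw [hc₀] at this
      linarith
    rw [div_le_iff₀ hts, mul_comm] at h6
    refine h6.trans ?_
    have := sub_nonneg.2 (h.modulus_mono hst)
    gcongr

end TimeGradFlow

/-! ### Dyadic solutions and their limit -/

namespace TimeGradFlow

variable {X : Type*} [MetricSpace X]
variable {φ : ℝ → X → ℝ} {D : Set X} {o : X} {B : ℝ → ℝ} {A κ H C : ℝ}

open Classical in
/-- A solution of the implicit scheme with nodes `t` and initial datum `x`, as long as it exists. -/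
noncomputable def schemeSol (φ : ℝ → X → ℝ) (D : Set X) (t : ℕ → ℝ) (x : X) : ℕ → X
  | 0 => x
  | n + 1 =>
    if h : ∃ y, IsStepMin φ D (t (n + 1)) (t (n + 1) - t n) (schemeSol φ D t x n) y then h.choose
    else schemeSol φ D t x n

theorem schemeSol_isStepMin {t : ℕ → ℝ} {x : X} {n : ℕ}
    (h : ∃ y, IsStepMin φ D (t (n + 1)) (t (n + 1) - t n) (schemeSol φ D t x n) y) :
    IsStepMin φ D (t (n + 1)) (t (n + 1) - t n) (schemeSol φ D t x n)
      (schemeSol φ D t x (n + 1)) := by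
  conv => arg 6; rw [schemeSol]
  rw [dif_pos h]
  exact h.choose_spec

theorem scheme_schemeSol [CompleteSpace X] (h : LocalHyp φ D o B A κ H) {δ : ℝ} {t : ℕ → ℝ}
    {N : ℕ} (x : X) (h0 : t 0 = 0) (ht : StrictMono t) (htN : t N ≤ H)
    (hδ : ∀ n < N, t (n + 1) - t n ≤ δ) (hδκ : δ * κ < 1) (hδA : 4 * A * δ ≤ 1) :
    Scheme φ D H δ t (schemeSol φ D t x) N := by
  refine ⟨h0, ht, htN, hδ, fun n hn => schemeSol_isStepMin ?_⟩
  have h1 := hδ n hn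
  refine exists_isStepMin h _ ⟨h0 ▸ ht.monotone (Nat.zero_le _), (ht.monotone hn).trans htN⟩
    (sub_pos.2 (ht n.lt_succ_self)) ?_ ?_
  · exact (mul_le_mul_of_nonneg_right h1 h.kappa_nonneg).trans_lt hδκ
  · exact (mul_le_mul_of_nonneg_left h1 (by have := h.lower_nonneg; positivity)).trans hδA

theorem Scheme.mono_mesh {δ δ' : ℝ} {t : ℕ → ℝ} {U : ℕ → X} {N : ℕ}
    (hS : Scheme φ D H δ t U N) (hδ : δ ≤ δ') : Scheme φ D H δ' t U N :=
  ⟨hS.zero, hS.strictMono, hS.le_horizon, fun n hn => (hS.mesh n hn).trans hδ, hS.step⟩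

/-- The nodes of the dyadic partitions. -/
noncomputable def dyadicNode (i n : ℕ) : ℝ := n / 2 ^ i

/-- The dyadic upper approximation of a time. -/
noncomputable def dyadicCeil (t : ℝ) (i : ℕ) : ℝ := dyadicNode i ⌈t * 2 ^ i⌉₊

/-- The dyadic approximate solutions from the base point. -/
noncomputable def dyadicSol (φ : ℝ → X → ℝ) (D : Set X) (o : X) (i : ℕ) (t : ℝ) : X :=
  schemeSol φ D (dyadicNode i) o ⌈t * 2 ^ i⌉₊

theorem dyadicNode_strictMono (i : ℕ) : StrictMono (dyadicNode i) := by
  intro m n hmn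
  unfold dyadicNode
  have : (m : ℝ) < n := by exact_mod_cast hmn
  gcongr

theorem dyadicNode_zero (i : ℕ) : dyadicNode i 0 = 0 := by simp [dyadicNode]

theorem dyadicNode_succ_sub (i n : ℕ) :
    dyadicNode i (n + 1) - dyadicNode i n = (1 / 2) ^ i := by
  simp only [dyadicNode, one_div, inv_pow]
  push_cast
  field_simp
  ring

theorem dyadicNode_mul_two_pow (i n : ℕ) : ⌈dyadicNode i n * 2 ^ i⌉₊ = n := by
  rw [dyadicNode, div_mul_cancel₀ _ (by positivity), Nat.ceil_natCast]

theorem dyadicSol_node (φ : ℝ → X → ℝ) (D : Set X) (o : X) (i n : ℕ) :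
    dyadicSol φ D o i (dyadicNode i n) = schemeSol φ D (dyadicNode i) o n := by
  rw [dyadicSol, dyadicNode_mul_two_pow]

theorem dyadicSol_ceil (φ : ℝ → X → ℝ) (D : Set X) (o : X) (i : ℕ) (t : ℝ) :
    dyadicSol φ D o i (dyadicCeil t i) = dyadicSol φ D o i t := by
  rw [dyadicCeil, dyadicSol_node, dyadicSol]

theorem le_dyadicCeil (t : ℝ) (i : ℕ) : t ≤ dyadicCeil t i := by
  rw [dyadicCeil, dyadicNode, le_div_iff₀ (by positivity)]
  exact Nat.le_ceil _

theorem dyadicCeil_le_add {t : ℝ} (ht : 0 ≤ t) (i : ℕ) : dyadicCeil t i ≤ t + (1 / 2) ^ i := by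
  rw [dyadicCeil, dyadicNode, div_le_iff₀ (by positivity), add_mul, ← mul_pow]
  have := (Nat.ceil_lt_add_one (show 0 ≤ t * 2 ^ i by positivity)).le
  norm_num
  exact this

theorem dyadicCeil_mono (i : ℕ) : Monotone fun t => dyadicCeil t i := by
  intro s t hst
  refine (dyadicNode_strictMono i).monotone (Nat.ceil_mono ?_)
  gcongr

theorem dyadicCeil_antitone (t : ℝ) {i j : ℕ} (hij : i ≤ j) : dyadicCeil t j ≤ dyadicCeil t i := by
  obtain ⟨k, rfl⟩ := Nat.exists_eq_add_of_le hij
  have h1 : ⌈t * 2 ^ (i + k)⌉₊ ≤ ⌈t * 2 ^ i⌉₊ * 2 ^ k := by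
    rw [Nat.ceil_le, pow_add, ← mul_assoc]
    push_cast
    have := Nat.le_ceil (t * 2 ^ i)
    gcongr
  have h2 : (⌈t * 2 ^ (i + k)⌉₊ : ℝ) ≤ ⌈t * 2 ^ i⌉₊ * 2 ^ k := by exact_mod_cast h1
  rw [dyadicCeil, dyadicCeil, dyadicNode, dyadicNode, div_le_div_iff₀ (by positivity)
    (by positivity), pow_add]
  rw [pow_add] at h2
  nlinarith [pow_pos (two_pos (α := ℝ)) i]

/-- The dyadic times up to `T`. -/
def dyadicTimes (T i : ℕ) : Set ℝ := dyadicNode i '' Iic (T * 2 ^ i)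

theorem dyadicTimes_subset_Icc (T i : ℕ) : dyadicTimes T i ⊆ Icc 0 (T : ℝ) := by
  rintro _ ⟨n, hn, rfl⟩
  refine ⟨by unfold dyadicNode; positivity, ?_⟩
  rw [dyadicNode, div_le_iff₀ (by positivity)]
  exact_mod_cast hn

theorem dyadicTimes_mono (T : ℕ) {i j : ℕ} (hij : i ≤ j) : dyadicTimes T i ⊆ dyadicTimes T j := by
  obtain ⟨k, rfl⟩ := Nat.exists_eq_add_of_le hij
  rintro _ ⟨n, hn, rfl⟩
  refine ⟨n * 2 ^ k, ?_, ?_⟩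
  · rw [mem_Iic, pow_add, ← mul_assoc]
    exact Nat.mul_le_mul_right _ hn
  · simp only [dyadicNode, pow_add]
    push_cast
    field_simp

theorem dyadicCeil_mem {T : ℕ} {t : ℝ} (ht : t ≤ T) (i : ℕ) : dyadicCeil t i ∈ dyadicTimes T i := by
  refine ⟨_, ?_, rfl⟩
  rw [mem_Iic, Nat.ceil_le]
  push_cast
  gcongr

theorem tendsto_dyadicCeil {t : ℝ} (ht : 0 ≤ t) : Tendsto (dyadicCeil t) atTop (𝓝 t) := by
  refine tendsto_of_tendsto_of_tendsto_of_le_of_le tendsto_const_nhds ?_ (le_dyadicCeil t)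
    (dyadicCeil_le_add ht)
  simpa using tendsto_const_nhds.add
    (tendsto_pow_atTop_nhds_zero_of_lt_one (r := (1 / 2 : ℝ)) (by norm_num) (by norm_num))

/-- Since dyadic nodes are nested, the finer solution is an `EVICurve` at all nodes of the coarser
one, and both start at `o`; the comparison error is therefore of the order of the coarser mesh. Away
from the nodes, the two dyadic ceilings of `t` are joined by the Hölder bound of the finer solution.
-/
theorem LocalHyp.exists_dyadic_estimate [CompleteSpace X] {T : ℕ}
    (h : LocalHyp φ D o B A κ T) : ∃ (C K : ℝ) (i₀ : ℕ), 0 ≤ C ∧ 0 ≤ K ∧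
      (∀ i ≥ i₀, EVICurve φ D o B κ C (dyadicTimes T i) (dyadicSol φ D o i)) ∧
      ∀ i ≥ i₀, ∀ j ≥ i, ∀ t ∈ Icc 0 (T : ℝ),
        dist (dyadicSol φ D o i t) (dyadicSol φ D o j t) ^ 2 ≤ K * (1 / 2) ^ i := by
  obtain ⟨C, δ₀, hδ₀, hC, hevi⟩ := h.exists_eviCurve
  obtain ⟨K, δ₁, hδ₁, hK, hcomp⟩ := h.exists_comparison hC
  have hA := h.lower_nonneg
  have hκ := h.kappa_nonneg
  have lim : Tendsto (fun i : ℕ => (1 / 2 : ℝ) ^ i) atTop (𝓝 0) :=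
    tendsto_pow_atTop_nhds_zero_of_lt_one (by norm_num) (by norm_num)
  have hev : ∀ᶠ i : ℕ in atTop, (1 / 2 : ℝ) ^ i < min (min δ₀ δ₁) (1 / (4 * A + κ + 1)) :=
    lim.eventually_lt_const (by positivity)
  obtain ⟨i₀, hi₀⟩ := eventually_atTop.1 hev
  have hsch : ∀ i ≥ i₀, Scheme φ D T ((1 / 2) ^ i) (dyadicNode i)
      (schemeSol φ D (dyadicNode i) o) (T * 2 ^ i) := by
    intro i hi
    have h1 := lt_min_iff.1 (hi₀ i hi)
    have h2 : (1 / 2 : ℝ) ^ i * (4 * A + κ + 1) < 1 := (lt_div_iff₀ (by positivity)).1 h1.2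
    have h3 : (0 : ℝ) < (1 / 2) ^ i := by positivity
    refine scheme_schemeSol h o (dyadicNode_zero i) (dyadicNode_strictMono i) ?_
      (fun n _ => (dyadicNode_succ_sub i n).le) ?_ ?_
    · simp [dyadicNode]
    · nlinarith [mul_nonneg h3.le hA]
    · nlinarith [mul_nonneg h3.le hκ]
  have hcurve : ∀ i ≥ i₀, EVICurve φ D o B κ C (dyadicTimes T i) (dyadicSol φ D o i) := by
    intro i hi
    have h1 := lt_min_iff.1 (lt_min_iff.1 (hi₀ i hi)).1
    exact hevi _ _ _ ((hsch i hi).mono_mesh h1.1.le) rfl _ (fun n _ => dyadicSol_node φ D o i n)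
  refine ⟨C, 2 * K + 2 * C, i₀, hC, by positivity, hcurve, ?_⟩
  intro i hi j hj t ht
  have h1 := lt_min_iff.1 (lt_min_iff.1 (hi₀ i hi)).1
  have hcj := hcurve j (hi.trans hj)
  have h2 := hcomp _ _ (dyadicTimes_subset_Icc T j) hcj _ _ _ _ (by positivity) h1.2.le (hsch i hi)
    (fun n hn => dyadicTimes_mono T hj ⟨n, hn, rfl⟩) ⌈t * 2 ^ i⌉₊ (by
      rw [Nat.ceil_le]; push_cast; have := ht.2; gcongr)
  have h3 : dyadicSol φ D o j 0 = o := by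
    rw [← dyadicNode_zero j, dyadicSol_node, schemeSol]
  have h4 : dyadicSol φ D o i t = schemeSol φ D (dyadicNode i) o ⌈t * 2 ^ i⌉₊ := rfl
  have hanti := dyadicCeil_antitone t hj
  have h5 := hcj.holder _ (dyadicCeil_mem ht.2 j) _
    (dyadicTimes_mono T hj (dyadicCeil_mem ht.2 i)) hanti
  rw [← h4, h3, schemeSol, dist_self, ← dyadicCeil] at h2
  rw [dyadicSol_ceil] at h5
  have h6 := dist_sq_le_two_mul (dyadicSol φ D o i t) (dyadicSol φ D o j (dyadicCeil t i))
    (dyadicSol φ D o j t)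
  have h7 : C * (dyadicCeil t i - dyadicCeil t j) ≤ C * (1 / 2) ^ i := by
    have h8 := dyadicCeil_le_add ht.1 i
    have h9 := le_dyadicCeil t j
    gcongr
    linarith
  linarith

/-- Existence of a global solution of the evolution variational inequality. -/
theorem exists_global_eviCurve [CompleteSpace X]
    (h : ∀ T : ℕ, 0 < T → ∃ A κ, LocalHyp φ D o B A κ T) :
    ∃ u : ℝ → X, u 0 = o ∧ ∀ T : ℕ, 0 < T → ∃ A κ C, 0 ≤ C ∧ LocalHyp φ D o B A κ T ∧
      EVICurve φ D o B κ C (Icc 0 (T : ℝ)) u := by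
  have lim : Tendsto (fun i : ℕ => (1 / 2 : ℝ) ^ i) atTop (𝓝 0) :=
    tendsto_pow_atTop_nhds_zero_of_lt_one (by norm_num) (by norm_num)
  have hconv : ∀ t : ℝ, ∃ y, 0 ≤ t → Tendsto (fun i => dyadicSol φ D o i t) atTop (𝓝 y) := by
    intro t
    by_cases ht : 0 ≤ t
    swap
    · exact ⟨o, fun h => absurd h ht⟩
    obtain ⟨T, hT⟩ := exists_nat_ge t
    -- `T + 1` because `T` may be `0`.
    obtain ⟨A, κ, hT'⟩ := h (T + 1) T.succ_pos
    obtain ⟨C, K, i₀, hC, hK, -, hest⟩ := hT'.exists_dyadic_estimate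
    suffices CauchySeq fun i => dyadicSol φ D o i t by
      obtain ⟨y, hy⟩ := cauchySeq_tendsto_of_complete this
      exact ⟨y, fun _ => hy⟩
    rw [Metric.cauchySeq_iff']
    intro ε hε
    have l1 : Tendsto (fun i : ℕ => K * (1 / 2 : ℝ) ^ i) atTop (𝓝 0) := by
      simpa using lim.const_mul K
    obtain ⟨N, hN1, hN2⟩ := ((l1.eventually_lt_const (show 0 < ε ^ 2 by positivity)).and
      (eventually_ge_atTop i₀)).exists
    refine ⟨N, fun n hn => ?_⟩
    have h1 := hest N hN2 n hn t ⟨ht, by push_cast; linarith⟩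
    rw [dist_comm]
    exact lt_of_pow_lt_pow_left₀ 2 hε.le (h1.trans_lt hN1)
  choose u hu using hconv
  refine ⟨u, ?_, fun T hT => ?_⟩
  · refine tendsto_nhds_unique (hu 0 le_rfl) ?_
    have : (fun i => dyadicSol φ D o i 0) = fun _ => o := by
      funext i
      rw [← dyadicNode_zero i, dyadicSol_node, schemeSol]
    rw [this]
    exact tendsto_const_nhds
  · obtain ⟨A, κ, hT'⟩ := h T hT
    obtain ⟨C, K, i₀, hC, hK, hcurve, -⟩ := hT'.exists_dyadic_estimate
    have hA := hT'.lower_nonneg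
    refine ⟨A, κ, C + A * (1 + C), by positivity, hT', ?_⟩
    refine EVICurve.of_tendsto hT' hC le_rfl (S := dyadicTimes T) (w := dyadicSol φ D o)
      (θ := dyadicCeil) (dyadicTimes_subset_Icc T)
      (eventually_atTop.2 ⟨i₀, hcurve⟩) (fun t ht => Eventually.of_forall fun i =>
        dyadicCeil_mem ht.2 i) (fun t ht => tendsto_dyadicCeil ht.1)
      (fun s t i hst => dyadicCeil_mono i hst) (fun t ht => ?_)
    simp only [dyadicSol_ceil]
    exact hu t ht.1

end TimeGradFlow

namespace TimeGradFlow

variable {X : Type*} [MetricSpace X]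

/-- The real values of the functional. -/
noncomputable def realEnergy (E : ℝ → X → EReal) (t : ℝ) (u : X) : ℝ := (E t u).toReal

/-! ### From extended-real hypotheses to `LocalHyp` -/

section Translation

variable {E : ℝ → X → EReal}

theorem mem_dom_iff {Y : Type*} {E : ℝ → Y → EReal} (h2 : HypE2 E) {t : ℝ} (ht : 0 ≤ t) {u : Y} : u ∈ dom E ↔ E t u < ⊤ := by
  rw [← h2 t ht, mem_ofPred_eq]

theorem coe_realEnergy (h1 : HypE1 E) (h2 : HypE2 E) {t : ℝ} (ht : 0 ≤ t) {u : X}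
    (hu : u ∈ dom E) : ((realEnergy E t u : ℝ) : EReal) = E t u :=
  EReal.coe_toReal ((mem_dom_iff h2 ht).1 hu).ne ((h1 t ht).1 u)

theorem penalized_eq_coe (h1 : HypE1 E) (h2 : HypE2 E) {t : ℝ} (ht : 0 ≤ t) (τ : ℝ) (u : X)
    {v : X} (hv : v ∈ dom E) :
    penalized E t τ u v = ((realEnergy E t v + dist u v ^ 2 / (2 * τ) : ℝ) : EReal) := by
  rw [penalized, ← coe_realEnergy h1 h2 ht hv, EReal.coe_add]

theorem mem_dom_of_penalized_lt_top (h2 : HypE2 E) {t τ : ℝ} (ht : 0 ≤ t) {u v : X}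
    (h : penalized E t τ u v < ⊤) : v ∈ dom E := by
  rw [mem_dom_iff h2 ht, lt_top_iff_ne_top]
  intro hv
  rw [penalized, hv, EReal.top_add_coe] at h
  exact lt_irrefl _ h

theorem penalized_eq_top (h2 : HypE2 E) {t τ : ℝ} (ht : 0 ≤ t) {u v : X} (hv : v ∉ dom E) :
    penalized E t τ u v = ⊤ := by
  by_contra h
  exact hv (mem_dom_of_penalized_lt_top h2 ht (lt_top_iff_ne_top.2 h))

theorem isStepMin_iff (h1 : HypE1 E) (h2 : HypE2 E) (hne : (dom E).Nonempty) {t τ : ℝ}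
    (ht : 0 ≤ t) {x y : X} : IsStepMin (realEnergy E) (dom E) t τ x y ↔
      ∀ v, penalized E t τ x y ≤ penalized E t τ x v := by
  constructor
  · rintro ⟨hy, h⟩ v
    by_cases hv : v ∈ dom E
    · rw [penalized_eq_coe h1 h2 ht τ x hy, penalized_eq_coe h1 h2 ht τ x hv]
      exact EReal.coe_le_coe_iff.2 (h v hv)
    · rw [penalized_eq_top h2 ht hv]
      exact le_top
  · intro h
    obtain ⟨z, hz⟩ := hne
    have hy : y ∈ dom E := by
      refine mem_dom_of_penalized_lt_top h2 ht ((h z).trans_lt ?_)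
      rw [penalized_eq_coe h1 h2 ht τ x hz]
      exact EReal.coe_lt_top _
    refine ⟨hy, fun v hv => ?_⟩
    have := h v
    rwa [penalized_eq_coe h1 h2 ht τ x hy, penalized_eq_coe h1 h2 ht τ x hv,
      EReal.coe_le_coe_iff] at this

theorem isClosed_sublevel (h1 : HypE1 E) (h2 : HypE2 E) {t : ℝ} (ht : 0 ≤ t) (c : ℝ) :
    IsClosed {u | u ∈ dom E ∧ realEnergy E t u ≤ c} := by
  have : {u | u ∈ dom E ∧ realEnergy E t u ≤ c} = E t ⁻¹' Iic (c : EReal) := by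
    ext u
    simp only [mem_ofPred_eq, mem_preimage, mem_Iic]
    constructor
    · rintro ⟨hu, h⟩
      rw [← coe_realEnergy h1 h2 ht hu]
      exact EReal.coe_le_coe_iff.2 h
    · intro h
      have hu : u ∈ dom E := (mem_dom_iff h2 ht).2 (h.trans_lt (EReal.coe_lt_top c))
      rw [← coe_realEnergy h1 h2 ht hu, EReal.coe_le_coe_iff] at h
      exact ⟨hu, h⟩
  rw [this]
  exact (h1 t ht).2.2.isClosed_preimage _

/-- `B` is a multiple of the primitive of `β`, extended by zero to negative times so that
monotonicity and continuity hold on all of `ℝ`. The factor `2 + 2 * dist o us ^ 2` pays for the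
change of base point from `us` to `o`. -/
theorem exists_time_modulus (h3 : HypE3 E) (o : X) : ∃ B : ℝ → ℝ, Monotone B ∧ Continuous B ∧
    (∀ T, AbsolutelyContinuousOnInterval B 0 T) ∧
    ∀ u ∈ dom E, ∀ s t, 0 ≤ s → s ≤ t →
      |realEnergy E t u - realEnergy E s u| ≤ (B t - B s) * (1 + dist u o ^ 2) := by
  obtain ⟨us, β, hβ0, hβ, hE⟩ := h3
  set β' := (Ici (0 : ℝ)).indicator β with hβ'
  have hint : ∀ a b, IntervalIntegrable β' volume a b := by
    intro a b
    refine MeasureTheory.IntegrableOn.intervalIntegrable ?_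
    rw [hβ', IntegrableOn, integrable_indicator_iff measurableSet_Ici, IntegrableOn,
      Measure.restrict_restrict measurableSet_Ici]
    refine hβ.integrableOn_compact_subset inter_subset_left ?_
    exact isCompact_uIcc.inter_left isClosed_Ici
  have hnn : ∀ x, 0 ≤ β' x := fun x => indicator_nonneg (fun t ht => hβ0 t ht) x
  set K := 2 + 2 * dist o us ^ 2 with hK
  have hsub : ∀ s t, K * (∫ r in (0 : ℝ)..t, β' r) - K * (∫ r in (0 : ℝ)..s, β' r) =
      K * ∫ r in s..t, β' r := by
    intro s t
    rw [← mul_sub, intervalIntegral.integral_interval_sub_left (hint _ _) (hint _ _)]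
  refine ⟨fun t => K * ∫ r in (0 : ℝ)..t, β' r, ?_, ?_, ?_, ?_⟩
  · intro s t hst
    rw [← sub_nonneg, hsub]
    exact mul_nonneg (by positivity) (intervalIntegral.integral_nonneg hst fun x _ => hnn x)
  · exact continuous_const.mul (intervalIntegral.continuous_primitive hint 0)
  · intro T
    exact ((hint 0 T).absolutelyContinuousOnInterval_intervalIntegral (by simp)).const_mul K
  · intro u hu s t hs hst
    have h := hE u hu s t hs hst
    have e : ∫ r in s..t, β r = ∫ r in s..t, β' r := by
      refine intervalIntegral.integral_congr fun x hx => ?_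
      rw [uIcc_of_le hst] at hx
      exact (indicator_of_mem (show x ∈ Ici 0 from hs.trans hx.1) β).symm
    rw [hsub]
    refine h.trans ?_
    rw [e, mul_comm K, mul_assoc]
    refine mul_le_mul_of_nonneg_left ?_ (intervalIntegral.integral_nonneg hst fun x _ => hnn x)
    have := dist_sq_le_two_mul u o us
    have h0 : 0 ≤ dist o us ^ 2 * dist u o ^ 2 := by positivity
    rw [hK]
    linarith

/-- A bound below for a single Moreau-Yosida value says that the energy decreases at most
quadratically in the distance from `us`; the rest is a change of base point. -/
theorem exists_lower_bound (h1 : HypE1 E) (h2 : HypE2 E) (h4 : HypE4 E) (o : X) {T : ℝ}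
    (hT : 0 < T) : ∃ A, 0 ≤ A ∧ ∀ t ∈ Icc 0 T, ∀ v ∈ dom E,
      -A * (1 + dist v o ^ 2) ≤ realEnergy E t v := by
  obtain ⟨us, τ, hτ, m, hm⟩ := h4 T hT
  refine ⟨|m| + (dist us o ^ 2 + 1) / τ, by positivity, fun t ht v hv => ?_⟩
  have h := (hm t ht).trans (iInf_le _ v)
  rw [penalized_eq_coe h1 h2 ht.1 τ us hv, EReal.coe_le_coe_iff] at h
  have h5 : dist us v ^ 2 / (2 * τ) ≤ (dist us o ^ 2 + dist v o ^ 2) / τ := by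
    rw [div_le_div_iff₀ (by positivity) hτ]
    have := dist_sq_le_two_mul us o v
    rw [dist_comm o v] at this
    nlinarith
  have h6 : (dist us o ^ 2 + dist v o ^ 2) / τ ≤ (dist us o ^ 2 + 1) / τ * (1 + dist v o ^ 2) := by
    rw [div_mul_eq_mul_div]
    gcongr
    nlinarith [mul_nonneg (sq_nonneg (dist us o)) (sq_nonneg (dist v o))]
  have h7 : -m ≤ |m| * (1 + dist v o ^ 2) :=
    (neg_le_abs m).trans (le_mul_of_one_le_right (abs_nonneg _) (by linarith [sq_nonneg (dist v o)]))
  linarith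

/-- Take `κ = lamMinus lam T`, so that `lam t ≥ -κ` on the whole interval. The curve stays in the
domain because the right side of the convexity inequality is finite. -/
theorem exists_convexity (h1 : HypE1 E) (h2 : HypE2 E) (h5 : HypE5 E) {T : ℝ} (hT : 0 < T) :
    ∃ κ, 0 ≤ κ ∧ ∀ u, ∀ v₀ ∈ dom E, ∀ v₁ ∈ dom E, ∃ γ : ℝ → X, ∀ t ∈ Icc 0 T, ∀ τ, 0 < τ →
      τ * κ < 1 → ∀ s ∈ Icc (0 : ℝ) 1, γ s ∈ dom E ∧
      realEnergy E t (γ s) + dist u (γ s) ^ 2 / (2 * τ) ≤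
        (1 - s) * (realEnergy E t v₀ + dist u v₀ ^ 2 / (2 * τ)) +
          s * (realEnergy E t v₁ + dist u v₁ ^ 2 / (2 * τ))
          - (1 - τ * κ) / (2 * τ) * s * (1 - s) * dist v₀ v₁ ^ 2 := by
  obtain ⟨lam, hlam, hE⟩ := h5
  refine ⟨lamMinus lam T, le_max_right _ _, fun u v₀ hv₀ v₁ hv₁ => ?_⟩
  obtain ⟨γ, -, -, hγ⟩ := hE T hT u v₀ v₁
  refine ⟨γ, fun t ht τ hτ hτκ s hs => ?_⟩
  have h := hγ t ht τ hτ hτκ s hs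
  rw [penalized_eq_coe h1 h2 ht.1 τ u hv₀, penalized_eq_coe h1 h2 ht.1 τ u hv₁,
    ← EReal.coe_mul, ← EReal.coe_mul, ← EReal.coe_add, ← EReal.coe_sub] at h
  have hmem : γ s ∈ dom E := mem_dom_of_penalized_lt_top h2 ht.1 (h.trans_lt (EReal.coe_lt_top _))
  rw [penalized_eq_coe h1 h2 ht.1 τ u hmem, EReal.coe_le_coe_iff] at h
  refine ⟨hmem, h.trans ?_⟩
  have hle : -lamMinus lam T ≤ lam t := by
    have h3 : sInf (lam '' Icc 0 T) ≤ lam t := csInf_le (hlam T hT).2 ⟨t, ht, rfl⟩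
    have h4 : -sInf (lam '' Icc 0 T) ≤ lamMinus lam T := le_max_left _ _
    linarith
  have hs1 : 0 ≤ 1 - s := by linarith [hs.2]
  have hs0 := hs.1
  have hle' : (1 - τ * lamMinus lam T) / (2 * τ) ≤ (1 + τ * lam t) / (2 * τ) := by
    gcongr
    nlinarith
  gcongr

/-- One `B` serves all horizons, while `A` and `κ` may depend on `T`. -/
theorem exists_localHyp (h1 : HypE1 E) (h2 : HypE2 E) (h3 : HypE3 E) (h4 : HypE4 E)
    (h5 : HypE5 E) {o : X} (ho : o ∈ dom E) : ∃ B : ℝ → ℝ, ∀ T : ℕ, 0 < T →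
      ∃ A κ, LocalHyp (realEnergy E) (dom E) o B A κ T := by
  obtain ⟨B, hB1, hB2, hB3, hB4⟩ := exists_time_modulus h3 o
  refine ⟨B, fun T hT => ?_⟩
  have hT' : (0 : ℝ) < T := by exact_mod_cast hT
  obtain ⟨A, hA, hA'⟩ := exists_lower_bound h1 h2 h4 o hT'
  obtain ⟨κ, hκ, hκ'⟩ := exists_convexity h1 h2 h5 hT'
  exact ⟨A, κ, hT', ho, hA, hκ, hB1, hB2, hB3 T, fun t ht c => isClosed_sublevel h1 h2 ht.1 c,
    fun u hu s t hs hst _ => hB4 u hu s t hs hst, hA', hκ'⟩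

end Translation

/-! ### Partitions and the filter of vanishing mesh -/

section Partition

theorem TimePartition.le_node_index (P : TimePartition) (t : ℝ) : t ≤ P.node (P.index t) :=
  Nat.sInf_mem (s := {n | t ≤ P.node n}) (P.tendsto.eventually_ge_atTop t).exists

theorem TimePartition.index_le (P : TimePartition) {t : ℝ} {n : ℕ} (h : t ≤ P.node n) :
    P.index t ≤ n := Nat.sInf_le h

theorem TimePartition.node_lt_of_lt_index (P : TimePartition) {t : ℝ} {n : ℕ}
    (h : n < P.index t) : P.node n < t := by
  by_contra hc
  exact (P.index_le (not_lt.1 hc)).not_gt h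

theorem TimePartition.lt_index_of_node_lt (P : TimePartition) {t : ℝ} {n : ℕ}
    (h : P.node n < t) : n < P.index t := by
  by_contra hc
  exact ((P.le_node_index t).trans (P.strictMono.monotone (not_lt.1 hc))).not_gt h

theorem TimePartition.index_mono (P : TimePartition) : Monotone P.index := fun _ _ hst =>
  P.index_le (hst.trans (P.le_node_index _))

theorem TimePartition.node_nonneg (P : TimePartition) (n : ℕ) : 0 ≤ P.node n :=
  P.node_zero ▸ P.strictMono.monotone n.zero_le

theorem TimePartition.sub_le_of_mesh_le (P : TimePartition) {δ : ℝ} (hδ : 0 ≤ δ)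
    (h : P.mesh ≤ ENNReal.ofReal δ) (n : ℕ) : P.node (n + 1) - P.node n ≤ δ :=
  (ENNReal.ofReal_le_ofReal_iff hδ).1
    ((le_iSup (fun n => ENNReal.ofReal (P.node (n + 1) - P.node n)) n).trans h)

theorem TimePartition.node_index_mem (P : TimePartition) {δ t : ℝ} (hδ : 0 ≤ δ)
    (h : ∀ n, P.node (n + 1) - P.node n ≤ δ) (ht : 0 ≤ t) :
    |P.node (P.index t) - t| ≤ δ ∧ |P.node (P.index t - 1) - t| ≤ δ := by
  have h1 := P.le_node_index t
  rcases hk : P.index t with _ | k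
  -- Index `0` forces `t = 0`, and there the truncated subtraction `0 - 1 = 0` still selects the
  -- right node.
  · rw [hk, P.node_zero] at h1
    have : t = 0 := le_antisymm h1 ht
    simp [P.node_zero, this, hδ]
  · have h2 := P.node_lt_of_lt_index (t := t) (n := k) (by omega)
    have h3 := h k
    rw [hk] at h1
    rw [Nat.add_sub_cancel, abs_le, abs_le]
    refine ⟨⟨?_, ?_⟩, ?_, ?_⟩ <;> linarith

theorem eventually_mesh_le {δ : ℝ} (hδ : 0 < δ) :
    ∀ᶠ P in meshToZero, ∀ n, P.node (n + 1) - P.node n ≤ δ := by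
  have : ∀ᶠ x : ℝ≥0∞ in 𝓝 0, x < ENNReal.ofReal δ := gt_mem_nhds (ENNReal.ofReal_pos.2 hδ)
  filter_upwards [tendsto_comap.eventually this] with P hP
  exact P.sub_le_of_mesh_le hδ.le hP.le

/-- The partition with constant step size. -/
def uniformPartition (h : ℝ) (hh : 0 < h) : TimePartition where
  node n := n * h
  node_zero := by simp
  strictMono m n hmn := by
    have : (m : ℝ) < n := by exact_mod_cast hmn
    simp only
    gcongr
  tendsto := tendsto_natCast_atTop_atTop.atTop_mul_const hh

theorem mesh_uniformPartition (h : ℝ) (hh : 0 < h) :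
    (uniformPartition h hh).mesh = ENNReal.ofReal h := by
  have : ∀ n : ℕ, ((n + 1 : ℕ) : ℝ) * h - n * h = h := fun n => by push_cast; ring
  simp [TimePartition.mesh, uniformPartition, ← sub_mul]

/-- Uniform partitions have arbitrarily small mesh. On a trivial filter `IsSchemeLimit` would be
vacuous and its limit not unique. -/
instance meshToZero_neBot : meshToZero.NeBot := by
  refine comap_neBot fun s hs => ?_
  obtain ⟨a, ha, has⟩ := ENNReal.nhds_zero_basis.mem_iff.1 hs
  obtain ⟨b, hb0, hba⟩ := exists_between ha
  have hb : b ≠ ⊤ := hba.ne_top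
  refine ⟨uniformPartition b.toReal (ENNReal.toReal_pos hb0.ne' hb), has ?_⟩
  rw [mesh_uniformPartition, ENNReal.ofReal_toReal hb]
  exact hba

end Partition

/-! ### Uniqueness and identification of the scheme limit -/

variable {E : ℝ → X → EReal}

theorem IsSchemeLimit.eqOn {U0 : TimePartition → X} {u u' : ℝ → X}
    (h : IsSchemeLimit E U0 u) (h' : IsSchemeLimit E U0 u') : EqOn u u' (Ici 0) := by
  intro t ht
  refine eq_of_forall_dist_le fun ε hε => ?_
  have ht' : t ∈ Icc 0 (t + 1) := ⟨ht, by linarith⟩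
  have hT : 0 < t + 1 := by have : 0 ≤ t := ht
                            linarith
  obtain ⟨P, ⟨⟨U, hU⟩, h1⟩, -, h2⟩ :=
    ((h (t + 1) hT (ε / 2) (by positivity)).and (h' (t + 1) hT (ε / 2) (by positivity))).exists
  have h3 := (h1 U hU t ht').1
  have h4 := (h2 U hU t ht').1
  have h5 := dist_triangle_left (u t) (u' t) (upperInterp P U t)
  linarith

/-- The comparison estimate controls any discrete solution at its nodes, and the Hölder bound for
`u` passes from a node to a nearby time. -/
theorem isSchemeLimit_of_eviCurve [CompleteSpace X] (h1 : HypE1 E) (h2 : HypE2 E) {o : X}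
    (ho : o ∈ dom E) {U0 : TimePartition → X} (hU0 : Tendsto U0 meshToZero (𝓝 o)) {u : ℝ → X}
    (hu0 : u 0 = o) {B : ℝ → ℝ} (hu : ∀ T : ℕ, 0 < T → ∃ A κ C, 0 ≤ C ∧
      LocalHyp (realEnergy E) (dom E) o B A κ T ∧
      EVICurve (realEnergy E) (dom E) o B κ C (Icc 0 (T : ℝ)) u) :
    IsSchemeLimit E U0 u := by
  intro T hT ε hε
  obtain ⟨H, hH⟩ := exists_nat_ge T
  -- The last node used may exceed `T` by one step; with mesh at most `1` it stays below `H + 1`.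
  obtain ⟨A, κ, C, hC, hloc, hcur⟩ := hu (H + 1) H.succ_pos
  push_cast at hloc hcur
  obtain ⟨K, δ₁, hδ₁, hK, hcomp⟩ := hloc.exists_comparison hC
  have hA := hloc.lower_nonneg
  have hκ := hloc.kappa_nonneg
  obtain ⟨δ, hδ0, hδ⟩ : ∃ δ : ℝ, 0 < δ ∧ (δ ≤ 1 ∧ δ ≤ δ₁ ∧ δ * (4 * A + κ + 1) < 1 ∧
      K * (δ + δ) < (ε / 2) ^ 2 ∧ C * δ < (ε / 2) ^ 2) := by
    have l0 : Tendsto (fun δ : ℝ => δ) (𝓝[>] 0) (𝓝 0) := tendsto_id.mono_left nhdsWithin_le_nhds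
    have l1 : Tendsto (fun δ : ℝ => δ * (4 * A + κ + 1)) (𝓝[>] 0) (𝓝 0) := by
      simpa using l0.mul_const (4 * A + κ + 1)
    have l2 : Tendsto (fun δ : ℝ => K * (δ + δ)) (𝓝[>] 0) (𝓝 0) := by
      simpa using (l0.add l0).const_mul K
    have l3 : Tendsto (fun δ : ℝ => C * δ) (𝓝[>] 0) (𝓝 0) := by
      simpa using l0.const_mul C
    have hε2 : 0 < (ε / 2) ^ 2 := by positivity
    have := (eventually_mem_nhdsWithin (a := (0 : ℝ)) (s := Ioi 0)).and
      ((l0.eventually_le_const one_pos).and ((l0.eventually_le_const hδ₁).and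
      ((l1.eventually_lt_const one_pos).and ((l2.eventually_lt_const hε2).and
      (l3.eventually_lt_const hε2)))))
    exact this.exists
  obtain ⟨hδ1, hδδ₁, hδA, hδK, hδC⟩ := hδ
  have hδκ : δ * κ < 1 := by nlinarith [mul_nonneg hδ0.le hA]
  have hδA' : 4 * A * δ ≤ 1 := by nlinarith [mul_nonneg hδ0.le hκ]
  have hdat : ∀ᶠ P in meshToZero, dist (U0 P) o ^ 2 < δ := by
    have : Tendsto (fun P => dist (U0 P) o ^ 2) meshToZero (𝓝 (dist o o ^ 2)) :=
      (hU0.dist tendsto_const_nhds).pow 2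
    rw [dist_self, zero_pow two_ne_zero] at this
    exact this.eventually_lt_const hδ0
  filter_upwards [hdat, eventually_mesh_le hδ0] with P hP hmesh
  set N := P.index T with hN
  have hnode : ∀ n ≤ N, P.node n ≤ H + 1 := by
    intro n hn
    have h3 := (abs_le.1 (P.node_index_mem hδ0.le hmesh hT.le).1).2
    have h4 := P.strictMono.monotone hn
    linarith
  have hnode' : ∀ n ≤ N, P.node n ∈ Icc (0 : ℝ) (H + 1) := fun n hn =>
    ⟨P.node_nonneg n, hnode n hn⟩
  refine ⟨⟨schemeSol (realEnergy E) (dom E) P.node (U0 P), rfl, fun n hn => ?_⟩, ?_⟩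
  · have hS := scheme_schemeSol hloc (U0 P) P.node_zero P.strictMono (hnode N le_rfl)
      (fun n _ => hmesh n) hδκ hδA'
    exact (isStepMin_iff h1 h2 ⟨o, ho⟩ (P.node_nonneg _)).1
      (hS.step n (P.lt_index_of_node_lt hn))
  · intro U hU t ht
    have hS : Scheme (realEnergy E) (dom E) (H + 1) δ P.node U N :=
      ⟨P.node_zero, P.strictMono, hnode N le_rfl, fun n _ => hmesh n, fun n hn =>
        (isStepMin_iff h1 h2 ⟨o, ho⟩ (P.node_nonneg _)).2
          (hU.2 n (P.node_lt_of_lt_index hn))⟩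
    have hclose : ∀ n ≤ N, |P.node n - t| ≤ δ → dist (U n) (u t) < ε := by
      intro n hn hnt
      have h3 := hcomp _ _ subset_rfl hcur _ _ _ _ hδ0.le hδδ₁ hS hnode' n hn
      rw [hU.1, hu0] at h3
      have h4 : dist (U n) (u (P.node n)) < ε / 2 := by
        refine lt_of_pow_lt_pow_left₀ 2 (by positivity) (h3.trans_lt (lt_of_le_of_lt ?_ hδK))
        gcongr
      have htI : t ∈ Icc (0 : ℝ) (H + 1) := ⟨ht.1, by linarith [ht.2]⟩
      have h5 : dist (u (P.node n)) (u t) ^ 2 ≤ C * |P.node n - t| := by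
        rcases le_total t (P.node n) with hle | hle
        · rw [abs_of_nonneg (by linarith)]
          exact hcur.holder _ htI _ (hnode' n hn) hle
        · rw [abs_sub_comm, abs_of_nonneg (by linarith), dist_comm]
          exact hcur.holder _ (hnode' n hn) _ htI hle
      have h6 : dist (u (P.node n)) (u t) < ε / 2 := by
        refine lt_of_pow_lt_pow_left₀ 2 (by positivity) (h5.trans_lt (lt_of_le_of_lt ?_ hδC))
        gcongr
      have h7 := dist_triangle (U n) (u (P.node n)) (u t)
      linarith
    obtain ⟨h3, h4⟩ := P.node_index_mem hδ0.le hmesh ht.1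
    have h5 : P.index t ≤ N := P.index_mono ht.2
    exact ⟨hclose _ h5 h3, hclose _ (by omega) h4⟩

end TimeGradFlow

/-! ### Absolute continuity and the metric derivative -/

namespace TimeGradFlow

variable {X : Type*} [MetricSpace X]

/-- A monotone `g`, even with jumps, sends disjoint time intervals to disjoint open intervals inside
`[g a, g b]`. Additivity of Lebesgue measure then replaces sorting the intervals. -/
theorem sum_abs_sub_le_of_mem_disjWithin {g : ℝ → ℝ} {a b : ℝ} (hab : a ≤ b)
    (hg : MonotoneOn g (Icc a b)) {E : ℕ × (ℕ → ℝ × ℝ)}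
    (hE : E ∈ AbsolutelyContinuousOnInterval.disjWithin a b) :
    ∑ i ∈ Finset.range E.1, |g (E.2 i).1 - g (E.2 i).2| ≤ g b - g a := by
  obtain ⟨hmem, hdisj⟩ := hE
  rw [uIcc_of_le hab] at hmem
  set p : ℕ → ℝ := fun i => min (E.2 i).1 (E.2 i).2 with hp
  set q : ℕ → ℝ := fun i => max (E.2 i).1 (E.2 i).2 with hq
  have hpI : ∀ i ∈ Finset.range E.1, p i ∈ Icc a b := fun i hi =>
    ⟨le_min (hmem i hi).1.1 (hmem i hi).2.1, (min_le_left _ _).trans (hmem i hi).1.2⟩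
  have hqI : ∀ i ∈ Finset.range E.1, q i ∈ Icc a b := fun i hi =>
    ⟨(hmem i hi).1.1.trans (le_max_left _ _), max_le (hmem i hi).1.2 (hmem i hi).2.2⟩
  have hpq : ∀ i, p i ≤ q i := fun i => min_le_max
  have habs : ∀ i ∈ Finset.range E.1, |g (E.2 i).1 - g (E.2 i).2| = g (q i) - g (p i) := by
    intro i hi
    rcases le_total (E.2 i).1 (E.2 i).2 with h | h
    · have := hg (hmem i hi).1 (hmem i hi).2 h
      simp only [hp, hq, min_eq_left h, max_eq_right h]
      rw [abs_sub_comm, abs_of_nonneg (sub_nonneg.2 this)]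
    · have := hg (hmem i hi).2 (hmem i hi).1 h
      simp only [hp, hq, min_eq_right h, max_eq_left h]
      rw [abs_of_nonneg (sub_nonneg.2 this)]
  have hlt : ∀ i ∈ Finset.range E.1, ∀ j ∈ Finset.range E.1, ∀ y, g (p i) < y → y < g (q j) →
      p i < q j := by
    intro i hi j hj y h1 h2
    by_contra hc
    exact (h1.trans h2).not_ge (hg (hqI j hj) (hpI i hi) (not_lt.1 hc))
  have hd : (Finset.range E.1 : Set ℕ).PairwiseDisjoint fun i => Ioo (g (p i)) (g (q i)) := by
    intro i hi j hj hij
    rw [Function.onFun, Set.disjoint_left]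
    intro y hyi hyj
    have h1 := hlt i hi j hj y hyi.1 hyj.2
    have h2 := hlt j hj i hi y hyj.1 hyi.2
    have h3 := hlt i hi i hi y hyi.1 hyi.2
    have h4 := hlt j hj j hj y hyj.1 hyj.2
    -- If two image intervals met, the smaller right endpoint would lie in both half-open time
    -- intervals.
    have h5 : min (q i) (q j) ∈ uIoc (E.2 i).1 (E.2 i).2 := ⟨lt_min h3 h1, min_le_left _ _⟩
    have h6 : min (q i) (q j) ∈ uIoc (E.2 j).1 (E.2 j).2 := ⟨lt_min h2 h4, min_le_right _ _⟩
    exact Set.disjoint_left.1 (hdisj hi hj hij) h5 h6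
  have hsum := measure_biUnion_finset (μ := volume) hd fun i _ => measurableSet_Ioo
  have hsub : (⋃ i ∈ Finset.range E.1, Ioo (g (p i)) (g (q i))) ⊆ Icc (g a) (g b) := by
    refine iUnion₂_subset fun i hi => Ioo_subset_Icc_self.trans (Icc_subset_Icc ?_ ?_)
    · exact hg (left_mem_Icc.2 hab) (hpI i hi) (hpI i hi).1
    · exact hg (hqI i hi) (right_mem_Icc.2 hab) (hqI i hi).2
  have h1 := measure_mono (μ := volume) hsub
  rw [hsum, Real.volume_Icc] at h1
  simp only [Real.volume_Ioo] at h1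
  rw [← ENNReal.ofReal_sum_of_nonneg (fun i hi => sub_nonneg.2 (hg (hpI i hi) (hqI i hi) (hpq i))),
    ENNReal.ofReal_le_ofReal_iff
      (sub_nonneg.2 (hg (left_mem_Icc.2 hab) (right_mem_Icc.2 hab) hab))] at h1
  rwa [Finset.sum_congr rfl habs]

/-- By Young's inequality, `2d ≤ (t - s)/η + η (g t - g s)`. The increments of `g` have bounded sum,
so `η` is fixed first and the total length afterwards; `g` need not be continuous. -/
theorem absolutelyContinuousOnInterval_of_dist_sq_le {f : ℝ → X} {g : ℝ → ℝ} {a b : ℝ}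
    (hab : a ≤ b) (hg : MonotoneOn g (Icc a b))
    (h : ∀ s ∈ Icc a b, ∀ t ∈ Icc a b, s ≤ t → dist (f t) (f s) ^ 2 ≤ (t - s) * (g t - g s)) :
    AbsolutelyContinuousOnInterval f a b := by
  rw [absolutelyContinuousOnInterval_iff]
  intro ε hε
  have hG : 0 ≤ g b - g a := sub_nonneg.2 (hg (left_mem_Icc.2 hab) (right_mem_Icc.2 hab) hab)
  set η := ε / (g b - g a + 1) with hη
  have hη0 : 0 < η := by positivity
  refine ⟨η * ε, by positivity, fun E hE hlen => ?_⟩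
  have hmem := hE.1
  rw [uIcc_of_le hab] at hmem
  have hkey : ∀ s t : ℝ, dist (f t) (f s) ^ 2 ≤ (t - s) * (g t - g s) → 0 ≤ t - s →
      0 ≤ g t - g s → 2 * dist (f t) (f s) ≤ (t - s) / η + η * (g t - g s) := by
    intro s t h1 h2 h3
    have h4 : 0 ≤ (t - s) / η + η * (g t - g s) := by positivity
    have h5 : (2 * dist (f t) (f s)) ^ 2 ≤ ((t - s) / η + η * (g t - g s)) ^ 2 := by
      have h6 : (t - s) / η * (η * (g t - g s)) = (t - s) * (g t - g s) := by field_simp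
      nlinarith [sq_nonneg ((t - s) / η - η * (g t - g s))]
    exact le_of_sq_le_sq h5 h4
  have hterm : ∀ i ∈ Finset.range E.1, 2 * dist (f (E.2 i).1) (f (E.2 i).2) ≤
      dist (E.2 i).1 (E.2 i).2 / η + η * |g (E.2 i).1 - g (E.2 i).2| := by
    intro i hi
    obtain ⟨h1, h2⟩ := hmem i hi
    rw [Real.dist_eq]
    rcases le_total (E.2 i).1 (E.2 i).2 with h3 | h3
    · have h4 := hg h1 h2 h3
      rw [dist_comm, abs_sub_comm, abs_of_nonneg (sub_nonneg.2 h3), abs_sub_comm,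
        abs_of_nonneg (sub_nonneg.2 h4)]
      exact hkey _ _ (h _ h1 _ h2 h3) (sub_nonneg.2 h3) (sub_nonneg.2 h4)
    · have h4 := hg h2 h1 h3
      rw [abs_of_nonneg (sub_nonneg.2 h3), abs_of_nonneg (sub_nonneg.2 h4)]
      exact hkey _ _ (h _ h2 _ h1 h3) (sub_nonneg.2 h3) (sub_nonneg.2 h4)
  have h1 := Finset.sum_le_sum hterm
  rw [← Finset.mul_sum, Finset.sum_add_distrib, ← Finset.sum_div, ← Finset.mul_sum] at h1
  have h2 := mul_le_mul_of_nonneg_left (sum_abs_sub_le_of_mem_disjWithin hab hg hE) hη0.le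
  have h3 : (∑ i ∈ Finset.range E.1, dist (E.2 i).1 (E.2 i).2) / η < ε := by
    rwa [div_lt_iff₀ hη0, mul_comm]
  have h4 : η * (g b - g a) ≤ ε := by
    rw [hη, div_mul_eq_mul_div, div_le_iff₀ (by positivity)]
    nlinarith
  linarith

theorem absolutelyContinuousOnInterval_of_dist_le {Y Z : Type*} [MetricSpace Y] [MetricSpace Z]
    {f : ℝ → Y} {F : ℝ → Z} {a b : ℝ} (hF : AbsolutelyContinuousOnInterval F a b)
    (h : ∀ s ∈ uIcc a b, ∀ t ∈ uIcc a b, dist (f s) (f t) ≤ dist (F s) (F t)) :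
    AbsolutelyContinuousOnInterval f a b := by
  rw [absolutelyContinuousOnInterval_iff] at hF ⊢
  intro ε hε
  obtain ⟨δ, hδ, hF⟩ := hF ε hε
  refine ⟨δ, hδ, fun E hE hlen => lt_of_le_of_lt (Finset.sum_le_sum fun i hi => ?_) (hF E hE hlen)⟩
  exact h _ (hE.1 i hi).1 _ (hE.1 i hi).2

theorem sq_abs_deriv_le_deriv {f g : ℝ → ℝ} {a b t : ℝ} (ht : t ∈ Ioo a b)
    (hf : DifferentiableAt ℝ f t) (hg : DifferentiableAt ℝ g t)
    (h : ∀ s ∈ Icc a b, t ≤ s → (f s - f t) ^ 2 ≤ (s - t) * (g s - g t)) :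
    deriv f t ^ 2 ≤ deriv g t := by
  have l1 := (hasDerivAt_iff_tendsto_slope.1 hf.hasDerivAt).mono_left
    (nhdsWithin_mono t (fun x (hx : x ∈ Ioi t) => ne_of_gt hx))
  have l2 := (hasDerivAt_iff_tendsto_slope.1 hg.hasDerivAt).mono_left
    (nhdsWithin_mono t (fun x (hx : x ∈ Ioi t) => ne_of_gt hx))
  refine le_of_tendsto_of_tendsto (l1.pow 2) l2 ?_
  filter_upwards [Ioo_mem_nhdsGT ht.2] with s hs
  have h1 := h s ⟨ht.1.le.trans hs.1.le, hs.2.le⟩ hs.1.le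
  have h2 : 0 < s - t := sub_pos.2 hs.1
  rw [slope_def_field, slope_def_field, div_pow, div_le_div_iff₀ (by positivity) h2]
  nlinarith

/-- Existence and square-integrability of the metric derivative. -/
theorem exists_metric_derivative [TopologicalSpace.SeparableSpace X] {u : ℝ → X} {g : ℝ → ℝ}
    {a b : ℝ} (hab : a ≤ b) (hg : MonotoneOn g (Icc a b))
    (h : ∀ s ∈ Icc a b, ∀ t ∈ Icc a b, s ≤ t → dist (u t) (u s) ^ 2 ≤ (t - s) * (g t - g s)) :
    ∃ m : ℝ → ℝ, Measurable m ∧ (∀ t, 0 ≤ m t) ∧ IntervalIntegrable m volume a b ∧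
      IntervalIntegrable (fun t => m t ^ 2) volume a b ∧
      (∀ s ∈ Icc a b, ∀ t ∈ Icc a b, s ≤ t → dist (u s) (u t) ≤ ∫ r in s..t, m r) ∧
      ∀ᵐ t, t ∈ Ioo a b →
        Tendsto (fun s => dist (u s) (u t) / |s - t|) (𝓝[≠] t) (𝓝 (m t)) := by
  have : Nonempty X := ⟨u 0⟩
  set q := TopologicalSpace.denseSeq X
  set f : ℕ → ℝ → ℝ := fun n t => dist (u t) (q n) with hf
  have hu := absolutelyContinuousOnInterval_of_dist_sq_le hab hg h
  have hfd : ∀ n s t, |f n s - f n t| ≤ dist (u s) (u t) := fun n s t =>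
    abs_dist_sub_le _ _ _
  have hfAC : ∀ n, AbsolutelyContinuousOnInterval (f n) a b := fun n =>
    absolutelyContinuousOnInterval_of_dist_le hu fun s _ t _ => by
      rw [Real.dist_eq]; exact hfd n s t
  have hgd : ∀ᵐ t, t ∈ Ioo a b → DifferentiableAt ℝ g t := by
    filter_upwards [hg.ae_differentiableWithinAt_of_mem] with t h1 h2
    exact (h1 (Ioo_subset_Icc_self h2)).differentiableAt (Icc_mem_nhds h2.1 h2.2)
  have hfd' : ∀ᵐ t, ∀ n, t ∈ Ioo a b → DifferentiableAt ℝ (f n) t := by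
    refine ae_all_iff.2 fun n => ?_
    filter_upwards [(hfAC n).ae_differentiableAt] with t h1 h2
    exact h1 (by rw [uIcc_of_le hab]; exact Ioo_subset_Icc_self h2)
  -- The distances to a dense sequence recover the metric. Their derivatives are bounded almost
  -- everywhere by the square root of `deriv g`, so the supremum is finite and square-integrable.
  set m : ℝ → ℝ := fun t => ⨆ n, |deriv (f n) t| with hm
  have hmeas : Measurable m := Measurable.iSup fun n => (measurable_deriv (f n)).norm
  have hm0 : ∀ t, 0 ≤ m t := fun t => Real.iSup_nonneg fun n => abs_nonneg _
  have hbd : ∀ᵐ t, t ∈ Ioo a b → 0 ≤ deriv g t ∧ ∀ n, |deriv (f n) t| ≤ √(deriv g t) := by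
    filter_upwards [hgd, hfd'] with t h1 h2 ht
    have key : ∀ n, deriv (f n) t ^ 2 ≤ deriv g t := fun n =>
      sq_abs_deriv_le_deriv ht (h2 n ht) (h1 ht) fun s hs hts => by
        have h3 := h t (Ioo_subset_Icc_self ht) s hs hts
        refine le_trans ?_ h3
        rw [← sq_abs]
        have := hfd n s t
        gcongr
    exact ⟨(sq_nonneg _).trans (key 0), fun n => Real.abs_le_sqrt (key n)⟩
  have hle : ∀ᵐ t, t ∈ Ioo a b → ∀ n, |deriv (f n) t| ≤ m t := by
    filter_upwards [hbd] with t h1 ht n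
    exact le_ciSup (f := fun n => |deriv (f n) t|)
      ⟨√(deriv g t), by rintro _ ⟨k, rfl⟩; exact (h1 ht).2 k⟩ n
  have hIoo : ∀ {p : ℝ → Prop}, (∀ᵐ t, t ∈ Ioo a b → p t) →
      ∀ᵐ t ∂(volume.restrict (uIoc a b)), p t := by
    intro p hp
    rw [uIoc_of_le hab, ← restrict_Ioo_eq_restrict_Ioc, ae_restrict_iff' measurableSet_Ioo]
    exact hp
  have hgi : IntervalIntegrable (deriv g) volume a b :=
    MonotoneOn.intervalIntegrable_deriv (by rwa [uIcc_of_le hab])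
  have hsq : ∀ᵐ t, t ∈ Ioo a b → m t ^ 2 ≤ deriv g t := by
    filter_upwards [hbd] with t h1 ht
    have h2 : m t ≤ √(deriv g t) := ciSup_le fun n => (h1 ht).2 n
    calc m t ^ 2 ≤ √(deriv g t) ^ 2 := by have := hm0 t; gcongr
      _ = deriv g t := Real.sq_sqrt (h1 ht).1
  have hi2 : IntervalIntegrable (fun t => m t ^ 2) volume a b := by
    refine hgi.mono_fun (hmeas.pow_const 2).aestronglyMeasurable ?_
    filter_upwards [hIoo hsq] with t ht
    rw [Real.norm_of_nonneg (sq_nonneg _)]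
    exact ht.trans (le_abs_self _)
  have hi1 : IntervalIntegrable m volume a b := by
    refine (hi2.add (intervalIntegrable_const (c := (1 : ℝ)))).mono_fun
      hmeas.aestronglyMeasurable (Eventually.of_forall fun t => ?_)
    simp only [Real.norm_eq_abs]
    rw [abs_of_nonneg (hm0 t), abs_of_nonneg (by positivity)]
    nlinarith [sq_nonneg (m t - 1)]
  have hsubI : ∀ s ∈ Icc a b, ∀ t ∈ Icc a b, uIcc s t ⊆ uIcc a b := fun s hs t ht => by
    rw [uIcc_of_le hab]
    exact uIcc_subset_Icc hs ht
  have hdist : ∀ s ∈ Icc a b, ∀ t ∈ Icc a b, s ≤ t → dist (u s) (u t) ≤ ∫ r in s..t, m r := by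
    intro s hs t ht hst
    refine le_of_forall_pos_le_add fun ε hε => ?_
    obtain ⟨n, hn⟩ := (TopologicalSpace.denseRange_denseSeq X).exists_dist_lt (u s)
      (half_pos hε)
    have hAC := (hfAC n).mono (hsubI s hs t ht)
    have h1 : f n t - f n s ≤ ∫ r in s..t, m r := by
      rw [← hAC.integral_deriv_eq_sub]
      refine intervalIntegral.integral_mono_ae_restrict hst hAC.intervalIntegrable_deriv
        (hi1.mono_set (hsubI s hs t ht)) ?_
      rw [← restrict_Ioo_eq_restrict_Icc]
      refine (ae_restrict_iff' measurableSet_Ioo).2 ?_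
      filter_upwards [hle] with r h2 hr
      exact (le_abs_self _).trans (h2 ⟨hs.1.trans_lt hr.1, hr.2.trans_le ht.2⟩ n)
    have h2 := dist_triangle_right (u s) (u t) (q n)
    simp only [hf] at h1
    change dist (u s) (q n) < _ at hn
    linarith
  refine ⟨m, hmeas, hm0, hi1, hi2, hdist, ?_⟩
  -- The metric difference quotient lies above that of each `f n` and below the average of `m`; the
  -- latter tends to `m t` almost everywhere by Lebesgue differentiation.
  filter_upwards [hi1.ae_hasDerivAt_integral, hfd', hbd] with t h1 h2 h3 ht
  have htI := Ioo_subset_Icc_self ht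
  have hM := h1 (by rw [uIcc_of_le hab]; exact htI) a left_mem_uIcc
  have hsub : ∀ᶠ s in 𝓝[≠] t, s ∈ Icc a b := nhdsWithin_le_nhds (Icc_mem_nhds ht.1 ht.2)
  rw [tendsto_order]
  constructor
  · intro c hc
    obtain ⟨n, hn⟩ := exists_lt_of_lt_ciSup hc
    have l := (hasDerivAt_iff_tendsto_slope.1 (h2 n ht).hasDerivAt).abs
    filter_upwards [l.eventually_const_lt hn] with s hs
    refine hs.trans_le ?_
    rw [slope_def_field, abs_div]
    gcongr
    exact hfd n s t
  · intro c hc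
    have l := (hasDerivAt_iff_tendsto_slope.1 hM).abs
    rw [abs_of_nonneg (hm0 t)] at l
    filter_upwards [l.eventually_lt_const hc, hsub] with s hs hsI
    refine lt_of_le_of_lt ?_ hs
    rw [slope_def_field, abs_div]
    gcongr
    have hia : ∀ x ∈ Icc a b, IntervalIntegrable m volume a x := fun x hx =>
      hi1.mono_set (hsubI a (left_mem_Icc.2 hab) x hx)
    rw [intervalIntegral.integral_interval_sub_left (hia s hsI) (hia t htI)]
    rcases le_total s t with hst | hst
    · rw [intervalIntegral.integral_symm, abs_neg]
      exact (hdist s hsI t htI hst).trans (le_abs_self _)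
    · rw [dist_comm]
      exact (hdist t htI s hsI hst).trans (le_abs_self _)

end TimeGradFlow

/-! ### Slope bound and absolute continuity of the energy -/

namespace TimeGradFlow

variable {X : Type*} [MetricSpace X]
variable {φ : ℝ → X → ℝ} {D : Set X} {o : X} {B : ℝ → ℝ} {A κ H C : ℝ} {u : ℝ → X}

section Curve

/-- `g` is minus twice the energy, corrected by the modulus to become monotone. Continuity of the
energy is not available at this stage. -/
theorem EVICurve.exists_monotoneOn (hu : EVICurve φ D o B κ C (Icc 0 H) u)
    (h : LocalHyp φ D o B A κ H) (hC : 0 ≤ C) {g : ℝ → ℝ}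
    (hg : g = fun t => 2 * energyRate κ C * modulus B t - 2 * φ t (u t)) :
    MonotoneOn g (Icc 0 H) ∧ ∀ s ∈ Icc 0 H, ∀ t ∈ Icc 0 H, s ≤ t →
      dist (u t) (u s) ^ 2 ≤ (t - s) * (g t - g s) := by
  subst hg
  constructor
  · intro s hs t ht hst
    have := hu.energy_le h subset_rfl hC hs ht hst
    simp only
    linarith
  · intro s hs t ht hst
    refine (hu.dist_sq_le_energy_sub h subset_rfl hC hs ht hst).trans_eq ?_
    ring

theorem EVICurve.absolutelyContinuous (hu : EVICurve φ D o B κ C (Icc 0 H) u)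
    (h : LocalHyp φ D o B A κ H) (hC : 0 ≤ C) : AbsolutelyContinuousOnInterval u 0 H := by
  obtain ⟨h1, h2⟩ := hu.exists_monotoneOn h hC rfl
  exact absolutelyContinuousOnInterval_of_dist_sq_le h.horizon_pos.le h1 h2

theorem EVICurve.intervalIntegrable_energy (hu : EVICurve φ D o B κ C (Icc 0 H) u)
    (h : LocalHyp φ D o B A κ H) (hC : 0 ≤ C) :
    IntervalIntegrable (fun t => φ t (u t)) volume 0 H := by
  have h1 := (hu.exists_monotoneOn h hC rfl).1
  rw [← uIcc_of_le h.horizon_pos.le] at h1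
  have h2 : IntervalIntegrable (modulus B) volume 0 H := h.modulus_continuous.intervalIntegrable _ _
  convert! (((h2.const_mul (2 * energyRate κ C)).sub h1.intervalIntegrable).div_const 2) using 1
  funext t
  simp

/-- The metric derivative exists almost everywhere, is square-integrable and controls the
distances. -/
theorem EVICurve.metricDeriv_spec [TopologicalSpace.SeparableSpace X]
    (hu : EVICurve φ D o B κ C (Icc 0 H) u) (h : LocalHyp φ D o B A κ H) (hC : 0 ≤ C) :
    IntervalIntegrable (metricDeriv u) volume 0 H ∧
    IntervalIntegrable (fun t => metricDeriv u t ^ 2) volume 0 H ∧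
    (∀ s ∈ Icc 0 H, ∀ t ∈ Icc 0 H, s ≤ t → dist (u s) (u t) ≤ ∫ r in s..t, metricDeriv u r) ∧
    ∀ᵐ t, t ∈ Ioo 0 H → 0 ≤ metricDeriv u t ∧
      Tendsto (fun s => dist (u s) (u t) / |s - t|) (𝓝[≠] t) (𝓝 (metricDeriv u t)) := by
  obtain ⟨h1, h2⟩ := hu.exists_monotoneOn h hC rfl
  have hH := h.horizon_pos.le
  obtain ⟨m, -, hm0, hm1, hm2, hm3, hm4⟩ := exists_metric_derivative hH h1 h2
  have heq : ∀ᵐ t, t ∈ Ioo 0 H → m t = metricDeriv u t := by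
    filter_upwards [hm4] with t ht htI
    exact (ht htI).limUnder_eq.symm
  have heq' : m =ᵐ[volume.restrict (uIoc 0 H)] metricDeriv u := by
    rw [uIoc_of_le hH, ← restrict_Ioo_eq_restrict_Ioc]
    exact (ae_restrict_iff' measurableSet_Ioo).2 heq
  refine ⟨hm1.congr_ae heq', hm2.congr_ae ?_, ?_, ?_⟩
  · filter_upwards [heq'] with t ht
    rw [ht]
  · intro s hs t ht hst
    refine (hm3 s hs t ht hst).trans_eq ?_
    rw [intervalIntegral.integral_of_le hst, intervalIntegral.integral_of_le hst,
      ← restrict_Ioo_eq_restrict_Ioc]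
    refine integral_congr_ae ?_
    refine (ae_restrict_iff' measurableSet_Ioo).2 ?_
    filter_upwards [heq] with r h3 hr
    exact h3 ⟨hs.1.trans_lt hr.1, hr.2.trans_le ht.2⟩
  · filter_upwards [hm4, heq] with t h3 h4 ht
    have h5 := hm0 t
    have h6 := h3 ht
    rw [h4 ht] at h5 h6
    exact ⟨h5, h6⟩

theorem EVICurve.continuousOn (hu : EVICurve φ D o B κ C (Icc 0 H) u) : ContinuousOn u (Icc 0 H) := by
  intro t ht
  rw [ContinuousWithinAt, tendsto_iff_dist_tendsto_zero]
  have lim : Tendsto (fun s : ℝ => √(C * |s - t|)) (𝓝[Icc 0 H] t) (𝓝 √(C * |t - t|)) := by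
    refine Tendsto.mono_left (Continuous.tendsto ?_ t) nhdsWithin_le_nhds
    fun_prop
  rw [sub_self, abs_zero, mul_zero, Real.sqrt_zero] at lim
  refine squeeze_zero' (Eventually.of_forall fun _ => dist_nonneg) ?_ lim
  filter_upwards [self_mem_nhdsWithin] with s hs
  refine Real.le_sqrt_of_sq_le ?_
  rcases le_total s t with hst | hst
  · rw [abs_sub_comm, abs_of_nonneg (sub_nonneg.2 hst), dist_comm]
    exact hu.holder s hs t ht hst
  · rw [abs_of_nonneg (sub_nonneg.2 hst)]
    exact hu.holder t ht s hs hst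

/-- Divide the inequality by `t - s` and let `s` increase to `t`: the modulus error vanishes, and
the quotient of `d²(·, v)` is controlled by the metric difference quotient. The bound holds for all
`v` in the domain, not only near `u t`, so it may be used along the curve itself. -/
theorem EVICurve.slope_bound (hu : EVICurve φ D o B κ C (Icc 0 H) u)
    (h : LocalHyp φ D o B A κ H) {t m : ℝ} (ht : t ∈ Ioo 0 H)
    (hm : Tendsto (fun s => dist (u s) (u t) / |s - t|) (𝓝[≠] t) (𝓝 m)) {v : X} (hv : v ∈ D) :
    φ t (u t) - φ t v ≤ m * dist (u t) v + κ * dist (u t) v ^ 2 := by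
  have htI := Ioo_subset_Icc_self ht
  have hc : Tendsto u (𝓝[<] t) (𝓝 (u t)) :=
    ((hu.continuousOn).continuousAt (Icc_mem_nhds ht.1 ht.2)).mono_left nhdsWithin_le_nhds
  have hm' := hm.mono_left (nhdsWithin_mono t (fun x (hx : x ∈ Iio t) => ne_of_lt hx))
  have hω : Tendsto (modulus B) (𝓝[<] t) (𝓝 (modulus B t)) :=
    (h.modulus_continuous.tendsto t).mono_left nhdsWithin_le_nhds
  have l1 : Tendsto (fun s => C * (1 + dist v o ^ 2) * (modulus B t - modulus B s)) (𝓝[<] t)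
      (𝓝 (C * (1 + dist v o ^ 2) * (modulus B t - modulus B t))) :=
    (hω.const_sub (modulus B t)).const_mul _
  have l2 : Tendsto (fun s => dist (u s) v + dist (u t) v) (𝓝[<] t)
      (𝓝 (dist (u t) v + dist (u t) v)) := (hc.dist tendsto_const_nhds).add_const _
  have lim : Tendsto (fun s => 2 * κ * dist (u t) v ^ 2 +
      C * (1 + dist v o ^ 2) * (modulus B t - modulus B s) +
      dist (u s) (u t) / |s - t| * (dist (u s) v + dist (u t) v)) (𝓝[<] t)
      (𝓝 (2 * κ * dist (u t) v ^ 2 + C * (1 + dist v o ^ 2) * (modulus B t - modulus B t) +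
        m * (dist (u t) v + dist (u t) v))) :=
    (l1.const_add _).add (hm'.mul l2)
  have key : 2 * (φ t (u t) - φ t v) ≤ 2 * κ * dist (u t) v ^ 2 +
      C * (1 + dist v o ^ 2) * (modulus B t - modulus B t) +
      m * (dist (u t) v + dist (u t) v) := by
    refine ge_of_tendsto lim ?_
    filter_upwards [Ioo_mem_nhdsLT ht.1] with s hs
    have hts : 0 < t - s := sub_pos.2 hs.2
    have h1 := hu.evi v hv s ⟨hs.1.le, hs.2.le.trans htI.2⟩ t htI hs.2.le
    rw [mul_comm, ← div_le_iff₀ hts] at h1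
    have h2 : (dist (u s) v ^ 2 - dist (u t) v ^ 2) / (t - s) ≤
        dist (u s) (u t) / |s - t| * (dist (u s) v + dist (u t) v) := by
      rw [abs_sub_comm, abs_of_pos hts, div_mul_eq_mul_div]
      refine div_le_div_of_nonneg_right ?_ hts.le
      rw [sq_sub_sq, mul_comm]
      refine mul_le_mul_of_nonneg_right ?_ (add_nonneg dist_nonneg dist_nonneg)
      linarith [dist_triangle (u s) (u t) v]
    have h5 : (dist (u s) v ^ 2 - dist (u t) v ^ 2) / (t - s) =
      -((dist (u t) v ^ 2 - dist (u s) v ^ 2) / (t - s)) := by rw [← neg_div, neg_sub]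
    rw [h5] at h2
    linarith only [h1, h2]
  rw [sub_self, mul_zero] at key
  linarith only [key]

/-- Otherwise, lower semicontinuity along the times that violate the bound would give `φ t (u t) ≤ φ
t (u t) - η`. -/
theorem EVICurve.eventually_energy_ge (hu : EVICurve φ D o B κ C (Icc 0 H) u)
    (h : LocalHyp φ D o B A κ H) {t : ℝ} (ht : t ∈ Icc 0 H) {η : ℝ} (hη : 0 < η) :
    ∀ᶠ r in 𝓝[Icc 0 H] t, φ t (u t) - η ≤ φ r (u r) := by
  by_contra hcon
  rw [not_eventually] at hcon
  have hne := frequently_iff_neBot.1 hcon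
  have h1 := h.le_of_tendsto (l := 𝓝[Icc 0 H] t ⊓ 𝓟 {r | ¬φ t (u t) - η ≤ φ r (u r)})
    (θ := id) (y := u) (c := fun _ => φ t (u t) - η) (t := t) (c₀ := φ t (u t) - η) (y₀ := u t)
    (Eventually.filter_mono inf_le_left self_mem_nhdsWithin)
    (tendsto_id.mono_left (inf_le_left.trans nhdsWithin_le_nhds))
    (Eventually.filter_mono inf_le_left (by
      filter_upwards [self_mem_nhdsWithin] with r hr using hu.mem r hr))
    ((hu.continuousOn t ht).mono_left inf_le_left)
    (Eventually.filter_mono inf_le_right (by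
      filter_upwards [mem_principal_self _] with r hr using (not_le.1 hr).le)) tendsto_const_nhds
  linarith [h1.2]

end Curve

theorem mul_integral_le_of_sq {m : ℝ → ℝ} {r x : ℝ} (hrx : r ≤ x)
    (hm : IntervalIntegrable m volume r x)
    (hm2 : IntervalIntegrable (fun t => m t ^ 2) volume r x) :
    m r * ∫ y in r..x, m y ≤ (x - r) * m r ^ 2 / 2 + (∫ y in r..x, m y ^ 2) / 2 := by
  have h1 : m r * ∫ y in r..x, m y = ∫ y in r..x, m r * m y := by
    rw [intervalIntegral.integral_const_mul]
  have h2 : (x - r) * m r ^ 2 / 2 + (∫ y in r..x, m y ^ 2) / 2 =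
      ∫ y in r..x, (m r ^ 2 / 2 + m y ^ 2 / 2) := by
    rw [intervalIntegral.integral_add intervalIntegrable_const (hm2.div_const 2),
      intervalIntegral.integral_const, intervalIntegral.integral_div, smul_eq_mul, mul_div_assoc]
  rw [h1, h2]
  refine intervalIntegral.integral_mono_on hrx (hm.const_mul _)
    (intervalIntegrable_const.add (hm2.div_const 2)) fun y _ => ?_
  nlinarith [sq_nonneg (m r - m y)]

theorem integral_sub_shift {f : ℝ → ℝ} {a b h H : ℝ} (hf : IntervalIntegrable f volume 0 H)
    (ha : 0 ≤ a) (hab : a ≤ b) (hh : 0 ≤ h) (hbH : b + h ≤ H) :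
    IntervalIntegrable (fun r => f (r + h)) volume a b ∧
    ∫ r in a..b, (f r - f (r + h)) = (∫ r in a..(a + h), f r) - ∫ r in b..(b + h), f r := by
  have hsub : ∀ x ∈ Icc 0 H, ∀ y ∈ Icc 0 H, IntervalIntegrable f volume x y := by
    intro x hx y hy
    refine hf.mono_set ?_
    rw [uIcc_of_le (hx.1.trans hx.2)]
    exact uIcc_subset_Icc hx hy
  have haI : a ∈ Icc 0 H := ⟨ha, by linarith⟩
  have hbI : b ∈ Icc 0 H := ⟨by linarith, by linarith⟩
  have hahI : a + h ∈ Icc 0 H := ⟨by linarith, by linarith⟩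
  have hbhI : b + h ∈ Icc 0 H := ⟨by linarith, by linarith⟩
  have h1 : IntervalIntegrable (fun r => f (r + h)) volume a b := by
    simpa using (hsub _ hahI _ hbhI).comp_add_right h
  refine ⟨h1, ?_⟩
  rw [intervalIntegral.integral_sub (hsub _ haI _ hbI) h1,
    intervalIntegral.integral_comp_add_right,
    intervalIntegral.integral_interval_sub_interval_comm (hsub _ haI _ hbI) (hsub _ hahI _ hbhI)
      (hsub _ haI _ hahI)]

/-- A one-sided absolute continuity estimate from an almost everywhere defined bound. -/
theorem sub_le_of_ae_sub_le {e N q ω : ℝ → ℝ} {a b H L : ℝ}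
    (he : IntervalIntegrable e volume 0 H) (hq : IntervalIntegrable q volume 0 H)
    (hN : MonotoneOn N (Icc 0 H)) (hNc : ContinuousOn N (Icc 0 H)) (hω : Continuous ω)
    (hL : 0 ≤ L) (hωm : Monotone ω)
    (hle : ∀ s ∈ Icc 0 H, ∀ t ∈ Icc 0 H, s ≤ t → e t ≤ e s + L * (ω t - ω s))
    (hlsc : ∀ t ∈ Icc 0 H, ∀ η > 0, ∀ᶠ r in 𝓝[Icc 0 H] t, e t - η ≤ e r)
    (hae : ∀ᵐ r, r ∈ Ioo 0 H → ∀ h, 0 ≤ h → r + h ≤ H →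
      e r - e (r + h) ≤ h * q r / 2 + (N (r + h) - N r))
    (ha : 0 ≤ a) (hab : a ≤ b) (hb : b < H) :
    e a - e b ≤ (∫ r in a..b, q r) / 2 + (N b - N a) := by
  rcases hab.eq_or_lt with rfl | hlt
  · simp
  have hNi : IntervalIntegrable N volume 0 H :=
    MonotoneOn.intervalIntegrable (by rwa [uIcc_of_le (by linarith)])
  have haI : a ∈ Icc 0 H := ⟨ha, by linarith⟩
  have hbI : b ∈ Icc 0 H := ⟨by linarith, hb.le⟩
  have hi : ∀ {f : ℝ → ℝ}, IntervalIntegrable f volume 0 H → ∀ x ∈ Icc 0 H, ∀ y ∈ Icc 0 H,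
      IntervalIntegrable f volume x y := by
    intro f hf x hx y hy
    refine hf.mono_set ?_
    rw [uIcc_of_le (hx.1.trans hx.2)]
    exact uIcc_subset_Icc hx hy
  refine le_of_forall_pos_le_add fun η hη => ?_
  -- Integrate the almost-everywhere bound over `[a, b]` with the shift `h` fixed. The left side
  -- telescopes to the integrals of `e` over `[a, a+h]` and `[b, b+h]`; lower semicontinuity handles
  -- the first and `hle` the second. Then divide by `h`.
  have hev : ∀ᶠ h in 𝓝[>] (0 : ℝ), e a - η - e b - L * (ω (b + h) - ω b) ≤
      (∫ r in a..b, q r) / 2 + (N (b + h) - N a) := by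
    obtain ⟨δ, hδ, hδ'⟩ := Metric.mem_nhdsWithin_iff.1 (hlsc a haI η hη)
    have hm : 0 < min δ (H - b) := lt_min hδ (by linarith)
    filter_upwards [Ioo_mem_nhdsGT hm] with h hh
    have hh0 := hh.1
    have hhδ := hh.2.trans_le (min_le_left _ _)
    have hhb : b + h ≤ H := by linarith [hh.2.trans_le (min_le_right δ (H - b))]
    obtain ⟨i1, i2⟩ := integral_sub_shift he ha hab hh0.le hhb
    obtain ⟨j1, j2⟩ := integral_sub_shift hNi ha hab hh0.le hhb
    have hahI : a + h ∈ Icc 0 H := ⟨by linarith, by linarith⟩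
    have hbhI : b + h ∈ Icc 0 H := ⟨by linarith, by linarith⟩
    have k1 : ∫ r in a..b, (e r - e (r + h)) ≤ ∫ r in a..b, (h * q r / 2 - (N r - N (r + h))) := by
      refine intervalIntegral.integral_mono_ae_restrict hab ((hi he _ haI _ hbI).sub i1)
        ((((hi hq _ haI _ hbI).const_mul h).div_const 2).sub ((hi hNi _ haI _ hbI).sub j1)) ?_
      rw [← restrict_Ioo_eq_restrict_Icc]
      refine (ae_restrict_iff' measurableSet_Ioo).2 ?_
      filter_upwards [hae] with r hr hrI
      have := hr ⟨ha.trans_lt hrI.1, hrI.2.trans hb⟩ h hh0.le (by linarith [hrI.2])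
      linarith
    rw [intervalIntegral.integral_sub (((hi hq _ haI _ hbI).const_mul h).div_const 2)
      ((hi hNi _ haI _ hbI).sub j1), i2, j2, intervalIntegral.integral_div,
      intervalIntegral.integral_const_mul] at k1
    have k2 : h * (e a - η) ≤ ∫ r in a..(a + h), e r := by
      have := intervalIntegral.integral_mono_on (by linarith)
        (intervalIntegrable_const (c := e a - η)) (hi he _ haI _ hahI) (fun r hr => by
          refine hδ' ⟨?_, ⟨by linarith [hr.1], by linarith [hr.2]⟩⟩
          rw [Metric.mem_ball, Real.dist_eq, abs_of_nonneg (by linarith [hr.1])]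
          linarith [hr.2])
      rw [intervalIntegral.integral_const, smul_eq_mul] at this
      simpa using this
    have k3 : ∫ r in b..(b + h), e r ≤ h * (e b + L * (ω (b + h) - ω b)) := by
      have := intervalIntegral.integral_mono_on (by linarith) (hi he _ hbI _ hbhI)
        (intervalIntegrable_const (c := e b + L * (ω (b + h) - ω b))) (fun r hr => by
          refine (hle b hbI r ⟨by linarith [hr.1, hbI.1], hr.2.trans hhb⟩ hr.1).trans ?_
          have := hωm hr.2
          gcongr)
      rw [intervalIntegral.integral_const, smul_eq_mul] at this
      simpa using this
    have k4 : h * N a ≤ ∫ r in a..(a + h), N r := by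
      have := intervalIntegral.integral_mono_on (by linarith)
        (intervalIntegrable_const (c := N a)) (hi hNi _ haI _ hahI) (fun r hr =>
          hN haI ⟨ha.trans hr.1, hr.2.trans hahI.2⟩ hr.1)
      rw [intervalIntegral.integral_const, smul_eq_mul] at this
      simpa using this
    have k5 : ∫ r in b..(b + h), N r ≤ h * N (b + h) := by
      have := intervalIntegral.integral_mono_on (by linarith) (hi hNi _ hbI _ hbhI)
        (intervalIntegrable_const (c := N (b + h))) (fun r hr =>
          hN ⟨hbI.1.trans hr.1, hr.2.trans hhb⟩ hbhI hr.2)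
      rw [intervalIntegral.integral_const, smul_eq_mul] at this
      simpa using this
    refine le_of_mul_le_mul_left ?_ hh0
    linarith
  have hbh : Tendsto (fun h : ℝ => b + h) (𝓝[>] 0) (𝓝 b) := by
    have : Tendsto (fun h : ℝ => b + h) (𝓝 0) (𝓝 (b + 0)) := by
      apply Continuous.tendsto; fun_prop
    rw [add_zero] at this
    exact this.mono_left nhdsWithin_le_nhds
  have hNb : ContinuousAt N b := hNc.continuousAt (Icc_mem_nhds (by linarith) hb)
  have l1 := (((hω.tendsto b).comp hbh).sub_const (ω b)).const_mul L |>.const_sub (e a - η - e b)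
  have l2 := ((hNb.tendsto.comp hbh).sub_const (N a)).const_add ((∫ r in a..b, q r) / 2)
  have := le_of_tendsto_of_tendsto l1 l2 hev
  simp only [sub_self, mul_zero, sub_zero] at this
  linarith

theorem absolutelyContinuousOnInterval_id (a b : ℝ) :
    AbsolutelyContinuousOnInterval (fun x : ℝ => x) a b :=
  (LipschitzWith.id.lipschitzOnWith (s := uIcc a b)).absolutelyContinuousOnInterval

section Energy

/-- Use `slope_bound` at `r` with `v = u (r + k)`, bound the distance by the integral of the metric
derivative, and apply Young's inequality. In `N`, the term with `κ * C` comes from the Hölder bound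
and the term with `B` from the change of time. -/
theorem EVICurve.energy_sub_le [TopologicalSpace.SeparableSpace X]
    (hu : EVICurve φ D o B κ C (Icc 0 H) u) (h : LocalHyp φ D o B A κ H) (hC : 0 ≤ C) {N : ℝ → ℝ}
    (hN : N = fun x => (∫ r in (0 : ℝ)..x, metricDeriv u r ^ 2) / 2 + κ * C * x + (1 + C) * B x) :
    ∀ᵐ r, r ∈ Ioo 0 H → ∀ k, 0 ≤ k → r + k ≤ H →
      φ r (u r) - φ (r + k) (u (r + k)) ≤ k * metricDeriv u r ^ 2 / 2 + (N (r + k) - N r) := by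
  obtain ⟨hm1, hm2, hm3, hm4⟩ := hu.metricDeriv_spec h hC
  have hκ := h.kappa_nonneg
  filter_upwards [hm4] with r hr hrI k hk hrk
  obtain ⟨hm0, hmt⟩ := hr hrI
  have hrI' := Ioo_subset_Icc_self hrI
  have hkI : r + k ∈ Icc 0 H := ⟨by linarith [hrI.1], hrk⟩
  have h0I : (0 : ℝ) ∈ Icc 0 H := left_mem_Icc.2 h.horizon_pos.le
  have hle : r ≤ r + k := by linarith
  have hi : ∀ {f : ℝ → ℝ}, IntervalIntegrable f volume 0 H → ∀ x ∈ Icc 0 H, ∀ y ∈ Icc 0 H,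
      IntervalIntegrable f volume x y := by
    intro f hf x hx y hy
    refine hf.mono_set ?_
    rw [uIcc_of_le (hx.1.trans hx.2)]
    exact uIcc_subset_Icc hx hy
  have h1 := hu.slope_bound h hrI hmt (hu.mem _ hkI)
  have h2 := hm3 r hrI' _ hkI hle
  have h3 := mul_integral_le_of_sq hle (hi hm1 _ hrI' _ hkI) (hi hm2 _ hrI' _ hkI)
  have h4 := mul_le_mul_of_nonneg_left h2 hm0
  have h5 := hu.holder r hrI' _ hkI hle
  have h6 := (abs_le.1 (h.time _ (hu.mem _ hkI) r (r + k) hrI.1.le hle hrk)).1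
  have h7 := hu.dist_sq_le _ hkI
  have h8 : (B (r + k) - B r) * (1 + dist (u (r + k)) o ^ 2) ≤ (B (r + k) - B r) * (1 + C) := by
    have := sub_nonneg.2 (h.mono hle)
    gcongr
  have h9 : κ * dist (u r) (u (r + k)) ^ 2 ≤ κ * (C * (r + k - r)) := by
    rw [dist_comm]; gcongr
  have h10 := intervalIntegral.integral_interval_sub_left (hi hm2 _ h0I _ hkI) (hi hm2 _ h0I _ hrI')
  rw [hN]
  simp only
  rw [← h10, show r + k - r = k by ring] at h3
  rw [show r + k - r = k by ring] at h9
  linarith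

/-- The energy is absolutely continuous along solutions. -/
theorem EVICurve.absolutelyContinuous_energy [TopologicalSpace.SeparableSpace X]
    (hu : EVICurve φ D o B κ C (Icc 0 H) u) (h : LocalHyp φ D o B A κ H) (hC : 0 ≤ C) {T : ℝ}
    (hT : 0 ≤ T) (hTH : T < H) : AbsolutelyContinuousOnInterval (fun t => φ t (u t)) 0 T := by
  obtain ⟨hm1, hm2, -, -⟩ := hu.metricDeriv_spec h hC
  have hκ := h.kappa_nonneg
  have hH := h.horizon_pos.le
  have hi : ∀ x ∈ Icc 0 H, ∀ y ∈ Icc 0 H,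
      IntervalIntegrable (fun t => metricDeriv u t ^ 2) volume x y := by
    intro x hx y hy
    refine hm2.mono_set ?_
    rw [uIcc_of_le hH]
    exact uIcc_subset_Icc hx hy
  have h0I : (0 : ℝ) ∈ Icc 0 H := left_mem_Icc.2 hH
  set M : ℝ → ℝ := fun x => ∫ r in (0 : ℝ)..x, metricDeriv u r ^ 2 with hM
  set N : ℝ → ℝ := fun x => M x / 2 + κ * C * x + (1 + C) * B x with hN
  have hMsub : ∀ s ∈ Icc 0 H, ∀ t ∈ Icc 0 H, M t - M s = ∫ r in s..t, metricDeriv u r ^ 2 :=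
    fun s hs t ht => intervalIntegral.integral_interval_sub_left (hi _ h0I _ ht) (hi _ h0I _ hs)
  have hMm : MonotoneOn M (Icc 0 H) := fun s hs t ht hst => by
    rw [← sub_nonneg, hMsub s hs t ht]
    exact intervalIntegral.integral_nonneg hst fun _ _ => sq_nonneg _
  have hMAC : AbsolutelyContinuousOnInterval M 0 H :=
    hm2.absolutelyContinuousOnInterval_intervalIntegral (by simp)
  have hNm : MonotoneOn N (Icc 0 H) := fun s hs t ht hst => by
    have h1 := hMm hs ht hst
    have h2 := h.mono hst
    simp only [hN]
    gcongr
  have hNAC : AbsolutelyContinuousOnInterval N 0 H := by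
    have h1 := ((hMAC.const_mul (1 / 2)).fun_add
      ((absolutelyContinuousOnInterval_id 0 H).const_mul (κ * C))).fun_add
      (h.absCont.const_mul (1 + C))
    convert! h1 using 2 with x
    simp only [hN]; ring
  have hωAC : AbsolutelyContinuousOnInterval (modulus B) 0 H :=
    h.absCont.fun_add (absolutelyContinuousOnInterval_id 0 H)
  set L := energyRate κ C with hL
  have hL0 : 0 ≤ L := energyRate_nonneg hκ hC
  have hle : ∀ s ∈ Icc 0 H, ∀ t ∈ Icc 0 H, s ≤ t →
      φ t (u t) ≤ φ s (u s) + L * (modulus B t - modulus B s) := fun s hs t ht hst =>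
    hu.energy_le h subset_rfl hC hs ht hst
  have key : ∀ a b, 0 ≤ a → a ≤ b → b < H → φ a (u a) - φ b (u b) ≤
      (M b - M a) / 2 + (N b - N a) := by
    intro a b ha hab hb
    rw [hMsub a ⟨ha, by linarith⟩ b ⟨by linarith, hb.le⟩]
    exact sub_le_of_ae_sub_le (hu.intervalIntegrable_energy h hC) hm2 hNm
      (by rw [← uIcc_of_le hH]; exact hNAC.continuousOn) h.modulus_continuous hL0 h.modulus_mono
      hle (fun t ht η hη => hu.eventually_energy_ge h ht hη) (hu.energy_sub_le h hC rfl) ha hab hb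
  -- `key` controls decreases of the energy and `hle` its increases; both are dominated by
  -- increments of this one function.
  have hF : AbsolutelyContinuousOnInterval
      (fun x => (1 / 2 * M x + N x) + L * modulus B x) 0 T :=
    (((hMAC.const_mul (1 / 2)).fun_add hNAC).fun_add (hωAC.const_mul L)).mono (by
      rw [uIcc_of_le hT, uIcc_of_le hH]; exact Icc_subset_Icc_right hTH.le)
  have hdist : ∀ a b, 0 ≤ a → a ≤ b → b ≤ T → |φ a (u a) - φ b (u b)| ≤
      |((1 / 2 * M a + N a) + L * modulus B a) - ((1 / 2 * M b + N b) + L * modulus B b)| := by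
    intro a b ha hab hb
    have haI : a ∈ Icc 0 H := ⟨ha, by linarith⟩
    have hbI : b ∈ Icc 0 H := ⟨by linarith, by linarith⟩
    have h1 := key a b ha hab (by linarith)
    have h2 := hle a haI b hbI hab
    have h3 := hMm haI hbI hab
    have h4 := hNm haI hbI hab
    have h5 := mul_le_mul_of_nonneg_left (h.modulus_mono hab) hL0
    refine le_trans ?_ (neg_le_abs _)
    rw [abs_le]
    constructor <;> linarith
  refine absolutelyContinuousOnInterval_of_dist_le hF fun s hs t ht => ?_
  rw [uIcc_of_le hT] at hs ht
  rw [Real.dist_eq, Real.dist_eq]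
  rcases le_total s t with hst | hst
  · exact hdist s t hs.1 hst ht.2
  · rw [abs_sub_comm, abs_sub_comm ((1 / 2 * M s + N s) + L * modulus B s)]
    exact hdist t s ht.1 hst hs.2

end Energy

end TimeGradFlow

/-! ### The two energy-dissipation inequalities -/

namespace TimeGradFlow

variable {X : Type*} [MetricSpace X]

section EnergyIdentity

variable {φ : ℝ → X → ℝ} {D : Set X} {o : X} {B : ℝ → ℝ} {A κ H C : ℝ} {u : ℝ → X}

theorem EVICurve.deriv_dist_sq_le (hu : EVICurve φ D o B κ C (Icc 0 H) u)
    (h : LocalHyp φ D o B A κ H) {r : ℝ} (hr : r ∈ Ioo 0 H) {v : X} (hv : v ∈ D)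
    (hd : DifferentiableAt ℝ (fun t => dist (u t) v ^ 2) r) :
    deriv (fun t => dist (u t) v ^ 2) r ≤
      2 * (φ r v - φ r (u r)) + 2 * κ * dist (u r) v ^ 2 := by
  have l1 := (hasDerivAt_iff_tendsto_slope.1 hd.hasDerivAt).mono_left
    (nhdsWithin_mono r (fun x (hx : x ∈ Iio r) => ne_of_lt hx))
  have l2 : Tendsto (fun s => 2 * (φ r v - φ r (u r)) + 2 * κ * dist (u r) v ^ 2 +
      C * (1 + dist v o ^ 2) * (modulus B r - modulus B s)) (𝓝[<] r)
      (𝓝 (2 * (φ r v - φ r (u r)) + 2 * κ * dist (u r) v ^ 2 +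
        C * (1 + dist v o ^ 2) * (modulus B r - modulus B r))) :=
    ((((h.modulus_continuous.tendsto r).mono_left nhdsWithin_le_nhds).const_sub _).const_mul
      _).const_add _
  rw [sub_self, mul_zero, add_zero] at l2
  refine le_of_tendsto_of_tendsto l1 l2 ?_
  filter_upwards [Ioo_mem_nhdsLT hr.1] with s hs
  have h1 := hu.evi v hv s ⟨hs.1.le, hs.2.le.trans hr.2.le⟩ r (Ioo_subset_Icc_self hr) hs.2.le
  have hrs : 0 < r - s := sub_pos.2 hs.2
  rw [slope_def_field, ← neg_sub, ← neg_sub r s, neg_div_neg_eq, div_le_iff₀ hrs, mul_comm]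
  exact h1

theorem integral_le_of_le_mul_sub {J : ℝ → ℝ} {t k c : ℝ} (hk : 0 ≤ k)
    (hJ : IntervalIntegrable J volume t (t + k))
    (h : ∀ r ∈ Icc t (t + k), J r ≤ c * (r - t)) :
    ∫ r in t..(t + k), J r ≤ c * (k ^ 2 / 2) := by
  have h1 := intervalIntegral.integral_mono_on (by linarith) hJ
    (Continuous.intervalIntegrable (by fun_prop) t (t + k)) h
  refine h1.trans_eq ?_
  rw [intervalIntegral.integral_const_mul, intervalIntegral.integral_sub (by simp) (by simp),
    integral_id, intervalIntegral.integral_const, smul_eq_mul]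
  ring

/-- The upper energy-dissipation inequality. -/
theorem EVICurve.sq_metricDeriv_le (hu : EVICurve φ D o B κ C (Icc 0 H) u)
    (h : LocalHyp φ D o B A κ H) (hC : 0 ≤ C) {T : ℝ} (hT : 0 ≤ T) (hTH : T < H)
    (he : AbsolutelyContinuousOnInterval (fun t => φ t (u t)) 0 T) {t m e' p : ℝ}
    (ht : t ∈ Ioo 0 T) (hm : Tendsto (fun s => dist (u s) (u t) / |s - t|) (𝓝[≠] t) (𝓝 m))
    (he' : HasDerivAt (fun s => φ s (u s)) e' t) (hp : HasDerivAt (fun s => φ s (u t)) p t) :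
    m ^ 2 ≤ p - e' := by
  have hTH' : Icc 0 T ⊆ Icc 0 H := Icc_subset_Icc_right hTH.le
  have htI := Ioo_subset_Icc_self ht
  have hv : u t ∈ D := hu.mem t (hTH' htI)
  set ζ : ℝ → ℝ := fun r => dist (u r) (u t) ^ 2 with hζ
  have hζAC : AbsolutelyContinuousOnInterval ζ 0 T := by
    have h1 : AbsolutelyContinuousOnInterval (fun r => dist (u r) (u t)) 0 H :=
      absolutelyContinuousOnInterval_of_dist_le (hu.absolutelyContinuous h hC) fun r _ s _ => by
        rw [Real.dist_eq]
        exact abs_dist_sub_le _ _ _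
    have h2 : AbsolutelyContinuousOnInterval (fun r => dist (u r) (u t)) 0 T := h1.mono (by
      rw [uIcc_of_le hT, uIcc_of_le h.horizon_pos.le]; exact hTH')
    convert! h2.fun_mul h2 using 2 with r
    simp only [hζ]; ring
  -- `J` dominates the derivative of `ζ`, vanishes at `t` and has derivative `2 * (p - e')` there.
  -- Integrating its linear bound produces `(s - t)² / 2`, hence the sharp constant.
  set J : ℝ → ℝ := fun r => 2 * (φ r (u t) - φ r (u r)) + 2 * κ * ζ r with hJ
  have hJc : ContinuousOn J (Icc 0 T) := by
    have h1 := (h.continuousOn_left hv).mono hTH'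
    have h2 := he.continuousOn
    have h3 := hζAC.continuousOn
    rw [uIcc_of_le hT] at h2 h3
    exact ((h1.sub h2).const_mul 2).add (h3.const_mul (2 * κ))
  have hζd : HasDerivAt ζ 0 t := by
    rw [hasDerivAt_iff_tendsto_slope]
    have l1 : Tendsto (fun s => (dist (u s) (u t) / |s - t|) ^ 2 * (s - t)) (𝓝[≠] t)
        (𝓝 (m ^ 2 * (t - t))) := by
      refine (hm.pow 2).mul ?_
      exact ((continuous_id.sub continuous_const).tendsto t).mono_left nhdsWithin_le_nhds
    rw [sub_self, mul_zero] at l1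
    refine l1.congr' ?_
    filter_upwards [self_mem_nhdsWithin] with s hs
    have : s - t ≠ 0 := sub_ne_zero.2 hs
    rw [slope_def_field, div_pow, sq_abs]
    simp only [hζ, dist_self]
    field_simp
    ring
  have hJd : HasDerivAt J (2 * (p - e') + 2 * κ * 0) t :=
    ((hp.sub he').const_mul 2).add (hζd.const_mul (2 * κ))
  rw [mul_zero, add_zero] at hJd
  have hJt : J t = 0 := by simp [hJ, hζ]
  have key : ∀ η > 0, m ^ 2 ≤ (2 * (p - e') + η) / 2 := by
    intro η hη
    have l1 := (hasDerivAt_iff_tendsto_slope.1 hJd).mono_left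
      (nhdsWithin_mono t (fun x (hx : x ∈ Ioi t) => ne_of_gt hx))
    have hev := l1.eventually_lt_const (show 2 * (p - e') < 2 * (p - e') + η by linarith)
    obtain ⟨b, hb, hb'⟩ := mem_nhdsGT_iff_exists_Ioo_subset.1 hev
    have hm' := (hm.mono_left (nhdsWithin_mono t (fun x (hx : x ∈ Ioi t) => ne_of_gt hx))).pow 2
    refine le_of_tendsto hm' ?_
    filter_upwards [Ioo_mem_nhdsGT (show t < min b T from lt_min hb ht.2)] with s hs
    have hsb := hs.2.trans_le (min_le_left _ _)
    have hsT := hs.2.trans_le (min_le_right _ _)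
    have hst : 0 < s - t := sub_pos.2 hs.1
    have hsub : uIcc t s ⊆ uIcc 0 T := by
      rw [uIcc_of_le hT]
      exact uIcc_subset_Icc htI ⟨ht.1.le.trans hs.1.le, hsT.le⟩
    have hAC := hζAC.mono hsub
    have hJi : IntervalIntegrable J volume t s :=
      (hJc.mono (by rwa [uIcc_of_le hT] at hsub)).intervalIntegrable
    -- The finite-difference inequality carries an error `(s - t)(ω(s) - ω(t))`, too large after
    -- division by `(s - t)²`. Its pointwise form has no such error, so that form is integrated
    -- instead.
    have h1 : ζ s ≤ ∫ r in t..s, J r := by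
      have e1 : ζ s = ∫ r in t..s, deriv ζ r := by
        rw [hAC.integral_deriv_eq_sub]; simp [hζ]
      rw [e1]
      refine intervalIntegral.integral_mono_ae_restrict hs.1.le hAC.intervalIntegrable_deriv hJi ?_
      refine (ae_restrict_iff' measurableSet_Icc).2 ?_
      filter_upwards [hAC.ae_differentiableAt] with r hr hrI
      have hrH : r ∈ Ioo 0 H := ⟨ht.1.trans_le hrI.1, (hrI.2.trans hsT.le).trans_lt hTH⟩
      exact hu.deriv_dist_sq_le h hrH hv (hr (by rwa [uIcc_of_le hs.1.le]))
    have h2 := integral_le_of_le_mul_sub (J := J) (t := t) (k := s - t)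
      (c := 2 * (p - e') + η) hst.le (by rwa [add_sub_cancel]) (fun r hr => by
        rw [add_sub_cancel] at hr
        rcases hr.1.eq_or_lt with rfl | hlt
        · rw [hJt]; simp
        · have h3 : slope J t r < 2 * (p - e') + η := hb' ⟨hlt, hr.2.trans_lt hsb⟩
          rw [slope_def_field, hJt, sub_zero, div_lt_iff₀ (sub_pos.2 hlt)] at h3
          exact h3.le)
    rw [add_sub_cancel] at h2
    rw [abs_of_pos hst, div_pow, div_le_iff₀ (by positivity)]
    simp only [hζ] at h1
    linarith
  refine le_of_forall_pos_le_add fun η hη => ?_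
  have := key (2 * η) (by positivity)
  linarith

/-- The lower energy-dissipation inequality. -/
theorem sub_mul_le_of_liminf {t m e' p G : ℝ} (ht : 0 ≤ t) (hmem : ∀ s, 0 ≤ s → u s ∈ D)
    (hm : Tendsto (fun s => dist (u s) (u t) / |s - t|) (𝓝[≠] t) (𝓝 m))
    (hc : ContinuousAt u t)
    (he' : HasDerivAt (fun s => φ s (u s)) e' t)
    (hslope : ∀ η > 0, ∀ᶠ v in 𝓝 (u t), v ∈ D → φ t (u t) - φ t v ≤ (G + η) * dist v (u t))
    (hlim : ∀ (tn : ℕ → ℝ) (un : ℕ → X), Antitone tn → (∀ n, t < tn n) → Tendsto tn atTop (𝓝 t) →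
      (∀ n, un n ∈ D) → Tendsto un atTop (𝓝 (u t)) → ((p : ℝ) : EReal) ≤
        liminf (fun n => (((φ (tn n) (un n) - φ t (un n)) / (tn n - t) : ℝ) : EReal)) atTop) :
    p - G * m ≤ e' := by
  set tn : ℕ → ℝ := fun n => t + 1 / (n + 1 : ℝ) with htn
  have hpos : ∀ n, t < tn n := fun n => by
    have := Nat.one_div_pos_of_nat (α := ℝ) (n := n)
    simp only [htn]; linarith
  have htt : Tendsto tn atTop (𝓝 t) := by
    have := (tendsto_one_div_add_atTop_nhds_zero_nat (𝕜 := ℝ)).const_add t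
    rwa [add_zero] at this
  have hanti : Antitone tn := fun i j hij => by
    have := Nat.one_div_le_one_div (α := ℝ) hij
    simp only [htn]; linarith
  have htn' : Tendsto tn atTop (𝓝[≠] t) :=
    tendsto_nhdsWithin_iff.2 ⟨htt, Eventually.of_forall fun n => (hpos n).ne'⟩
  have hut : Tendsto (fun n => u (tn n)) atTop (𝓝 (u t)) := hc.tendsto.comp htt
  have hmemn : ∀ n, u (tn n) ∈ D := fun n => hmem _ (ht.trans (hpos n).le)
  have h1 := hlim tn (fun n => u (tn n)) hanti hpos htt hmemn hut
  have key : ∀ η > 0, p ≤ e' + (G + η) * m := by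
    intro η hη
    have l1 := (hasDerivAt_iff_tendsto_slope.1 he').comp htn'
    have l2 := (hm.comp htn').const_mul (G + η)
    have l3 := (continuous_coe_real_ereal.tendsto _).comp (l1.add l2)
    rw [← EReal.coe_le_coe_iff]
    refine h1.trans ?_
    rw [← l3.liminf_eq]
    -- Split the energy increment into a change of time at the fixed point `u (tn n)` and a change
    -- of point at the fixed time `t`; the slope bounds the second part below.
    refine liminf_le_liminf ?_
    filter_upwards [hut.eventually (hslope η hη)] with n hn
    have h2 := hn (hmemn n)
    have h3 : 0 < tn n - t := sub_pos.2 (hpos n)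
    simp only [Function.comp_apply]
    rw [EReal.coe_le_coe_iff, slope_def_field, abs_of_pos h3, ← mul_div_assoc, ← add_div]
    gcongr
    linarith
  have l : Tendsto (fun η : ℝ => e' + (G + η) * m) (𝓝[>] 0) (𝓝 (e' + (G + 0) * m)) := by
    refine Tendsto.mono_left (Continuous.tendsto ?_ 0) nhdsWithin_le_nhds
    fun_prop
  have := ge_of_tendsto l (by filter_upwards [self_mem_nhdsWithin] with η hη using key η hη)
  linarith

end EnergyIdentity

/-! ### The local slope in terms of real energies -/

section Slope

variable {E : ℝ → X → EReal}

theorem energy_sub_toENNReal (h1 : HypE1 E) (h2 : HypE2 E) {t : ℝ} (ht : 0 ≤ t) {u v : X}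
    (hu : u ∈ dom E) (hv : v ∈ dom E) :
    (E t u - E t v).toENNReal = ENNReal.ofReal (realEnergy E t u - realEnergy E t v) := by
  rw [← coe_realEnergy h1 h2 ht hu, ← coe_realEnergy h1 h2 ht hv, ← EReal.coe_sub,
    EReal.toENNReal_of_ne_top (EReal.coe_ne_top _), EReal.toReal_coe]

theorem localSlope_eq_limsup (h2 : HypE2 E) {t : ℝ} (ht : 0 ≤ t) {u : X} (hu : u ∈ dom E) :
    localSlope (E t) u = limsup (fun v => (E t u - E t v).toENNReal / edist u v) (𝓝[≠] u) :=
  if_neg ((mem_dom_iff h2 ht).1 hu).ne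

theorem localSlope_le (h1 : HypE1 E) (h2 : HypE2 E) {t m κ : ℝ} (ht : 0 ≤ t) {u : X}
    (hu : u ∈ dom E) (hm : 0 ≤ m) (hκ : 0 ≤ κ)
    (h : ∀ v ∈ dom E, realEnergy E t u - realEnergy E t v ≤ m * dist u v + κ * dist u v ^ 2) :
    localSlope (E t) u ≤ ENNReal.ofReal m := by
  rw [localSlope_eq_limsup h2 ht hu]
  -- At an isolated point the punctured filter is trivial and the slope is `0`.
  rcases (𝓝[≠] u).eq_or_neBot with hbot | hne
  · rw [hbot, limsup_bot]
    exact bot_le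
  have l : Tendsto (fun v => ENNReal.ofReal (m + κ * dist u v)) (𝓝[≠] u)
      (𝓝 (ENNReal.ofReal (m + κ * dist u u))) := by
    refine Tendsto.mono_left (Continuous.tendsto ?_ u) nhdsWithin_le_nhds
    exact ENNReal.continuous_ofReal.comp (by fun_prop)
  rw [dist_self, mul_zero, add_zero] at l
  rw [← l.limsup_eq]
  refine limsup_le_limsup (Eventually.of_forall fun v => ?_)
  beta_reduce
  by_cases hv : v ∈ dom E
  · refine ENNReal.div_le_of_le_mul ?_
    rw [energy_sub_toENNReal h1 h2 ht hu hv, edist_dist, ← ENNReal.ofReal_mul (by positivity)]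
    refine ENNReal.ofReal_le_ofReal ((h v hv).trans_eq ?_)
    ring
  · have hv' : E t v = ⊤ := by
      by_contra hc
      exact hv ((mem_dom_iff h2 ht).2 (lt_top_iff_ne_top.2 hc))
    have h3 : E t u - E t v = ⊥ := by rw [hv', EReal.sub_top]
    rw [h3, EReal.toENNReal_bot, ENNReal.zero_div]
    exact zero_le

theorem eventually_sub_le_of_localSlope (h1 : HypE1 E) (h2 : HypE2 E) {t : ℝ} (ht : 0 ≤ t) {u : X}
    (hu : u ∈ dom E) (hs : localSlope (E t) u ≠ ⊤) {η : ℝ} (hη : 0 < η) :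
    ∀ᶠ v in 𝓝 u, v ∈ dom E → realEnergy E t u - realEnergy E t v ≤
      ((localSlope (E t) u).toReal + η) * dist v u := by
  set G := (localSlope (E t) u).toReal with hG
  have hlt : localSlope (E t) u < ENNReal.ofReal (G + η) := by
    rw [← ENNReal.ofReal_toReal hs, ← hG]
    exact (ENNReal.ofReal_lt_ofReal_iff (by positivity)).2 (by linarith)
  rw [localSlope_eq_limsup h2 ht hu] at hlt
  have hev := eventually_nhdsWithin_iff.1 (eventually_lt_of_limsup_lt hlt)
  filter_upwards [hev] with v hv hvD
  by_cases hvu : v = u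
  · subst hvu
    simp
  have h3 := (hv hvu).le
  rw [energy_sub_toENNReal h1 h2 ht hu hvD,
    ENNReal.div_le_iff (edist_pos.2 (Ne.symm hvu)).ne' (edist_ne_top _ _), edist_dist,
    ← ENNReal.ofReal_mul (by positivity), ENNReal.ofReal_le_ofReal_iff (by positivity),
    dist_comm] at h3
  exact h3

end Slope

end TimeGradFlow

/-! ### Global solutions and the energy identity -/

namespace TimeGradFlow

variable {X : Type*} [MetricSpace X]

theorem EVICurve.congr {φ : ℝ → X → ℝ} {D : Set X} {o : X} {B : ℝ → ℝ} {κ C : ℝ} {S : Set ℝ}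
    {w w' : ℝ → X} (hw : EVICurve φ D o B κ C S w) (h : EqOn w w' S) :
    EVICurve φ D o B κ C S w' := by
  refine ⟨fun t ht => ?_, fun t ht => ?_, fun t ht => ?_, fun s hs t ht hst => ?_,
    fun v hv s hs t ht hst => ?_⟩
  · rw [← h ht]; exact hw.mem t ht
  · rw [← h ht]; exact hw.dist_sq_le t ht
  · rw [← h ht]; exact hw.abs_energy_le t ht
  · rw [← h ht, ← h hs]; exact hw.holder s hs t ht hst
  · rw [← h ht, ← h hs]; exact hw.evi v hv s hs t ht hst

section Global

variable {E : ℝ → X → EReal} {u : ℝ → X} {o : X} {B : ℝ → ℝ}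

/-- `u` solves the evolution variational inequality on every bounded time interval. -/
def IsEVISolution (E : ℝ → X → EReal) (o : X) (B : ℝ → ℝ) (u : ℝ → X) : Prop :=
  ∀ T : ℕ, 0 < T → ∃ A κ C, 0 ≤ C ∧ LocalHyp (realEnergy E) (dom E) o B A κ T ∧
    EVICurve (realEnergy E) (dom E) o B κ C (Icc 0 (T : ℝ)) u

theorem ae_Ioi_of_forall_nat {p : ℝ → Prop}
    (h : ∀ T : ℕ, ∀ᵐ t, t ∈ Ioo 0 (T : ℝ) → p t) : ∀ᵐ t ∂(volume.restrict (Ioi (0 : ℝ))), p t := by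
  rw [ae_restrict_iff' measurableSet_Ioi]
  filter_upwards [ae_all_iff.2 h] with t ht ht0
  obtain ⟨T, hT⟩ := exists_nat_gt t
  exact ht T ⟨ht0, hT⟩

theorem IsEVISolution.mem (hu : IsEVISolution E o B u) {t : ℝ} (ht : 0 ≤ t) : u t ∈ dom E := by
  obtain ⟨T, hT⟩ := exists_nat_gt t
  obtain ⟨A, κ, C, hC, h, hc⟩ := hu T (by exact_mod_cast ht.trans_lt hT)
  exact hc.mem t ⟨ht, hT.le⟩

theorem IsEVISolution.locAbsCont (hu : IsEVISolution E o B u) : LocAbsCont u := by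
  intro T hT
  obtain ⟨N, hN⟩ := exists_nat_gt T
  obtain ⟨A, κ, C, hC, h, hc⟩ := hu N (by exact_mod_cast hT.trans hN)
  refine (hc.absolutelyContinuous h hC).mono ?_
  rw [uIcc_of_le hT.le, uIcc_of_le (hT.trans hN).le]
  exact Icc_subset_Icc_right hN.le

variable [TopologicalSpace.SeparableSpace X]

theorem IsEVISolution.ae_metricDeriv (hu : IsEVISolution E o B u) :
    ∀ᵐ t ∂(volume.restrict (Ioi (0 : ℝ))),
      Tendsto (fun s => dist (u s) (u t) / |s - t|) (𝓝[≠] t) (𝓝 (metricDeriv u t)) := by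
  refine ae_Ioi_of_forall_nat fun T => ?_
  rcases Nat.eq_zero_or_pos T with rfl | hT
  · simp
  obtain ⟨A, κ, C, hC, h, hc⟩ := hu T hT
  filter_upwards [(hc.metricDeriv_spec h hC).2.2.2] with t h1 h2 using (h1 h2).2

theorem IsEVISolution.intervalIntegrable_metricDeriv (hu : IsEVISolution E o B u) {T : ℝ}
    (hT : 0 ≤ T) : IntervalIntegrable (metricDeriv u) volume 0 T ∧
      IntervalIntegrable (fun t => metricDeriv u t ^ 2) volume 0 T := by
  obtain ⟨N, hN⟩ := exists_nat_gt T
  obtain ⟨A, κ, C, hC, h, hc⟩ := hu N (by exact_mod_cast hT.trans_lt hN)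
  obtain ⟨h1, h2, -, -⟩ := hc.metricDeriv_spec h hC
  have hsub : uIcc 0 T ⊆ uIcc 0 (N : ℝ) := by
    rw [uIcc_of_le hT, uIcc_of_le (hT.trans_lt hN).le]
    exact Icc_subset_Icc_right hN.le
  exact ⟨h1.mono_set hsub, h2.mono_set hsub⟩

theorem IsEVISolution.memLp_metricDeriv (hu : IsEVISolution E o B u) {T : ℝ} (hT : 0 < T) :
    MemLp (metricDeriv u) 2 (volume.restrict (Icc 0 T)) := by
  obtain ⟨h1, h2⟩ := hu.intervalIntegrable_metricDeriv hT.le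
  rw [intervalIntegrable_iff_integrableOn_Icc_of_le hT.le] at h1 h2
  exact (memLp_two_iff_integrable_sq h1.aestronglyMeasurable).2 h2

theorem IsEVISolution.energy_absolutelyContinuous (hu : IsEVISolution E o B u) {T : ℝ}
    (hT : 0 ≤ T) : AbsolutelyContinuousOnInterval (fun t => (E t (u t)).toReal) 0 T := by
  obtain ⟨N, hN⟩ := exists_nat_gt T
  obtain ⟨A, κ, C, hC, h, hc⟩ := hu N (by exact_mod_cast hT.trans_lt hN)
  exact hc.absolutelyContinuous_energy h hC hT hN

/-- The slope equals the metric derivative, and the derivative of the energy is given by the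
energy-dissipation equality. -/
theorem IsEVISolution.ae_energy_identity (hu : IsEVISolution E o B u) (h1 : HypE1 E)
    (h2 : HypE2 E) (hreg : TimeRegular E) (T : ℕ) : ∀ᵐ t, t ∈ Ioo 0 (T : ℝ) →
      0 ≤ metricDeriv u t ∧ localSlope (E t) (u t) = ENNReal.ofReal (metricDeriv u t) ∧
      HasDerivAt (fun s => (E s (u s)).toReal)
        (timeDeriv E t (u t) - metricDeriv u t ^ 2) t := by
  -- The upper dissipation inequality needs a horizon strictly beyond `T`.
  obtain ⟨A, κ, C, hC, h, hc⟩ := hu (T + 1) T.succ_pos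
  have hT : (0 : ℝ) ≤ T := T.cast_nonneg
  have hTH : (T : ℝ) < (T + 1 : ℕ) := by push_cast; linarith
  have hAC := hu.energy_absolutelyContinuous hT
  filter_upwards [(hc.metricDeriv_spec h hC).2.2.2, hAC.ae_differentiableAt] with t ht1 ht2 ht
  have htH : t ∈ Ioo 0 ((T + 1 : ℕ) : ℝ) := ⟨ht.1, ht.2.trans hTH⟩
  obtain ⟨hm0, hm⟩ := ht1 htH
  have hut := hu.mem ht.1.le
  have hd : HasDerivAt (fun s => (E s (u s)).toReal) _ t :=
    (ht2 (by rw [uIcc_of_le hT]; exact Ioo_subset_Icc_self ht)).hasDerivAt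
  set e' := deriv (fun s => (E s (u s)).toReal) t with he'
  set m := metricDeriv u t with hm_def
  set p := timeDeriv E t (u t) with hp_def
  have hp : HasDerivAt (fun s => (E s (u t)).toReal) p t :=
    (hreg.differentiable _ hut t ht.1.le).hasDerivWithinAt.hasDerivAt (Ici_mem_nhds ht.1)
  have hupper : m ^ 2 ≤ p - e' := hc.sq_metricDeriv_le h hC hT hTH hAC ht hm hd hp
  have hslope : localSlope (E t) (u t) ≤ ENNReal.ofReal m :=
    localSlope_le h1 h2 ht.1.le hut hm0 h.kappa_nonneg fun v hv => hc.slope_bound h htH hm hv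
  have hfin : localSlope (E t) (u t) ≠ ⊤ := (hslope.trans_lt ENNReal.ofReal_lt_top).ne
  set G := (localSlope (E t) (u t)).toReal with hG
  have hG0 : 0 ≤ G := ENNReal.toReal_nonneg
  have hGm : G ≤ m := ENNReal.toReal_le_of_le_ofReal hm0 hslope
  have hlower : p - G * m ≤ e' :=
    sub_mul_le_of_liminf (φ := realEnergy E) (D := dom E) ht.1.le (fun s hs => hu.mem hs) hm
      (hc.continuousOn.continuousAt (Icc_mem_nhds htH.1 htH.2)) hd
      (fun η hη => eventually_sub_le_of_localSlope h1 h2 ht.1.le hut hfin hη)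
      (hreg.liminf_ge t ht.1.le (u t) hut)
  -- From `m² ≤ p - e' ≤ G m` and `0 ≤ G ≤ m`: cancel `m` if it is positive; otherwise both are `0`.
  have hGeq : G = m := by
    rcases hm0.eq_or_lt with h0 | h0
    · linarith
    · refine le_antisymm hGm (le_of_mul_le_mul_right ?_ h0)
      nlinarith
  refine ⟨hm0, ?_, ?_⟩
  · rw [← hGeq, hG, ENNReal.ofReal_toReal hfin]
  · have : e' = p - m ^ 2 := by
      rw [hGeq] at hlower
      nlinarith
    rwa [← this]

theorem ae_restrict_Icc_of_forall_nat {p : ℝ → Prop}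
    (h : ∀ T : ℕ, ∀ᵐ t, t ∈ Ioo 0 (T : ℝ) → p t) (T : ℝ) :
    ∀ᵐ t ∂(volume.restrict (Icc 0 T)), p t := by
  rw [← restrict_Ioo_eq_restrict_Icc]
  exact ae_restrict_of_ae_restrict_of_subset Ioo_subset_Ioi_self (ae_Ioi_of_forall_nat h)

/-- Measurability of the slope along `u` is inherited, like integrability, from its
almost-everywhere equality with the metric derivative. -/
theorem IsEVISolution.memLp_localSlope (hu : IsEVISolution E o B u) (h1 : HypE1 E)
    (h2 : HypE2 E) (hreg : TimeRegular E) {T : ℝ} (hT : 0 < T) :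
    MemLp (fun t => localSlope (E t) (u t)) 2 (volume.restrict (Icc 0 T)) := by
  have hm := hu.memLp_metricDeriv hT
  have hae : (fun t => ‖metricDeriv u t‖ₑ) =ᵐ[volume.restrict (Icc 0 T)]
      fun t => localSlope (E t) (u t) := by
    refine ae_restrict_Icc_of_forall_nat (fun N => ?_) T
    filter_upwards [hu.ae_energy_identity h1 h2 hreg N] with t ht htI
    obtain ⟨h3, h4, -⟩ := ht htI
    rw [h4, Real.enorm_eq_ofReal h3]
  exact (memLp_congr_ae hae).1 hm.enorm

/-- The partial time derivative is almost everywhere `e' + |u'|²`, hence integrable. Half of `|u'|²`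
is then rewritten as half the squared slope. -/
theorem IsEVISolution.energy_identity (hu : IsEVISolution E o B u) (h1 : HypE1 E)
    (h2 : HypE2 E) (hreg : TimeRegular E) {t : ℝ} (ht : 0 ≤ t) :
    IntervalIntegrable (fun s => timeDeriv E s (u s)) volume 0 t ∧
      (E t (u t)).toReal - (E 0 (u 0)).toReal =
        (∫ s in (0 : ℝ)..t, timeDeriv E s (u s))
          - 1 / 2 * (∫ s in (0 : ℝ)..t, metricDeriv u s ^ 2)
          - 1 / 2 * (∫ s in (0 : ℝ)..t, (localSlope (E s) (u s)).toReal ^ 2) := by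
  have hAC := hu.energy_absolutelyContinuous ht
  have hm := (hu.intervalIntegrable_metricDeriv ht).2
  have hd := hAC.intervalIntegrable_deriv
  have hae := ae_restrict_Icc_of_forall_nat (hu.ae_energy_identity h1 h2 hreg) t
  have hae' := ae_restrict_of_ae_restrict_of_subset Ioc_subset_Icc_self hae
  rw [← uIoc_of_le ht] at hae'
  have e1 : (fun s => deriv (fun s => (E s (u s)).toReal) s + metricDeriv u s ^ 2)
      =ᵐ[volume.restrict (uIoc 0 t)] fun s => timeDeriv E s (u s) := by
    filter_upwards [hae'] with s hs
    rw [hs.2.2.deriv]; ring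
  have e2 : (fun s => metricDeriv u s ^ 2) =ᵐ[volume.restrict (uIoc 0 t)]
      fun s => (localSlope (E s) (u s)).toReal ^ 2 := by
    filter_upwards [hae'] with s hs
    rw [hs.2.1, ENNReal.toReal_ofReal hs.1]
  refine ⟨(hd.add hm).congr_ae e1, ?_⟩
  rw [← intervalIntegral.integral_congr_ae_restrict e1,
    ← intervalIntegral.integral_congr_ae_restrict e2, intervalIntegral.integral_add hd hm,
    hAC.integral_deriv_eq_sub]
  ring

theorem IsEVISolution.isSolution (hu : IsEVISolution E o B u) (h1 : HypE1 E) (h2 : HypE2 E)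
    (hreg : TimeRegular E) (hu0 : u 0 = o) : IsSolution E o u where
  locAbsCont := hu.locAbsCont
  initial := hu0
  mem_dom t ht := (mem_dom_iff h2 ht).1 (hu.mem ht)
  energy_locAbsCont T hT := hu.energy_absolutelyContinuous hT.le
  metricDeriv_sq T hT := hu.memLp_metricDeriv hT
  slope_sq T hT := hu.memLp_localSlope h1 h2 hreg hT
  inequality := by
    filter_upwards [ae_Ioi_of_forall_nat (hu.ae_energy_identity h1 h2 hreg)] with t ht
    refine ⟨_, ht.2.2, ?_⟩
    rw [ht.2.1, ENNReal.toReal_ofReal ht.1]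
    linarith

end Global

end TimeGradFlow

open TimeGradFlow
theorem mainTheorem2 {X : Type*} [MetricSpace X] [CompleteSpace X]
    [TopologicalSpace.SeparableSpace X] (E : ℝ → X → EReal)
    (hE1 : HypE1 E) (hE2 : HypE2 E) (hE3 : HypE3 E) (hE4 : HypE4 E) (hE5 : HypE5 E)
    (u₀ : X) (hu₀ : u₀ ∈ dom E)
    (U0 : TimePartition → X) (hU0 : Tendsto U0 meshToZero (𝓝 u₀))
    (hS : ∃ S : ℝ, ∀ P, E 0 (U0 P) ≤ (S : EReal)) :
    (∃ u : ℝ → X, IsSchemeLimit E U0 u) ∧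
    ∀ u : ℝ → X, IsSchemeLimit E U0 u →
      (LocAbsCont u ∧
        (∀ᵐ t ∂(volume.restrict (Ioi (0 : ℝ))),
          Tendsto (fun s => dist (u s) (u t) / |s - t|) (𝓝[≠] t) (𝓝 (metricDeriv u t))) ∧
        ∀ T, 0 < T → MemLp (metricDeriv u) 2 (volume.restrict (Icc 0 T))) ∧
      (TimeRegular E →
        (∀ t, 0 ≤ t → E t (u t) < ⊤) ∧
        LocAbsCont (fun t => (E t (u t)).toReal) ∧
        (∀ T, 0 < T →
          MemLp (fun t => localSlope (E t) (u t)) 2 (volume.restrict (Icc 0 T))) ∧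
        (∀ t, 0 ≤ t →
          IntervalIntegrable (fun s => timeDeriv E s (u s)) volume 0 t ∧
          (E t (u t)).toReal - (E 0 (u 0)).toReal =
            (∫ s in (0 : ℝ)..t, timeDeriv E s (u s))
              - 1 / 2 * (∫ s in (0 : ℝ)..t, metricDeriv u s ^ 2)
              - 1 / 2 * (∫ s in (0 : ℝ)..t, (localSlope (E s) (u s)).toReal ^ 2)) ∧
        IsSolution E u₀ u) := by
  obtain ⟨B, hB⟩ := exists_localHyp hE1 hE2 hE3 hE4 hE5 hu₀
  obtain ⟨w, hw0, hw⟩ := exists_global_eviCurve hB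
  have hlim := isSchemeLimit_of_eviCurve hE1 hE2 hu₀ hU0 hw0 hw
  refine ⟨⟨w, hlim⟩, fun u hulim => ?_⟩
  -- Scheme limits are determined on `[0,∞)` only. Agreement there transfers the variational
  -- inequality from `w` to `u`, and the remaining conclusions are drawn for `u` itself.
  have heq := hlim.eqOn hulim
  have hu0 : u 0 = u₀ := (heq self_mem_Ici).symm.trans hw0
  have hu : IsEVISolution E u₀ B u := fun T hT => by
    obtain ⟨A, κ, C, hC, h, hc⟩ := hw T hT
    exact ⟨A, κ, C, hC, h, hc.congr (heq.mono Icc_subset_Ici_self)⟩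
  refine ⟨⟨hu.locAbsCont, hu.ae_metricDeriv, fun T hT => hu.memLp_metricDeriv hT⟩, fun hreg => ?_⟩
  exact ⟨fun t ht => (mem_dom_iff hE2 ht).1 (hu.mem ht),
    fun T hT => hu.energy_absolutelyContinuous hT.le,
    fun T hT => hu.memLp_localSlope hE1 hE2 hreg hT,
    fun t ht => hu.energy_identity hE1 hE2 hreg ht, hu.isSolution hE1 hE2 hreg hu0⟩
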